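/- Let $N\ge 2$, let $F_N$ be the free group on a basis $A$ with $|A|=N$, let $X$ be its Cayley graph with respect to $A$ (a tree) and $\partial X$ its boundary, i.e. the set of equivalence classes of geodesic rays. The topology of $\partial X$ is generated by the cylinders $\mathrm{Cyl}(e)$ of oriented edges $e$, where $\mathrm{Cyl}(e)$ consists of the classes of the geodesic rays that start with $e$. Let $\mathcal C_N$ be the space of closed subsets of $\partial X$ with at least two points, with the Vietoris topology. A subset current is an $F_N$-invariant Borel measure on $\mathcal C_N$ which is finite on compact sets. Let $\mathcal S\mathrm{Curr}(F_N)$ be the space of subset currents, with the weak-$*$ topology (the coarsest one making $\mu\mapsto\int f\,d\mu$ continuous for every compactly supported continuous $f:\mathcal C_N\to\mathbb R$) and with addition and multiplication by scalars in $\mathbb R_{\ge0}$; linearity refers to these operations. For a nontrivial finitely generated $H\le F_N$ let $\widehat H$ be its commensurator in $F_N$ and put $\eta_H=[\widehat H:H]\sum_{H'}\delta_{\Lambda(H')}$, where $H'$ runs over the conjugates of $\widehat H$ in $F_N$ and $\Lambda(H')\subset\partial X$ is the limit set; put $\eta_{\{1\}}=0$. For a finite subtree $T$ of $X$ with at least two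 vertices, $\mathrm{SCyl}(T)$ is the set of $S\in\mathcal C_N$ that are contained in the union of the cylinders $\mathrm{Cyl}(e)$ and meet each of them, $e$ running over the oriented edges of $T$ whose terminal vertex has degree one in $T$. For $a\in A$ let $e_a$ be the edge $\{1,a\}$. Let $\mathcal R_1$ be the set of finite subtrees $T\ni 1$ in which $1$ has degree at least two and all degree-one vertices are at distance $1$ from $1$. Put $$V(\mu)=\sum_{T\in\mathcal R_1}\mu(\mathrm{SCyl}(T)),\qquad \overline{\mathrm{rk}}(\mu)=\sum_{a\in A}\mu(\mathrm{SCyl}(e_a))-V(\mu).$$ For a finite non-empty subtree $T$ let $\mathcal R(T)$ be the set of $(S_1,S_2)\in\mathcal C_N\times\mathcal C_N$ with $\mathrm{Conv}(S_1)\cap\mathrm{Conv}(S_2)=T$, where $\mathrm{Conv}(S)$ is the union of the bi-infinite geodesics of $X$ joining points of $S$. Put $$\widehat c(\mu,\nu)=\sum_{[T]}(\mu\times\nu)(\mathcal R(T)),\qquad \mathcal N(\mu,\nu)=\sum_{a\in A}\mu(\mathrm{SCyl}(e_a))\,\nu(\mathrm{SCyl}(e_a))-V(\mu)V(\nu)+\widehat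 c(\mu,\nu),$$ where $[T]$ runs over the finite non-empty subtrees $T\ni1$ (including $\{1\}$) up to translation by $F_N$. **Theorem.** 1. For every finitely generated $H\le F_N$, $\eta_H$ is a subset current. For every Borel set $U\subset\mathcal C_N$ the set $I^{-1}(U)=\{(S_1,S_2)\in\mathcal C_N\times\mathcal C_N: S_1\cap S_2\in U\}$ is measurable for the product $\sigma$-algebra. 2. For all $\mu,\nu\in\mathcal S\mathrm{Curr}(F_N)$, the formula $\widehat I(\mu,\nu)(U)=(\mu\times\nu)(I^{-1}(U))$, $U\subset\mathcal C_N$ Borel, defines a subset current. The map $\widehat I:\mathcal S\mathrm{Curr}(F_N)\times\mathcal S\mathrm{Curr}(F_N)\to\mathcal S\mathrm{Curr}(F_N)$ is bilinear and not continuous, and for all finitely generated $H,K\le F_N$ $$\widehat I(\eta_H,\eta_K)=\sum_{HgK\in H\backslash F_N/K}\eta_{H\cap gKg^{-1}}.\qquad(*)$$ 3. For all $\mu,\nu\in\mathcal S\mathrm{Curr}(F_N)$, $\widehat c(\mu,\nu)<\infty$ and $\overline{\mathrm{rk}}(\widehat I(\mu,\nu))=\mathcal N(\mu,\nu)$. 4.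 No bilinear map $\mathcal S\mathrm{Curr}(F_N)\times\mathcal S\mathrm{Curr}(F_N)\to\mathcal S\mathrm{Curr}(F_N)$ with the values $(*)$ on the counting currents is continuous. -/

import Mathlib

open MeasureTheory Topology
open scoped NNReal ENNReal CompactlySupported

namespace SubsetCurrents

noncomputable section

/-! ### The Cayley tree and its boundary -/

/-- The free group `F_N` with its standard free basis. -/
abbrev F (N : ℕ) : Type := FreeGroup (Fin N)

/-- The Cayley graph `X` of `F_N` with respect to the free basis: `g` is adjacent to `g * a` for
every basis element `a`. -/
abbrev cayley (N : ℕ) : SimpleGraph (F N) :=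
  SimpleGraph.mulCayley (Set.range (FreeGroup.of : Fin N → F N))

/-- Geodesic rays in `X` for the path metric, recorded by their vertices. -/
def Ray (N : ℕ) : Type :=
  {r : ℕ → F N // ∀ m n : ℕ, (cayley N).dist (r m) (r (m + n)) = n}

/-- Two geodesic rays in the tree `X` are equivalent if they eventually coincide, up to a shift of
the parameter. -/
instance raySetoid (N : ℕ) : Setoid (Ray N) where
  r x y := ∃ a b : ℕ, ∀ k : ℕ, x.1 (a + k) = y.1 (b + k)
  iseqv :=
    { refl := fun _ => ⟨0, 0, fun _ => rfl⟩
      symm := fun ⟨a, b, h⟩ => ⟨b, a, fun k => (h k).symm⟩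
      trans := by
        rintro x y z ⟨a, b, h⟩ ⟨c, d, h'⟩
        refine ⟨a + c, d + b, fun k => ?_⟩
        have h1 := h (c + k)
        have h2 := h' (b + k)
        rw [show a + c + k = a + (c + k) by omega, h1,
          show b + (c + k) = c + (b + k) by omega, h2, show d + (b + k) = d + b + k by omega] }

/-- The boundary `∂X` of the tree `X`: equivalence classes of geodesic rays. -/
def Boundary (N : ℕ) : Type := Quotient (raySetoid N)

/-- The endpoint of a geodesic ray. -/
def Ray.endpoint {N : ℕ} (r : Ray N) : Boundary N := Quotient.mk (raySetoid N) r

/-- The cylinder of the oriented edge from `u` to `v`: the endpoints of the geodesic rays which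
start by running through this edge. -/
def Cyl {N : ℕ} (u v : F N) : Set (Boundary N) :=
  {ξ | ∃ r : Ray N, r.1 0 = u ∧ r.1 1 = v ∧ r.endpoint = ξ}

/-- The topology of `∂X`, generated by the cylinders. -/
instance (N : ℕ) : TopologicalSpace (Boundary N) :=
  TopologicalSpace.generateFrom {U | ∃ u v : F N, (cayley N).Adj u v ∧ U = Cyl u v}

/-! ### The action of `F_N` -/

theorem cayley_dist_mul {N : ℕ} (g u v : F N) :
    (cayley N).dist (g * u) (g * v) = (cayley N).dist u v := by
  have key : ∀ g u v : F N, (cayley N).Reachable u v →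
      (cayley N).dist (g * u) (g * v) ≤ (cayley N).dist u v ∧
        (cayley N).Reachable (g * u) (g * v) := by
    intro g u v h
    let f : cayley N →g cayley N :=
      ⟨fun x => g * x, fun {a b} hab => SimpleGraph.mulCayley_adj_mul_iff_right.2 hab⟩
    obtain ⟨p, hp⟩ := h.exists_walk_length_eq_dist
    refine ⟨?_, ⟨p.map f⟩⟩
    rw [← hp, ← SimpleGraph.Walk.length_map f p]
    exact SimpleGraph.dist_le _
  by_cases h : (cayley N).Reachable u v
  · have h1 := key g u v h
    have h2 := key g⁻¹ _ _ h1.2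
    simp only [inv_mul_cancel_left] at h2
    exact le_antisymm h1.1 h2.1
  · have h' : ¬ (cayley N).Reachable (g * u) (g * v) := fun h' => by
      have h2 := (key g⁻¹ _ _ h').2
      simp only [inv_mul_cancel_left] at h2
      exact h h2
    rw [SimpleGraph.dist_eq_zero_of_not_reachable h, SimpleGraph.dist_eq_zero_of_not_reachable h']

/-- Left translation of geodesic rays. -/
def Ray.translate {N : ℕ} (g : F N) (r : Ray N) : Ray N :=
  ⟨fun n => g * r.1 n, fun m n => by rw [cayley_dist_mul]; exact r.2 m n⟩

/-- The left action of `F_N` on `∂X`, induced by left translation of rays. -/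
instance (N : ℕ) : MulAction (F N) (Boundary N) where
  smul g := Quotient.map (Ray.translate g)
    (fun _ _ ⟨a, b, h⟩ => ⟨a, b, fun k => congrArg (g * ·) (h k)⟩)
  one_smul := by
    rintro ⟨r⟩
    exact congrArg (Quotient.mk (raySetoid N)) (Subtype.ext (funext fun n => one_mul (r.1 n)))
  mul_smul := by
    rintro g h ⟨r⟩
    exact congrArg (Quotient.mk (raySetoid N)) (Subtype.ext (funext fun n => mul_assoc g h (r.1 n)))

theorem smul_endpoint {N : ℕ} (g : F N) (r : Ray N) :
    g • r.endpoint = (r.translate g).endpoint := rfl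

theorem smul_mem_Cyl {N : ℕ} (g u v : F N) (ξ : Boundary N) :
    g • ξ ∈ Cyl u v ↔ ξ ∈ Cyl (g⁻¹ * u) (g⁻¹ * v) := by
  constructor
  · rintro ⟨r, h0, h1, h⟩
    refine ⟨r.translate g⁻¹, ?_, ?_, ?_⟩
    · simp [Ray.translate, h0]
    · simp [Ray.translate, h1]
    · rw [← smul_endpoint, h, inv_smul_smul]
  · rintro ⟨r, h0, h1, rfl⟩
    exact ⟨r.translate g, by simp [Ray.translate, h0], by simp [Ray.translate, h1], rfl⟩

instance (N : ℕ) : ContinuousConstSMul (F N) (Boundary N) where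
  continuous_const_smul g := by
    refine continuous_generateFrom_iff.2 ?_
    rintro _ ⟨u, v, huv, rfl⟩
    have : (fun ξ : Boundary N => g • ξ) ⁻¹' Cyl u v = Cyl (g⁻¹ * u) (g⁻¹ * v) :=
      Set.ext fun ξ => smul_mem_Cyl g u v ξ
    rw [this]
    exact TopologicalSpace.isOpen_generateFrom_of_mem
      ⟨_, _, SimpleGraph.mulCayley_adj_mul_iff_right.2 huv, rfl⟩

/-! ### The space `C_N` and subset currents -/

/-- `C_N`: the closed subsets of `∂X` with at least two points. -/
def ClosedSets (N : ℕ) : Type := {S : Set (Boundary N) // IsClosed S ∧ S.Nontrivial}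

/-- The subspace topology from the Vietoris topology. -/
instance (N : ℕ) : TopologicalSpace (ClosedSets N) :=
  TopologicalSpace.induced Subtype.val (TopologicalSpace.vietoris (Boundary N))

instance (N : ℕ) : MeasurableSpace (ClosedSets N) := borel _

instance (N : ℕ) : BorelSpace (ClosedSets N) := ⟨rfl⟩

/-- The translate `g S` of `S ∈ C_N`. -/
def ClosedSets.translate {N : ℕ} (g : F N) (S : ClosedSets N) : ClosedSets N :=
  ⟨(fun ξ => g • ξ) '' S.1, (Homeomorph.smul g).isClosedMap _ S.2.1,
    S.2.2.image (MulAction.injective g)⟩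

/-- The space `SCurr(F_N)` of subset currents: the Borel measures on `C_N` which are finite on
compact sets and invariant under `F_N`, with the `ℝ≥0`-linear structure of measures. -/
def SCurr (N : ℕ) : Submodule ℝ≥0 (Measure (ClosedSets N)) where
  carrier := {μ | (∀ K : Set (ClosedSets N), IsCompact K → μ K < ∞) ∧
    ∀ (g : F N) (U : Set (ClosedSets N)), MeasurableSet U →
      μ (ClosedSets.translate g ⁻¹' U) = μ U}
  add_mem' := by
    rintro μ ν ⟨h1, h2⟩ ⟨h3, h4⟩
    refine ⟨fun K hK => ?_, fun g U hU => ?_⟩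
    · rw [Measure.add_apply]
      exact ENNReal.add_lt_top.2 ⟨h1 K hK, h3 K hK⟩
    · rw [Measure.add_apply, Measure.add_apply, h2 g U hU, h4 g U hU]
  zero_mem' := ⟨fun K _ => by simp, fun g U _ => by simp⟩
  smul_mem' := by
    rintro c μ ⟨h1, h2⟩
    refine ⟨fun K hK => ?_, fun g U hU => ?_⟩
    · rw [Measure.smul_apply]
      exact ENNReal.mul_lt_top ENNReal.coe_lt_top (h1 K hK)
    · rw [Measure.smul_apply, Measure.smul_apply, h2 g U hU]

/-- The weak-* topology: the coarsest one making `μ ↦ ∫ f dμ` continuous for every compactly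
supported continuous function `f` on `C_N`. -/
instance (N : ℕ) : TopologicalSpace (SCurr N) :=
  TopologicalSpace.induced
    (fun (μ : SCurr N) (f : C_c(ClosedSets N, ℝ)) => ∫ S, f S ∂(μ : Measure (ClosedSets N)))
    inferInstance

/-! ### Limit sets and counting currents -/

/-- Convergence of a sequence of vertices of `X` to a point `ξ ∈ ∂X` in `X ∪ ∂X`: for every
oriented edge `(u, v)` with `ξ ∈ Cyl u v`, the sequence eventually stays in the half-tree that
this edge points to. -/
def TendstoBoundary {N : ℕ} (h : ℕ → F N) (ξ : Boundary N) : Prop :=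
  ∀ u v : F N, (cayley N).Adj u v → ξ ∈ Cyl u v →
    ∀ᶠ n in Filter.atTop, (cayley N).dist v (h n) < (cayley N).dist u (h n)

/-- The limit set `Λ(H) ⊆ ∂X`. -/
def limitSet {N : ℕ} (H : Subgroup (F N)) : Set (Boundary N) :=
  {ξ | ∃ h : ℕ → F N, (∀ n, h n ∈ H) ∧ TendstoBoundary h ξ}

/-- The conjugate subgroup `g H g⁻¹`. -/
def conjSubgroup {N : ℕ} (g : F N) (H : Subgroup (F N)) : Subgroup (F N) :=
  H.map (MulAut.conj g).toMonoidHom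

/-- The counting measure `∑ δ_{Λ(H')}` on `C_N`, over the conjugates `H'` of `H`. The sum runs over
the pairs `(H', S)` with `H'` conjugate to `H` and `S ∈ C_N` equal to `Λ(H')`. -/
def conjCounting {N : ℕ} (H : Subgroup (F N)) : Measure (ClosedSets N) :=
  Measure.sum fun p : {p : Subgroup (F N) × ClosedSets N //
      (∃ g : F N, p.1 = conjSubgroup g H) ∧ p.2.1 = limitSet p.1} =>
    Measure.dirac p.1.2

open Classical in
/-- The counting subset current `η_H = [Ĥ : H] ∑_{H' ∈ [Ĥ]} δ_{Λ(H')}`, where `Ĥ` is the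
commensurator of `H` in `F_N`; for the trivial subgroup it is `0`. -/
def counting {N : ℕ} (H : Subgroup (F N)) : Measure (ClosedSets N) :=
  if H = ⊥ then 0
  else H.relIndex (Subgroup.Commensurable.commensurator H) •
    conjCounting (Subgroup.Commensurable.commensurator H)

/-- The measure `∑_{HgK} η_{H ∩ gKg⁻¹}` over the double cosets `HgK ∈ H \ F_N / K`. -/
def doubleCosetSum {N : ℕ} (H K : Subgroup (F N)) : Measure (ClosedSets N) :=
  Measure.sum fun d : DoubleCoset.Quotient (H : Set (F N)) (K : Set (F N)) =>
    counting (H ⊓ conjSubgroup (Quotient.out d) K)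

/-- A bilinear map `Φ` on subset currents such that
`Φ(η_H, η_K) = ∑_{HgK} η_{H ∩ gKg⁻¹}` for all finitely generated `H, K ≤ F_N`. -/
def ExtendsProduct {N : ℕ} (Φ : SCurr N →ₗ[ℝ≥0] SCurr N →ₗ[ℝ≥0] SCurr N) : Prop :=
  ∀ H K : Subgroup (F N), H.FG → K.FG → ∀ μ ν : SCurr N,
    (μ : Measure (ClosedSets N)) = counting H → (ν : Measure (ClosedSets N)) = counting K →
      (Φ μ ν : Measure (ClosedSets N)) = doubleCosetSum H K

/-! ### Finite subtrees, subset cylinders and round graphs -/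

/-- `T` is the vertex set of a non-empty finite subtree of `X`. (A subtree of a tree is the subgraph
induced on its vertices.) -/
def IsFinSubtree {N : ℕ} (T : Finset (F N)) : Prop :=
  ((cayley N).induce (T : Set (F N))).IsTree

/-- The degree of the vertex `v` in the finite subtree on `T`. -/
def degIn {N : ℕ} (T : Finset (F N)) (v : F N) : ℕ :=
  {u : F N | u ∈ T ∧ (cayley N).Adj v u}.ncard

/-- `(u, v)` is a terminal edge of `T`: an oriented edge of `T` whose terminal vertex has degree
one in `T`. -/
def IsTerminalEdge {N : ℕ} (T : Finset (F N)) (u v : F N) : Prop :=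
  u ∈ T ∧ v ∈ T ∧ (cayley N).Adj u v ∧ degIn T v = 1

/-- The subset cylinder `SCyl(T) ⊆ C_N` of a finite subtree `T` with at least two vertices. -/
def SCyl {N : ℕ} (T : Finset (F N)) : Set (ClosedSets N) :=
  {S | (∀ ξ ∈ S.1, ∃ u v, IsTerminalEdge T u v ∧ ξ ∈ Cyl u v) ∧
    ∀ u v, IsTerminalEdge T u v → (S.1 ∩ Cyl u v).Nonempty}

/-- The edge `e_a` with endpoints `1` and `a`, as a subtree. -/
def edge {N : ℕ} (a : Fin N) : Finset (F N) := {1, FreeGroup.of a}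

/-- The based round graphs of grade `r` with base point `1`: the finite subtrees `T ∋ 1` with at
least two vertices such that `1` has degree more than one in `T` and every vertex of degree one of
`T` is at distance `r` from `1`. -/
def roundGraphs (N r : ℕ) : Set (Finset (F N)) :=
  {T | IsFinSubtree T ∧ 2 ≤ T.card ∧ 1 ∈ T ∧ 1 < degIn T 1 ∧
    ∀ u ∈ T, degIn T u = 1 → (cayley N).dist 1 u = r}

/-! ### The reduced rank functional -/

/-- `E(μ) = ∑_a μ(SCyl(e_a))`. -/
def edgeFunctional {N : ℕ} (μ : SCurr N) : ℝ :=
  ∑ a : Fin N, (μ : Measure (ClosedSets N)).real (SCyl (edge a))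

/-- `V(μ) = ∑_T μ(SCyl(T))`, over the finitely many based round graphs `T` of grade one. -/
def vertexFunctional {N : ℕ} (μ : SCurr N) : ℝ :=
  ∑ᶠ T ∈ roundGraphs N 1, (μ : Measure (ClosedSets N)).real (SCyl T)

/-- The reduced rank functional `E - V`. -/
def reducedRank {N : ℕ} (μ : SCurr N) : ℝ := edgeFunctional μ - vertexFunctional μ

/-! ### The intersection functional -/

/-- The vertex set of the convex hull of `S ⊆ ∂X` in `X`: the vertices of the bi-infinite geodesics
both of whose endpoints are in `S`. Such a geodesic through `v` consists of two rays `r`, `s` from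
`v` whose concatenation is geodesic. -/
def Conv {N : ℕ} (S : Set (Boundary N)) : Set (F N) :=
  {v | ∃ r s : Ray N, r.1 0 = v ∧ s.1 0 = v ∧
    (∀ m n : ℕ, (cayley N).dist (r.1 m) (s.1 n) = m + n) ∧ r.endpoint ∈ S ∧ s.endpoint ∈ S}

/-- `R(T)`: the pairs `(S₁, S₂)` with `Conv(S₁) ∩ Conv(S₂) = T`. -/
def meetIn {N : ℕ} (T : Finset (F N)) : Set (ClosedSets N × ClosedSets N) :=
  {p | Conv p.1.1 ∩ Conv p.2.1 = (T : Set (F N))}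

/-- The finite subtrees of `X` containing the vertex `1` (including `{1}`). -/
def BasedSubtree (N : ℕ) : Type := {T : Finset (F N) // IsFinSubtree T ∧ 1 ∈ T}

/-- Based subtrees `T₁`, `T₂` are equivalent if `g T₁ = T₂` for some `g ∈ F_N`. -/
instance basedSetoid (N : ℕ) : Setoid (BasedSubtree N) where
  r T₁ T₂ := ∃ g : F N, (fun x => g * x) '' (T₁.1 : Set (F N)) = (T₂.1 : Set (F N))
  iseqv :=
    { refl := fun _ => ⟨1, by simp⟩
      symm := by
        rintro T₁ T₂ ⟨g, h⟩
        refine ⟨g⁻¹, ?_⟩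
        rw [← h, Set.image_image]
        simp
      trans := by
        rintro T₁ T₂ T₃ ⟨g, h⟩ ⟨g', h'⟩
        refine ⟨g' * g, ?_⟩
        rw [← h', ← h, Set.image_image]
        simp [mul_assoc] }

/-- `ĉ(μ, ν) = ∑_{[T]} (μ × ν)(R(T))`, over the `F_N`-classes of based subtrees. The value at a
representative does not depend on the representative, by invariance of `μ × ν`. -/
def contractibleFunctional {N : ℕ} (μ ν : SCurr N) : ℝ≥0∞ :=
  ∑' c : Quotient (basedSetoid N),
    ((μ : Measure (ClosedSets N)).prod (ν : Measure (ClosedSets N))) (meetIn c.out.1)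

/-- The intersection functional `𝒩 = Ê - V̂ + ĉ`, where
`Ê(μ, ν) = ∑_a μ(SCyl(e_a)) ν(SCyl(e_a))` and `V̂(μ, ν) = V(μ) V(ν)`. -/
def intersectionFunctional {N : ℕ} (μ ν : SCurr N) : ℝ :=
  (∑ a : Fin N, (μ : Measure (ClosedSets N)).real (SCyl (edge a)) *
      (ν : Measure (ClosedSets N)).real (SCyl (edge a)))
    - vertexFunctional μ * vertexFunctional ν + (contractibleFunctional μ ν).toReal

/-! ### The intersection map -/

/-- The preimage of `U ⊆ C_N` under the intersection map `(S₁, S₂) ↦ S₁ ∩ S₂`. -/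
def interPreimage {N : ℕ} (U : Set (ClosedSets N)) : Set (ClosedSets N × ClosedSets N) :=
  {p | ∃ S ∈ U, S.1 = p.1.1 ∩ p.2.1}

end

end SubsetCurrents

namespace SubsetCurrents

noncomputable section

variable {N : ℕ}

/-! ### Geometry of the Cayley tree -/

/-! Everything is reduced to directions. A point ξ of ∂X is determined by the neighbours `dir v ξ`
through which the rays from the vertices v leave, and these functions form a closed subset of a
product of finite sets (`isClosedEmbedding_flow`). A vertex v is in the hull of S exactly when
points of S leave v in different directions. Hence the sets `hullSet v` are open and compact
(`isCompact_hullSet`); they cover the space of closed sets, so finiteness on compact sets need only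
be tested on them (`mem_SCurr`).

Measurability of the intersection map rests on `isClosed_meetSet`: if S₁ ∩ S₂ misses a closed set,
so do the intersections of nearby pairs. If v is in the hull of S₁ ∩ S₂ then it is in both hulls, so
the push-forward of μ × ν is finite on each `hullSet v`; invariance is inherited from the diagonal
action.

For the values on counting currents, finitely generated subgroups act cofinitely on the hulls of
their limit sets (`isQuasiconvex_of_fg`). It follows that the commensurator of a nontrivial H is the
stabilizer of Λ(H), that η_H is the sum of the Dirac measures at gΛ(H) over cosets gH
(`IsQuasiconvex.counting_eq`), and that Λ(H ∩ K) = Λ(H) ∩ Λ(K) (`limitSet_inf`). The product formula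
is then the bijection between pairs of cosets and double cosets together with cosets of H ∩ dKd⁻¹
(`bijective_coset_pairs`).

The rank formula is an Euler characteristic count. Let Y be the intersection of the hulls of S₁ and
S₂. It contains the hull of S₁ ∩ S₂. Every other vertex of Y has exactly one edge of Y leading
towards that hull, or towards the only point of S₁ ∩ S₂, or, if S₁ ∩ S₂ is empty, towards a root of
the finite tree Y chosen equivariantly; only the root itself has no outgoing edge. Conversely each
edge of Y outside the hull of S₁ ∩ S₂ is outgoing at exactly one end. Measuring the edges e_a gives
`edge_identity`, measuring the vertex 1 gives `vertex_identity`. By invariance the same total flow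
occurs in both, and the roots contribute ĉ; subtracting gives the formula.

Discontinuity: for distinct basis elements a, b the currents η_{⟨aⁿb⟩} / (n + 1) converge to
η_{⟨a⟩}, because for large n most translates of the axis of aⁿb that pass through 1 follow the axis
of a for a long time in both directions (`tendsto_averagedCurrent`). But ⟨aⁿb⟩ meets every conjugate
of ⟨a⟩ trivially, as the exponent sum of b shows. So the product with η_{⟨a⟩} vanishes along the
sequence, while at the limit it is at least η_{⟨a⟩}, which is not zero. Only bilinearity and the
values on counting currents are used. -/

theorem adj_iff_exists_letter {u v : F N} :
    (cayley N).Adj u v ↔ ∃ x : Fin N × Bool, v = u * FreeGroup.mk [x] := by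
  rw [SimpleGraph.mulCayley_adj']
  constructor
  · rintro ⟨-, g, ⟨a, rfl⟩, h | h⟩
    · exact ⟨(a, true), h.symm⟩
    · refine ⟨(a, false), ?_⟩
      have : FreeGroup.mk [(a, false)] = (FreeGroup.of a)⁻¹ := rfl
      rw [this, h, mul_inv_cancel_right]
  · rintro ⟨⟨a, b⟩, rfl⟩
    refine ⟨fun h => ?_, FreeGroup.of a, ⟨a, rfl⟩, ?_⟩
    · have h1 : (FreeGroup.mk [(a, b)]).toWord = [] := by
        rw [FreeGroup.toWord_eq_nil_iff]; exact (mul_eq_left.1 h.symm)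
      simp at h1
    · cases b
      · right
        have : FreeGroup.mk [(a, false)] = (FreeGroup.of a)⁻¹ := rfl
        rw [this, inv_mul_cancel_right]
      · left; rfl

theorem toWord_letter_mul (x : Fin N × Bool) (g : F N) :
    (∃ t, g.toWord = (x.1, !x.2) :: t ∧ (FreeGroup.mk [x] * g).toWord = t) ∨
      (FreeGroup.mk [x] * g).toWord = x :: g.toWord := by
  have h : (FreeGroup.mk [x] * g).toWord = FreeGroup.reduce (x :: g.toWord) := by
    conv_lhs => rw [← FreeGroup.mk_toWord (x := g), FreeGroup.mul_mk, FreeGroup.toWord_mk]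
    rfl
  rw [h, FreeGroup.reduce.cons, FreeGroup.reduce_toWord]
  rcases hg : g.toWord with _ | ⟨y, t⟩
  · right; rfl
  · by_cases hxy : x.1 = y.1 ∧ x.2 = !y.2
    · left
      refine ⟨t, ?_, ?_⟩
      · rw [hxy.1, hxy.2]; simp
      · simp [hxy]
    · right
      simp [hxy]

theorem norm_le_length {u v : F N} (p : (cayley N).Walk u v) :
    FreeGroup.norm (u⁻¹ * v) ≤ p.length := by
  induction p with
  | nil => simp
  | @cons u w v h p ih =>
    obtain ⟨x, rfl⟩ := adj_iff_exists_letter.1 h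
    have : u⁻¹ * v = FreeGroup.mk [x] * ((u * FreeGroup.mk [x])⁻¹ * v) := by group
    rw [this, SimpleGraph.Walk.length_cons]
    refine (FreeGroup.norm_mul_le _ _).trans ?_
    have h1 : FreeGroup.norm (FreeGroup.mk [x]) ≤ 1 := FreeGroup.norm_mk_le
    omega

theorem exists_walk_mul_mk (L : List (Fin N × Bool)) (u : F N) :
    ∃ p : (cayley N).Walk u (u * FreeGroup.mk L), p.length = L.length := by
  induction L generalizing u with
  | nil => exact ⟨SimpleGraph.Walk.nil.copy rfl (by rw [← FreeGroup.one_eq_mk, mul_one]), by simp⟩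
  | cons x L ih =>
    obtain ⟨p, hp⟩ := ih (u * FreeGroup.mk [x])
    have h : u * FreeGroup.mk [x] * FreeGroup.mk L = u * FreeGroup.mk (x :: L) := by
      rw [mul_assoc, FreeGroup.mul_mk]; rfl
    exact ⟨SimpleGraph.Walk.cons (adj_iff_exists_letter.2 ⟨x, rfl⟩) (p.copy rfl h), by simp [hp]⟩

/-- The reduced word spells a walk of its own length, and one step of a walk changes the word length
by at most one. -/
theorem dist_eq_norm (u v : F N) : (cayley N).dist u v = FreeGroup.norm (u⁻¹ * v) := by
  obtain ⟨p, hp⟩ := exists_walk_mul_mk (u⁻¹ * v).toWord u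
  have e : u * FreeGroup.mk (u⁻¹ * v).toWord = v := by
    rw [FreeGroup.mk_toWord, mul_inv_cancel_left]
  apply le_antisymm
  · have := SimpleGraph.dist_le (p.copy rfl e)
    rwa [SimpleGraph.Walk.length_copy, hp] at this
  · obtain ⟨q, hq⟩ := (p.copy rfl e).reachable.exists_walk_length_eq_dist
    exact hq ▸ norm_le_length q

theorem cayley_connected : (cayley N).Connected := by
  refine (SimpleGraph.connected_iff _).2 ⟨fun u v => ?_, ⟨1⟩⟩
  obtain ⟨p, -⟩ := exists_walk_mul_mk (u⁻¹ * v).toWord u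
  rw [FreeGroup.mk_toWord, mul_inv_cancel_left] at p
  exact p.reachable

theorem dist_eq_zero {u v : F N} : (cayley N).dist u v = 0 ↔ u = v :=
  cayley_connected.dist_eq_zero_iff

theorem dist_adj {u v : F N} (h : (cayley N).Adj u v) : (cayley N).dist u v = 1 :=
  SimpleGraph.dist_eq_one_iff_adj.2 h

/-- The neighbour of `v` on the geodesic from `v` to `w` (and `v` itself if `w = v`). -/
def toward (v w : F N) : F N := v * FreeGroup.mk ((v⁻¹ * w).toWord.take 1)

@[simp] theorem toward_self (v : F N) : toward v v = v := by
  simp [toward, ← FreeGroup.one_eq_mk]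

theorem mul_toward (g v w : F N) : toward (g * v) (g * w) = g * toward v w := by
  simp [toward, mul_assoc]

theorem toward_adj {v w : F N} (h : v ≠ w) : (cayley N).Adj v (toward v w) := by
  rw [adj_iff_exists_letter]
  rcases hg : (v⁻¹ * w).toWord with _ | ⟨x, t⟩
  · rw [FreeGroup.toWord_eq_nil_iff, inv_mul_eq_one] at hg
    exact absurd hg h
  · exact ⟨x, by simp [toward, hg]⟩

/-- With v = ux, either v⁻¹w begins with x⁻¹ or the word of u⁻¹w is x followed by that of v⁻¹w. This
dichotomy carries the tree property in the later arguments. -/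
theorem toward_or {u v : F N} (h : (cayley N).Adj u v) (w : F N) :
    toward u w = v ∨ toward v w = u := by
  obtain ⟨x, rfl⟩ := adj_iff_exists_letter.1 h
  have e : u⁻¹ * w = FreeGroup.mk [x] * ((u * FreeGroup.mk [x])⁻¹ * w) := by group
  rcases toWord_letter_mul x ((u * FreeGroup.mk [x])⁻¹ * w) with ⟨t, h1, -⟩ | h1
  · right
    have : FreeGroup.mk [(x.1, !x.2)] = (FreeGroup.mk [x])⁻¹ := rfl
    rw [toward, h1, List.take_succ_cons, List.take_zero, this, mul_inv_cancel_right]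
  · left
    rw [toward, e, h1, List.take_succ_cons, List.take_zero]

theorem dist_toward {v w : F N} (h : v ≠ w) :
    (cayley N).dist (toward v w) w + 1 = (cayley N).dist v w := by
  rw [dist_eq_norm, dist_eq_norm]
  rcases hg : (v⁻¹ * w).toWord with _ | ⟨x, t⟩
  · rw [FreeGroup.toWord_eq_nil_iff, inv_mul_eq_one] at hg
    exact absurd hg h
  · have e : (toward v w)⁻¹ * w = FreeGroup.mk [(x.1, !x.2)] * (v⁻¹ * w) := by
      have : FreeGroup.mk [(x.1, !x.2)] = (FreeGroup.mk [x])⁻¹ := rfl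
      simp only [toward, hg, List.take_succ_cons, List.take_zero, this]
      group
    have h1 : FreeGroup.norm (v⁻¹ * w) = t.length + 1 := by rw [FreeGroup.norm, hg]; rfl
    rcases toWord_letter_mul (x.1, !x.2) (v⁻¹ * w) with ⟨s, h2, h3⟩ | h2
    · rw [hg] at h2
      simp only [List.cons.injEq] at h2
      rw [h1, e, FreeGroup.norm, h3, h2.2]
    · have h4 := FreeGroup.isReduced_toWord (x := FreeGroup.mk [(x.1, !x.2)] * (v⁻¹ * w))
      rw [h2, hg, FreeGroup.isReduced_cons_cons] at h4
      simpa using h4.1 rfl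

theorem dist_lt_iff_toward {u v : F N} (h : (cayley N).Adj u v) (w : F N) :
    (cayley N).dist v w < (cayley N).dist u w ↔ toward u w = v := by
  constructor
  · intro hlt
    rcases toward_or h w with h1 | h1
    · exact h1
    · by_cases hv : v = w
      · subst hv
        rcases eq_or_ne u v with h2 | h2
        · exact absurd h2 h.ne
        · exact absurd (h1.symm.trans (toward_self v)) h2
      · have := dist_toward hv
        rw [h1] at this
        omega
  · intro h1
    have hu : u ≠ w := by
      rintro rfl
      rw [toward_self] at h1
      exact h.ne h1
    have := dist_toward hu
    rw [h1] at this
    omega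

theorem toward_of_adj {u v : F N} (h : (cayley N).Adj u v) : toward u v = v := by
  rw [← dist_lt_iff_toward h, dist_adj h, dist_eq_zero.2 rfl]
  exact zero_lt_one

theorem toward_toward_ne {v w : F N} (h : v ≠ w) : toward (toward v w) w ≠ v := by
  intro h1
  have h2 := (dist_lt_iff_toward (toward_adj h) w).2 rfl
  have h3 := (dist_lt_iff_toward (toward_adj h).symm w).2 h1
  omega

theorem dist_triangle (u v w : F N) :
    (cayley N).dist u w ≤ (cayley N).dist u v + (cayley N).dist v w :=
  cayley_connected.dist_triangle

/-- If the directions differed, the path from `toward v w` to w' would pass through v, making w'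
closer to v than w; by symmetry w would also be closer than w'. -/
theorem toward_eq_of_adj {v w w' : F N} (h : (cayley N).Adj w w') (hw : v ≠ w) (hw' : v ≠ w') :
    toward v w = toward v w' := by
  by_contra hne
  have key : ∀ {w w' : F N}, (cayley N).Adj w w' → v ≠ w → v ≠ w' → toward v w ≠ toward v w' →
      (cayley N).dist v w' + 1 ≤ (cayley N).dist v w := by
    intro w w' h hw hw' hne
    have h1 : toward (toward v w) w' = v :=
      (toward_or (toward_adj hw) w').resolve_left (fun e => hne e.symm)
    have h2 := (dist_lt_iff_toward (toward_adj hw).symm w').2 h1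
    have h3 := dist_triangle (toward v w) w w'
    rw [dist_adj h] at h3
    have h4 := dist_toward hw
    omega
  have h1 := key h hw hw' hne
  have h2 := key h.symm hw' hw (Ne.symm hne)
  omega

/-- Every edge is a bridge: the side of the edge on which a vertex lies, read off from `toward u`,
cannot change along a walk that avoids the edge. -/
theorem cayley_isAcyclic : (cayley N).IsAcyclic := by
  rw [SimpleGraph.isAcyclic_iff_forall_adj_isBridge]
  intro u v huv
  rw [SimpleGraph.isBridge_iff]
  rintro ⟨p⟩
  have key : ∀ {x y : F N}, ((cayley N).deleteEdges {s(u, v)}).Walk x y →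
      (toward u x = v ↔ toward u y = v) := by
    intro x y p
    induction p with
    | nil => rfl
    | @cons x y z h p ih =>
      rw [← ih]
      rw [SimpleGraph.deleteEdges_adj] at h
      obtain ⟨hxy, he⟩ := h
      by_cases hx : u = x
      · subst hx
        have hyv : y ≠ v := by rintro rfl; exact he rfl
        rw [toward_self, toward_of_adj hxy]
        exact iff_of_false huv.ne hyv
      · by_cases hy : u = y
        · subst hy
          have hyv : x ≠ v := by rintro rfl; exact he (Sym2.eq_swap)
          rw [toward_self, toward_of_adj hxy.symm]
          exact iff_of_false hyv huv.ne
        · rw [toward_eq_of_adj hxy hx hy]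
  have := (key p).2 (toward_of_adj huv)
  rw [toward_self] at this
  exact huv.ne this

/-! ### Local finiteness -/

theorem finite_neighbors (v : F N) : {u : F N | (cayley N).Adj v u}.Finite := by
  refine (Set.finite_range fun x : Fin N × Bool => v * FreeGroup.mk [x]).subset ?_
  intro u hu
  obtain ⟨x, rfl⟩ := adj_iff_exists_letter.1 hu
  exact ⟨x, rfl⟩

theorem finite_ball (v : F N) (R : ℕ) : {u : F N | (cayley N).dist v u ≤ R}.Finite := by
  induction R with
  | zero =>
    refine (Set.finite_singleton v).subset fun u hu => ?_
    exact (dist_eq_zero.1 (Nat.le_zero.1 hu)).symm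
  | succ R ih =>
    refine (ih.union (ih.biUnion fun u _ => finite_neighbors u)).subset fun u hu => ?_
    by_cases h : u = v
    · left; subst h; simp
    · right
      have h1 := dist_toward h
      refine Set.mem_biUnion (x := toward u v) ?_ (toward_adj h).symm
      have : (cayley N).dist v u ≤ R + 1 := hu
      rw [SimpleGraph.dist_comm] at this
      change (cayley N).dist v (toward u v) ≤ R
      rw [SimpleGraph.dist_comm]
      omega

/-! ### Rays and directions -/

theorem Ray.adj (r : Ray N) (n : ℕ) : (cayley N).Adj (r.1 n) (r.1 (n + 1)) :=
  SimpleGraph.dist_eq_one_iff_adj.1 (r.2 n 1)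

theorem Ray.toward_of_lt (r : Ray N) {m n : ℕ} (h : m < n) :
    toward (r.1 m) (r.1 n) = r.1 (m + 1) := by
  obtain ⟨k, rfl⟩ := Nat.exists_eq_add_of_lt h
  rw [← dist_lt_iff_toward (r.adj m), show m + k + 1 = m + 1 + k by ring, r.2,
    show m + 1 + k = m + (k + 1) by ring, r.2]
  exact Nat.lt_succ_self k

theorem Ray.toward_of_gt (r : Ray N) {m n : ℕ} (h : m ≤ n) :
    toward (r.1 (n + 1)) (r.1 m) = r.1 n := by
  obtain ⟨k, rfl⟩ := Nat.exists_eq_add_of_le h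
  rw [← dist_lt_iff_toward (r.adj _).symm, SimpleGraph.dist_comm, r.2, SimpleGraph.dist_comm,
    add_assoc, r.2]
  exact Nat.lt_succ_self k

theorem Ray.injective (r : Ray N) : Function.Injective r.1 := by
  intro m n h
  wlog hmn : m ≤ n generalizing m n
  · exact (this h.symm (le_of_not_ge hmn)).symm
  obtain ⟨k, rfl⟩ := Nat.exists_eq_add_of_le hmn
  have := r.2 m k
  rw [← h, dist_eq_zero.2 rfl] at this
  omega

/-- In a tree, paths without backtracking are geodesic: by induction the direction back to f m is
always the preceding vertex, so each step increases the distance by one. -/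
theorem dist_of_nonbacktracking {f : ℕ → F N} (h1 : ∀ n, (cayley N).Adj (f n) (f (n + 1)))
    (h2 : ∀ n, f (n + 2) ≠ f n) (m n : ℕ) : (cayley N).dist (f m) (f (m + n)) = n := by
  have key : ∀ k, toward (f (m + k + 1)) (f m) = f (m + k) := by
    intro k
    induction k with
    | zero => exact toward_of_adj (h1 m).symm
    | succ k ih =>
      refine (toward_or (h1 (m + k + 1)) (f m)).resolve_left ?_
      rw [ih]
      exact (h2 (m + k)).symm
  induction n with
  | zero => exact dist_eq_zero.2 rfl
  | succ n ih =>
    have hne : f (m + n + 1) ≠ f m := by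
      intro h
      have := key n
      rw [h, toward_self] at this
      exact (h1 (m + n)).ne (this.symm.trans h.symm)
    have := dist_toward hne
    rw [key n, SimpleGraph.dist_comm, ih, SimpleGraph.dist_comm] at this
    exact this.symm

theorem Ray.ext_of_equiv {r s : Ray N} (h0 : r.1 0 = s.1 0) (h : r.endpoint = s.endpoint) :
    r = s := by
  obtain ⟨a, b, hab⟩ := Quotient.exact h
  have hd : ∀ (t : Ray N) n, (cayley N).dist (t.1 0) (t.1 n) = n := fun t n => by
    simpa using t.2 0 n
  -- Both parameters are the distance from the common origin to the point where the tails agree.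
  have e : a = b := by
    have h1 := hd r a
    have h2 := hd s b
    have h3 := hab 0
    simp only [add_zero] at h3
    rw [h3, h0, h2] at h1
    exact h1.symm
  subst e
  apply Subtype.ext
  funext n
  induction n with
  | zero => exact h0
  | succ n ih =>
    have h1 := r.toward_of_lt (show n < a + (n + 1) by omega)
    have h2 := s.toward_of_lt (show n < a + (n + 1) by omega)
    rw [← h1, ← h2, ih, hab]

/-- The ray obtained by dropping the first `n` vertices. -/
def Ray.drop (n : ℕ) (r : Ray N) : Ray N :=
  ⟨fun k => r.1 (n + k), fun m k => by
    have := r.2 (n + m) k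
    rwa [add_assoc] at this⟩

theorem Ray.endpoint_drop (n : ℕ) (r : Ray N) : (r.drop n).endpoint = r.endpoint :=
  Quotient.sound ⟨0, n, fun k => by simp [Ray.drop]⟩

theorem exists_ray_cons (r : Ray N) {v : F N} (h : (cayley N).Adj v (r.1 0)) (h1 : r.1 1 ≠ v) :
    ∃ s : Ray N, s.1 0 = v ∧ s.1 1 = r.1 0 ∧ s.endpoint = r.endpoint := by
  let f : ℕ → F N := fun n => Nat.casesOn n v r.1
  have hf1 : ∀ n, (cayley N).Adj (f n) (f (n + 1)) := by
    rintro (_ | n)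
    · exact h
    · exact r.adj n
  have hf2 : ∀ n, f (n + 2) ≠ f n := by
    rintro (_ | n)
    · exact h1
    · intro e
      have := r.injective e
      omega
  exact ⟨⟨f, dist_of_nonbacktracking hf1 hf2⟩, rfl, rfl,
    Quotient.sound ⟨1, 0, fun k => by rw [add_comm, zero_add]⟩⟩

/-- A ray representing ξ is transported along a walk to v one edge at a time: either its first
vertex is dropped or a new one is prepended. -/
theorem exists_ray (v : F N) (ξ : Boundary N) : ∃ r : Ray N, r.1 0 = v ∧ r.endpoint = ξ := by
  obtain ⟨r, rfl⟩ := Quotient.exists_rep ξ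
  obtain ⟨p⟩ := (cayley_connected (N := N)).preconnected v (r.1 0)
  have key : ∀ {u v : F N}, (cayley N).Walk u v → ∀ r : Ray N, r.1 0 = v →
      ∃ s : Ray N, s.1 0 = u ∧ s.endpoint = r.endpoint := by
    intro u v p
    induction p with
    | nil => exact fun r hr => ⟨r, hr, rfl⟩
    | @cons u w v h p ih =>
      intro r hr
      obtain ⟨s, rfl, hs⟩ := ih r hr
      by_cases h1 : s.1 1 = u
      · exact ⟨s.drop 1, h1, (s.endpoint_drop 1).trans hs⟩
      · obtain ⟨t, ht0, -, ht⟩ := exists_ray_cons s h h1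
        exact ⟨t, ht0, ht.trans hs⟩
  exact key p r rfl

/-- The geodesic ray from `v` to `ξ`. -/
def rayTo (v : F N) (ξ : Boundary N) : Ray N := (exists_ray v ξ).choose

@[simp] theorem rayTo_zero (v : F N) (ξ : Boundary N) : (rayTo v ξ).1 0 = v :=
  (exists_ray v ξ).choose_spec.1

@[simp] theorem rayTo_endpoint (v : F N) (ξ : Boundary N) : (rayTo v ξ).endpoint = ξ :=
  (exists_ray v ξ).choose_spec.2

/-- The neighbour of `v` on the geodesic ray from `v` to `ξ`. -/
def dir (v : F N) (ξ : Boundary N) : F N := (rayTo v ξ).1 1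

theorem Ray.eq_rayTo (r : Ray N) : r = rayTo (r.1 0) r.endpoint :=
  Ray.ext_of_equiv (by simp) (by simp)

theorem Ray.dir_zero (r : Ray N) : dir (r.1 0) r.endpoint = r.1 1 := by
  rw [dir, ← r.eq_rayTo]

theorem Ray.dir_apply (r : Ray N) (n : ℕ) : dir (r.1 n) r.endpoint = r.1 (n + 1) := by
  have := (r.drop n).dir_zero
  rwa [r.endpoint_drop] at this

theorem mem_Cyl_iff {u v : F N} {ξ : Boundary N} : ξ ∈ Cyl u v ↔ dir u ξ = v := by
  constructor
  · rintro ⟨r, rfl, rfl, rfl⟩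
    exact r.dir_zero
  · rintro rfl
    exact ⟨rayTo u ξ, by simp, rfl, by simp⟩

theorem dir_adj (v : F N) (ξ : Boundary N) : (cayley N).Adj v (dir v ξ) := by
  have := (rayTo v ξ).adj 0
  rwa [rayTo_zero] at this

theorem rayTo_succ (v : F N) (ξ : Boundary N) (n : ℕ) :
    (rayTo v ξ).1 (n + 1) = dir ((rayTo v ξ).1 n) ξ := by
  have := (rayTo v ξ).dir_apply n
  rw [rayTo_endpoint] at this
  exact this.symm

theorem dir_dir_ne (v : F N) (ξ : Boundary N) : dir (dir v ξ) ξ ≠ v := by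
  intro h
  have h2 : (rayTo v ξ).1 2 = (rayTo v ξ).1 0 := by
    rw [rayTo_succ, rayTo_zero]; exact h
  have := (rayTo v ξ).injective h2
  omega

theorem dir_or {u v : F N} (h : (cayley N).Adj u v) (ξ : Boundary N) :
    dir u ξ = v ∨ dir v ξ = u := by
  by_contra! hc
  obtain ⟨s, hs0, hs1, hs⟩ := exists_ray_cons (r := rayTo v ξ) (v := u) (by simpa using h) hc.2
  apply hc.1
  have := s.dir_zero
  rw [hs0, hs, hs1, rayTo_zero, rayTo_endpoint] at this
  exact this

theorem dir_eq_iff_ne {u v : F N} (h : (cayley N).Adj u v) (ξ : Boundary N) :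
    dir u ξ = v ↔ dir v ξ ≠ u :=
  ⟨fun h1 h2 => dir_dir_ne u ξ (by rw [h1, h2]), fun h1 => (dir_or h ξ).resolve_right h1⟩

theorem dir_smul (g v : F N) (ξ : Boundary N) : dir (g * v) (g • ξ) = g * dir v ξ := by
  have := ((rayTo v ξ).translate g).dir_zero
  rw [← smul_endpoint, rayTo_endpoint] at this
  simpa [Ray.translate, dir] using this

theorem dir_smul' (g v : F N) (ξ : Boundary N) : dir v (g • ξ) = g * dir (g⁻¹ * v) ξ := by
  rw [← dir_smul, mul_inv_cancel_left]

theorem dir_injective {ξ η : Boundary N} (h : ∀ v, dir v ξ = dir v η) : ξ = η := by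
  have : rayTo 1 ξ = rayTo 1 η := by
    apply Subtype.ext
    funext n
    induction n with
    | zero => simp
    | succ n ih => rw [rayTo_succ, rayTo_succ, ih, h]
  rw [← rayTo_endpoint 1 ξ, this, rayTo_endpoint]

/-- Iterating φ gives a ray from each vertex. By `h3`, for adjacent starting points one ray is a
tail of the other, so by connectedness all rays have one endpoint. The hypotheses involve two
coordinates at a time, which makes the image of ∂X closed. -/
theorem exists_dir_eq {φ : F N → F N} (h1 : ∀ v, (cayley N).Adj v (φ v))
    (h2 : ∀ v, φ (φ v) ≠ v) (h3 : ∀ u v, (cayley N).Adj u v → φ u = v ∨ φ v = u) :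
    ∃ ξ, ∀ v, dir v ξ = φ v := by
  let ρ : F N → Ray N := fun v => ⟨fun n => φ^[n] v, dist_of_nonbacktracking
    (fun n => by rw [Function.iterate_succ_apply']; exact h1 _)
    (fun n => by rw [Function.iterate_succ_apply', Function.iterate_succ_apply']; exact h2 _)⟩
  have hadj : ∀ u v, (cayley N).Adj u v → (ρ u).endpoint = (ρ v).endpoint := by
    have : ∀ u v, φ u = v → (ρ u).endpoint = (ρ v).endpoint := by
      rintro u v rfl
      exact Quotient.sound ⟨1, 0, fun k => by
        simp only [ρ]; rw [add_comm, zero_add]; rfl⟩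
    intro u v huv
    rcases h3 u v huv with h | h
    · exact this u v h
    · exact (this v u h).symm
  have hall : ∀ v, (ρ v).endpoint = (ρ 1).endpoint := by
    have hw : ∀ {u v : F N}, (cayley N).Walk u v → (ρ u).endpoint = (ρ v).endpoint := by
      intro u v p
      induction p with
      | nil => rfl
      | cons h p ih => exact (hadj _ _ h).trans ih
    intro v
    obtain ⟨p⟩ := (cayley_connected (N := N)).preconnected v 1
    exact hw p
  refine ⟨(ρ 1).endpoint, fun v => ?_⟩
  rw [← hall v]
  exact (ρ v).dir_zero

/-- If `ξ` is not in the direction of `w` seen from `v`, then from `w` it is in the direction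
of `v`. -/
theorem dir_eq_toward {v w : F N} {ξ : Boundary N} (hvw : v ≠ w) (h : dir v ξ ≠ toward v w) :
    dir w ξ = toward w v := by
  obtain ⟨n, hn⟩ : ∃ n, (cayley N).dist v w = n := ⟨_, rfl⟩
  induction n generalizing v with
  | zero => exact absurd (dist_eq_zero.1 hn) hvw
  | succ n ih =>
    have h1 : dir (toward v w) ξ = v := (dir_or (toward_adj hvw) ξ).resolve_left h
    by_cases hw : toward v w = w
    · have h3 := toward_adj hvw
      rw [hw] at h1 h3
      rw [h1, toward_of_adj h3.symm]
    · have h2 := ih hw (by rw [h1]; exact (toward_toward_ne hvw).symm) (by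
        have := dist_toward hvw; omega)
      rw [h2]
      exact toward_eq_of_adj (toward_adj hvw).symm (Ne.symm hw) hvw.symm

theorem dir_eq_of_dir_ne {v w : F N} {ξ : Boundary N} (hvw : v ≠ w)
    (h : dir w ξ ≠ toward w v) : dir v ξ = toward v w := by
  by_contra h1
  exact h (dir_eq_toward hvw h1)

/-! ### The topology of the boundary -/

instance : TopologicalSpace (F N) := ⊥

instance : DiscreteTopology (F N) := ⟨rfl⟩

/-- A boundary point, recorded by its directions at all vertices. -/
def flow (ξ : Boundary N) : F N → F N := fun v => dir v ξ

theorem continuous_eval (u : F N) : Continuous fun φ : F N → F N => φ u := continuous_apply u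

theorem isInducing_flow : IsInducing (flow (N := N)) := by
  constructor
  apply le_antisymm
  · rw [← continuous_iff_le_induced, continuous_pi_iff]
    intro u
    refine continuous_discrete_rng.2 fun v => ?_
    by_cases h : (cayley N).Adj u v
    · refine TopologicalSpace.isOpen_generateFrom_of_mem ⟨u, v, h, ?_⟩
      ext ξ
      exact mem_Cyl_iff.symm
    · convert isOpen_empty
      ext ξ
      simp only [Set.mem_preimage, Set.mem_singleton_iff, Set.mem_empty_iff_false, iff_false]
      rintro rfl
      exact h (dir_adj u ξ)
  · refine le_generateFrom ?_
    rintro _ ⟨u, v, -, rfl⟩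
    refine ⟨{φ | φ u = v}, ?_, ?_⟩
    · exact (isOpen_discrete ({v} : Set (F N))).preimage (continuous_eval u)
    · ext ξ
      exact mem_Cyl_iff.symm

theorem flow_injective : Function.Injective (flow (N := N)) := fun _ _ h =>
  dir_injective fun v => congrFun h v

theorem isClosed_flow_preimage_eq (u v : F N) : IsClosed {φ : F N → F N | φ u = v} :=
  (isClosed_discrete ({v} : Set (F N))).preimage (continuous_eval u)

theorem isOpen_flow_preimage_eq (u v : F N) : IsOpen {φ : F N → F N | φ u = v} :=
  (isOpen_discrete ({v} : Set (F N))).preimage (continuous_eval u)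

theorem range_flow : Set.range (flow (N := N)) =
    {φ | (∀ v, (cayley N).Adj v (φ v)) ∧ (∀ v w, φ v = w → φ w ≠ v) ∧
      ∀ u v, (cayley N).Adj u v → φ u = v ∨ φ v = u} := by
  ext φ
  constructor
  · rintro ⟨ξ, rfl⟩
    refine ⟨fun v => dir_adj v ξ, ?_, fun u v h => dir_or h ξ⟩
    rintro v _ rfl
    exact dir_dir_ne v ξ
  · rintro ⟨h1, h2, h3⟩
    obtain ⟨ξ, hξ⟩ := exists_dir_eq h1 (fun v => h2 v _ rfl) h3
    exact ⟨ξ, funext hξ⟩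

theorem isClosed_range_flow : IsClosed (Set.range (flow (N := N))) := by
  rw [range_flow]
  simp only [Set.ofPred_and, Set.ofPred_forall]
  refine .inter ?_ (.inter ?_ ?_)
  · exact isClosed_iInter fun v =>
      (isClosed_discrete {w : F N | (cayley N).Adj v w}).preimage (continuous_eval v)
  · refine isClosed_iInter fun v => isClosed_iInter fun w => ?_
    rw [show {φ : F N → F N | φ v = w → φ w ≠ v} = ({φ | φ v = w} ∩ {φ | φ w = v})ᶜ by
      ext; simp]
    exact ((isOpen_flow_preimage_eq v w).inter (isOpen_flow_preimage_eq w v)).isClosed_compl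
  · exact isClosed_iInter fun u => isClosed_iInter fun v => isClosed_iInter fun _ =>
      (isClosed_flow_preimage_eq u v).union (isClosed_flow_preimage_eq v u)

theorem isClosedEmbedding_flow : IsClosedEmbedding (flow (N := N)) :=
  ⟨⟨isInducing_flow, flow_injective⟩, isClosed_range_flow⟩

theorem isCompact_pi_ball :
    IsCompact {φ : F N → F N | ∀ v, φ v ∈ {u | (cayley N).dist v u ≤ 1}} :=
  isCompact_pi_infinite fun v => (finite_ball v 1).isCompact

/-- The image under `flow` is closed in a product of finite balls. -/
instance : CompactSpace (Boundary N) := by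
  constructor
  rw [isInducing_flow.isCompact_iff, Set.image_univ]
  refine isCompact_pi_ball.of_isClosed_subset isClosed_range_flow ?_
  rintro _ ⟨ξ, rfl⟩ v
  exact (dist_adj (dir_adj v ξ)).le

instance : T2Space (Boundary N) := isClosedEmbedding_flow.isEmbedding.t2Space

instance : SecondCountableTopology (Boundary N) :=
  isInducing_flow.secondCountableTopology

theorem isClopen_Cyl (u v : F N) : IsClopen (Cyl u v) := by
  have h : Cyl u v = flow ⁻¹' {φ : F N → F N | φ u = v} := by
    ext ξ; exact mem_Cyl_iff
  rw [h]
  exact ⟨(isClosed_flow_preimage_eq u v).preimage isInducing_flow.continuous,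
    (isOpen_flow_preimage_eq u v).preimage isInducing_flow.continuous⟩

/-- Cylinders far out on the ray from `v` to `ξ` determine the direction at `v`. -/
theorem eventually_dir_eq (r : Ray N) (v : F N) : ∀ᶠ n in Filter.atTop,
    toward v (r.1 n) = dir v r.endpoint ∧
      ∀ η, dir (r.1 n) η = r.1 (n + 1) → dir v η = dir v r.endpoint := by
  obtain ⟨a, b, hab⟩ := Quotient.exact (rayTo_endpoint v r.endpoint)
  have hab : ∀ k, (rayTo v r.endpoint).1 (a + k) = r.1 (b + k) := hab
  -- From index b on, r runs along the ray from v; one further step guarantees that the vertex is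
  -- different from v.
  filter_upwards [Filter.eventually_ge_atTop (b + 1)] with n hn
  obtain ⟨k, rfl⟩ := Nat.exists_eq_add_of_le hn
  have e : ∀ k, r.1 (b + 1 + k) = (rayTo v r.endpoint).1 (a + 1 + k) := fun k => by
    rw [add_assoc, ← hab, add_assoc]
  have h1 : toward v (r.1 (b + 1 + k)) = dir v r.endpoint := by
    have := (rayTo v r.endpoint).toward_of_lt (show 0 < a + 1 + k by omega)
    rwa [rayTo_zero, ← e] at this
  refine ⟨h1, fun η hη => ?_⟩
  rw [← h1]
  have h2 : toward (r.1 (b + 1 + k)) v = (rayTo v r.endpoint).1 (a + k) := by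
    have := (rayTo v r.endpoint).toward_of_gt (Nat.zero_le (a + k))
    rwa [rayTo_zero, show a + k + 1 = a + 1 + k by ring, ← e] at this
  refine dir_eq_of_dir_ne ?_ ?_
  · rw [e]
    intro h
    have := (rayTo v r.endpoint).injective ((rayTo_zero v r.endpoint).trans h)
    omega
  · rw [hη, h2, add_assoc (b + 1), e]
    intro h
    have := (rayTo v r.endpoint).injective h
    omega

/-- A basic neighbourhood prescribes the directions at finitely many vertices, and each of them is
forced by all cylinders far enough out on the ray. -/
theorem exists_Cyl_subset {U : Set (Boundary N)} (hU : IsOpen U) (r : Ray N)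
    (hr : r.endpoint ∈ U) : ∃ n, ∀ m, n ≤ m → Cyl (r.1 m) (r.1 (m + 1)) ⊆ U := by
  obtain ⟨V, hV, rfl⟩ := isInducing_flow.isOpen_iff.1 hU
  obtain ⟨I, t, h1, h2⟩ := isOpen_pi_iff.1 hV _ hr
  have : ∀ᶠ n in Filter.atTop, ∀ v ∈ I, ∀ η, dir (r.1 n) η = r.1 (n + 1) →
      dir v η = dir v r.endpoint :=
    (Filter.eventually_all_finset I).2 fun v _ => (eventually_dir_eq r v).mono fun n h => h.2
  obtain ⟨n, hn⟩ := Filter.eventually_atTop.1 this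
  refine ⟨n, fun m hm η hη => h2 fun v hv => ?_⟩
  have := hn m hm v hv η (mem_Cyl_iff.1 hη)
  change dir v η ∈ t v
  rw [this]
  exact (h1 v hv).2

/-! ### Convex hulls -/

/-- Two rays from v with different first edges concatenate to a geodesic. Thus hulls are described
locally, by directions at v alone. -/
theorem mem_Conv_iff {S : Set (Boundary N)} {v : F N} :
    v ∈ Conv S ↔ ∃ ξ ∈ S, ∃ η ∈ S, dir v ξ ≠ dir v η := by
  constructor
  · rintro ⟨r, s, rfl, hs, h, hr, hs'⟩
    refine ⟨_, hr, _, hs', ?_⟩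
    have h1 := s.dir_zero
    rw [hs] at h1
    rw [r.dir_zero, h1]
    intro e
    have := h 1 1
    rw [e, dist_eq_zero.2 rfl] at this
    omega
  · rintro ⟨ξ, hξ, η, hη, h⟩
    refine ⟨rayTo v ξ, rayTo v η, by simp, by simp, fun m n => ?_, by simpa, by simpa⟩
    set r := rayTo v ξ with hr
    set s := rayTo v η with hs
    have h0 : ∀ t : Ray N, ∀ k, (cayley N).dist (t.1 0) (t.1 k) = k := fun t k => by
      simpa using t.2 0 k
    have key : ∀ n, toward (s.1 (n + 1)) (r.1 m) = s.1 n := by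
      intro n
      induction n with
      | zero =>
        refine (toward_or (s.adj 0) _).resolve_left ?_
        rcases m with _ | m
        · rw [show s.1 0 = r.1 0 by simp [hr, hs], toward_self]
          rw [show r.1 0 = s.1 0 by simp [hr, hs]]
          exact (s.adj 0).ne
        · rw [show s.1 0 = r.1 0 by simp [hr, hs], r.toward_of_lt (Nat.succ_pos m)]
          exact h
      | succ n ih =>
        refine (toward_or (s.adj (n + 1)) _).resolve_left ?_
        rw [ih]
        intro e
        have := s.injective e
        omega
    induction n with
    | zero =>
      rw [show s.1 0 = r.1 0 by simp [hr, hs], SimpleGraph.dist_comm, h0]; rfl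
    | succ n ih =>
      have hne : s.1 (n + 1) ≠ r.1 m := by
        intro e
        have := key n
        rw [e, toward_self, ← e] at this
        exact (s.adj n).ne this.symm
      have := dist_toward hne
      rw [key n, SimpleGraph.dist_comm, ih, SimpleGraph.dist_comm] at this
      omega

theorem Conv_mono {S T : Set (Boundary N)} (h : S ⊆ T) : Conv S ⊆ Conv T := fun v hv => by
  obtain ⟨ξ, hξ, η, hη, hne⟩ := mem_Conv_iff.1 hv
  exact mem_Conv_iff.2 ⟨ξ, h hξ, η, h hη, hne⟩

theorem Conv_image_smul (g : F N) (S : Set (Boundary N)) (v : F N) :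
    v ∈ Conv ((fun ξ => g • ξ) '' S) ↔ g⁻¹ * v ∈ Conv S := by
  simp [mem_Conv_iff, dir_smul']

/-- The convex hull of a set of boundary points with at least two elements is non-empty. -/
theorem Conv_nonempty {S : Set (Boundary N)} (h : S.Nontrivial) : (Conv S).Nonempty := by
  obtain ⟨ξ, hξ, η, hη, hne⟩ := h
  by_contra hc
  refine hne (dir_injective fun v => ?_)
  by_contra h1
  exact hc ⟨v, mem_Conv_iff.2 ⟨ξ, hξ, η, hη, h1⟩⟩

theorem nontrivial_of_mem_Conv {S : Set (Boundary N)} {v : F N} (h : v ∈ Conv S) :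
    S.Nontrivial := by
  obtain ⟨ξ, hξ, η, hη, hne⟩ := mem_Conv_iff.1 h
  exact ⟨ξ, hξ, η, hη, fun e => hne (by rw [e])⟩

/-- Each vertex of the hull of `S` has, seen from any other vertex, points of `S` behind it. -/
theorem exists_dir_eq_toward {S : Set (Boundary N)} {v w : F N} (hw : w ∈ Conv S) (h : v ≠ w) :
    ∃ ξ ∈ S, dir v ξ = toward v w := by
  obtain ⟨ξ, hξ, η, hη, hne⟩ := mem_Conv_iff.1 hw
  by_cases h1 : dir w ξ = toward w v
  · exact ⟨η, hη, dir_eq_of_dir_ne h fun h2 => hne (h1.trans h2.symm)⟩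
  · exact ⟨ξ, hξ, dir_eq_of_dir_ne h h1⟩

/-- Seen from the intermediate vertex, S has a point behind v and a point behind u, in different
directions. -/
theorem toward_mem_Conv {S : Set (Boundary N)} {u v : F N} (hu : u ∈ Conv S) (hv : v ∈ Conv S)
    (h : u ≠ v) : toward u v ∈ Conv S := by
  by_cases hw : toward u v = v
  · rwa [hw]
  obtain ⟨ξ, hξ, h1⟩ := exists_dir_eq_toward hv hw
  obtain ⟨η, hη, h2⟩ := exists_dir_eq_toward hu (toward_adj h).ne'
  refine mem_Conv_iff.2 ⟨ξ, hξ, η, hη, ?_⟩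
  rw [h1, h2, toward_of_adj (toward_adj h).symm]
  exact toward_toward_ne h

theorem dir_mem_Conv {S : Set (Boundary N)} {u : F N} {ξ : Boundary N} (hu : u ∈ Conv S)
    (hξ : ξ ∈ S) : dir u ξ ∈ Conv S := by
  obtain ⟨η, hη, h2⟩ := exists_dir_eq_toward hu (dir_adj u ξ).ne'
  refine mem_Conv_iff.2 ⟨ξ, hξ, η, hη, ?_⟩
  rw [h2, toward_of_adj (dir_adj u ξ).symm]
  exact dir_dir_ne u ξ

theorem rayTo_mem_Conv {S : Set (Boundary N)} {u : F N} {ξ : Boundary N} (hu : u ∈ Conv S)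
    (hξ : ξ ∈ S) (n : ℕ) : (rayTo u ξ).1 n ∈ Conv S := by
  induction n with
  | zero => simpa
  | succ n ih => rw [rayTo_succ]; exact dir_mem_Conv ih hξ

/-- A set of vertices which contains the geodesics between its points. -/
def IsGeodesicallyConvex (Y : Set (F N)) : Prop :=
  ∀ u ∈ Y, ∀ v ∈ Y, u ≠ v → toward u v ∈ Y

theorem isGeodesicallyConvex_Conv (S : Set (Boundary N)) : IsGeodesicallyConvex (Conv S) :=
  fun _ hu _ hv h => toward_mem_Conv hu hv h

theorem IsGeodesicallyConvex.inter {Y Z : Set (F N)} (hY : IsGeodesicallyConvex Y)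
    (hZ : IsGeodesicallyConvex Z) : IsGeodesicallyConvex (Y ∩ Z) :=
  fun u hu v hv h => ⟨hY u hu.1 v hv.1 h, hZ u hu.2 v hv.2 h⟩

theorem IsGeodesicallyConvex.isTree {Y : Set (F N)} (hY : IsGeodesicallyConvex Y)
    (hne : Y.Nonempty) : ((cayley N).induce Y).IsTree := by
  have : Nonempty Y := hne.to_subtype
  refine ⟨⟨?_⟩, cayley_isAcyclic.induce Y⟩
  rintro ⟨u, hu⟩ ⟨v, hv⟩
  obtain ⟨n, hn⟩ : ∃ n, (cayley N).dist u v = n := ⟨_, rfl⟩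
  induction n generalizing u with
  | zero =>
    obtain rfl := dist_eq_zero.1 hn
    rfl
  | succ n ih =>
    have hne : u ≠ v := by
      rintro rfl
      rw [dist_eq_zero.2 rfl] at hn
      omega
    have h1 := ih (toward u v) (hY u hu v hv hne) (by have := dist_toward hne; omega)
    exact (SimpleGraph.Adj.reachable (G := (cayley N).induce Y) (u := ⟨u, hu⟩)
      (v := ⟨toward u v, hY u hu v hv hne⟩) (toward_adj hne)).trans h1

/-! ### Limit sets of sets of vertices -/

/-- A vertex, recorded by the directions towards it at all vertices. -/
def vflow (w : F N) : F N → F N := fun v => toward v w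

/-- The limit set of a set of vertices. -/
def limitSetOf (A : Set (F N)) : Set (Boundary N) := {ξ | flow ξ ∈ closure (vflow '' A)}

theorem mem_limitSetOf_iff {A : Set (F N)} {ξ : Boundary N} :
    ξ ∈ limitSetOf A ↔ ∀ V : Finset (F N), ∃ h ∈ A, ∀ v ∈ V, toward v h = dir v ξ := by
  change flow ξ ∈ closure (vflow '' A) ↔ _
  rw [mem_closure_iff]
  constructor
  · intro h V
    obtain ⟨_, h1, w, hw, rfl⟩ := h (⋂ v ∈ V, {φ | φ v = dir v ξ})
      (isOpen_biInter_finset fun v _ => isOpen_flow_preimage_eq v (dir v ξ))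
      (Set.mem_iInter₂.2 fun v _ => rfl)
    exact ⟨w, hw, fun v hv => Set.mem_iInter₂.1 h1 v hv⟩
  · intro h U hU hξ
    obtain ⟨I, t, h1, h2⟩ := isOpen_pi_iff.1 hU _ hξ
    obtain ⟨w, hw, h3⟩ := h I
    refine ⟨vflow w, h2 fun v hv => ?_, w, hw, rfl⟩
    change toward v w ∈ t v
    rw [h3 v hv]
    exact (h1 v hv).2

theorem isClosed_limitSetOf (A : Set (F N)) : IsClosed (limitSetOf A) :=
  isClosed_closure.preimage isInducing_flow.continuous

theorem limitSetOf_mono {A B : Set (F N)} (h : A ⊆ B) : limitSetOf A ⊆ limitSetOf B :=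
  fun _ hξ => closure_mono (Set.image_mono h) hξ

theorem limitSetOf_biUnion {ι : Type*} {s : Set ι} (hs : s.Finite) (A : ι → Set (F N)) :
    limitSetOf (⋃ i ∈ s, A i) = ⋃ i ∈ s, limitSetOf (A i) := by
  ext ξ
  change flow ξ ∈ closure (vflow '' _) ↔ _
  simp only [Set.image_iUnion]
  rw [hs.closure_biUnion]
  simp [limitSetOf]

/-- Convergence to ξ means that the direction towards the sequence at each vertex is eventually that
of ξ. Since there are countably many vertices, sequences suffice to describe the closure. -/
theorem limitSet_eq (H : Subgroup (F N)) : limitSet H = limitSetOf (H : Set (F N)) := by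
  ext ξ
  have key : ∀ h : ℕ → F N, TendstoBoundary h ξ ↔
      Filter.Tendsto (fun n => vflow (h n)) Filter.atTop (𝓝 (flow ξ)) := by
    intro h
    rw [tendsto_pi_nhds]
    simp only [nhds_discrete, Filter.tendsto_pure]
    constructor
    · intro H v
      filter_upwards [H v (dir v ξ) (dir_adj v ξ) (mem_Cyl_iff.2 rfl)] with n hn
      exact (dist_lt_iff_toward (dir_adj v ξ) _).1 hn
    · intro H u v huv hξ
      filter_upwards [H u] with n hn
      rw [dist_lt_iff_toward huv]
      exact hn.trans (mem_Cyl_iff.1 hξ)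
  change _ ↔ flow ξ ∈ closure (vflow '' _)
  rw [mem_closure_iff_seq_limit]
  constructor
  · rintro ⟨h, h1, h2⟩
    exact ⟨fun n => vflow (h n), fun n => ⟨h n, h1 n, rfl⟩, (key h).1 h2⟩
  · rintro ⟨x, h1, h2⟩
    choose h h3 h4 using h1
    refine ⟨h, h3, (key h).2 ?_⟩
    simpa only [h4] using h2

theorem smul_mem_limitSetOf {A : Set (F N)} (g : F N) {ξ : Boundary N} (h : ξ ∈ limitSetOf A) :
    g • ξ ∈ limitSetOf ((fun x => g * x) '' A) := by
  rw [mem_limitSetOf_iff] at h ⊢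
  intro V
  classical
  obtain ⟨w, hw, h1⟩ := h (V.image fun v => g⁻¹ * v)
  refine ⟨_, ⟨w, hw, rfl⟩, fun v hv => ?_⟩
  rw [dir_smul', ← h1 _ (Finset.mem_image_of_mem _ hv), ← mul_toward, mul_inv_cancel_left]

theorem image_smul_limitSetOf (A : Set (F N)) (g : F N) :
    (fun ξ => g • ξ) '' limitSetOf A = limitSetOf ((fun x => g * x) '' A) := by
  ext ξ
  constructor
  · rintro ⟨ξ, hξ, rfl⟩
    exact smul_mem_limitSetOf g hξ
  · intro h
    refine ⟨g⁻¹ • ξ, ?_, smul_inv_smul g ξ⟩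
    have := smul_mem_limitSetOf g⁻¹ h
    simpa only [Set.image_image, inv_mul_cancel_left, Set.image_id'] using this

/-- If the path from `h` spelled by a word avoids `v`, its endpoints have the same direction
from `v`. -/
theorem toward_mul_mk (L : List (Fin N × Bool)) {v h : F N}
    (hv : ∀ i, v ≠ h * FreeGroup.mk (L.take i)) :
    toward v (h * FreeGroup.mk L) = toward v h := by
  induction L generalizing h with
  | nil => rw [← FreeGroup.one_eq_mk, mul_one]
  | cons x L ih =>
    have e : ∀ L', h * FreeGroup.mk (x :: L') = h * FreeGroup.mk [x] * FreeGroup.mk L' :=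
      fun L' => by rw [mul_assoc, FreeGroup.mul_mk]; rfl
    rw [e, ih fun i => by
      have := hv (i + 1)
      rwa [List.take_succ_cons, e] at this]
    refine (toward_eq_of_adj (adj_iff_exists_letter.2 ⟨x, rfl⟩) ?_ ?_).symm
    · simpa [← FreeGroup.one_eq_mk] using hv 0
    · simpa using hv 1

/-- Right multiplication moves vertices by a bounded amount, which does not change the direction
seen from a vertex off the path travelled. -/
theorem limitSetOf_mul_right_subset (A : Set (F N)) (x : F N) :
    limitSetOf A ⊆ limitSetOf ((fun h => h * x) '' A) := by
  classical
  intro ξ h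
  rw [mem_limitSetOf_iff] at h ⊢
  intro V
  -- The added vertices are those from which the path spelled by x runs through V. An h that has the
  -- directions of ξ at all vertices of W is not itself in W.
  let W : Finset (F N) := V ∪ V.biUnion fun v => (Finset.range (x.toWord.length + 1)).image
    fun i => v * (FreeGroup.mk (x.toWord.take i))⁻¹
  obtain ⟨w, hw, h1⟩ := h W
  have hW : ∀ v ∈ W, w ≠ v := by
    rintro v hv rfl
    have := h1 w hv
    rw [toward_self] at this
    exact (dir_adj w ξ).ne this
  refine ⟨_, ⟨w, hw, rfl⟩, fun v hv => ?_⟩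
  have h2 : toward v (w * FreeGroup.mk x.toWord) = toward v w := by
    refine toward_mul_mk _ fun i hi => ?_
    wlog hi' : i ≤ x.toWord.length generalizing i
    · refine this x.toWord.length ?_ le_rfl
      rw [hi, List.take_of_length_le (le_of_not_ge hi'), List.take_length]
    refine hW (v * (FreeGroup.mk (x.toWord.take i))⁻¹) (Finset.mem_union_right _ ?_) ?_
    · exact Finset.mem_biUnion.2 ⟨v, hv, Finset.mem_image.2
        ⟨i, Finset.mem_range.2 (Nat.lt_succ_of_le hi'), rfl⟩⟩
    · rw [hi, mul_inv_cancel_right]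
  rw [FreeGroup.mk_toWord] at h2
  exact h2.trans (h1 v (Finset.mem_union_left _ hv))

theorem limitSetOf_mul_right (A : Set (F N)) (x : F N) :
    limitSetOf ((fun h => h * x) '' A) = limitSetOf A := by
  refine Set.Subset.antisymm ?_ (limitSetOf_mul_right_subset A x)
  have := limitSetOf_mul_right_subset ((fun h => h * x) '' A) x⁻¹
  simpa only [Set.image_image, mul_inv_cancel_right, Set.image_id'] using this

/-- Along an ultrafilter on A finer than the cofinite filter, the directions at each vertex
stabilize by compactness. The limit inherits the conditions of `exists_dir_eq`, as the ultrafilter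
avoids each single vertex. -/
theorem limitSetOf_nonempty {A : Set (F N)} (hA : A.Infinite) : (limitSetOf A).Nonempty := by
  have : (Filter.cofinite ⊓ Filter.principal A).NeBot := by
    rw [Filter.cofinite_inf_principal_neBot_iff]
    exact hA
  obtain ⟨𝒰, h𝒰⟩ := Ultrafilter.exists_le (Filter.cofinite ⊓ Filter.principal A)
  have hA' : ∀ᶠ w in (𝒰 : Filter (F N)), w ∈ A := h𝒰 (Filter.mem_inf_of_right (Filter.mem_principal_self A))
  have hne : ∀ v, ∀ᶠ w in (𝒰 : Filter (F N)), w ≠ v := fun v =>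
    h𝒰 (Filter.mem_inf_of_left (Set.finite_singleton v).compl_mem_cofinite)
  obtain ⟨φ, -, hφ⟩ := (isCompact_pi_ball (N := N)).ultrafilter_le_nhds (𝒰.map vflow) (by
    rw [Filter.le_principal_iff]
    refine Filter.mem_map.2 (Filter.univ_mem' fun w v => ?_)
    change (cayley N).dist v (toward v w) ≤ 1
    by_cases h : v = w
    · subst h; simp
    · exact (dist_adj (toward_adj h)).le)
  have hev : ∀ v, ∀ᶠ w in (𝒰 : Filter (F N)), toward v w = φ v := fun v => by
    have := hφ ((isOpen_flow_preimage_eq v (φ v)).mem_nhds rfl)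
    exact this
  obtain ⟨ξ, hξ⟩ := exists_dir_eq (φ := φ)
    (fun v => by
      obtain ⟨w, h1, h2⟩ := ((hev v).and (hne v)).exists
      exact h1 ▸ toward_adj h2.symm)
    (fun v => by
      obtain ⟨w, h1, h2, h3⟩ := ((hev v).and ((hev (φ v)).and (hne v))).exists
      rw [← h2, ← h1]
      exact toward_toward_ne h3.symm)
    (fun u v huv => by
      obtain ⟨w, h1, h2⟩ := ((hev u).and (hev v)).exists
      rw [← h1, ← h2]
      exact toward_or huv w)
  refine ⟨ξ, mem_limitSetOf_iff.2 fun V => ?_⟩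
  have := ((Filter.eventually_all_finset V).2 fun v _ => hev v).and hA'
  obtain ⟨w, h1, h2⟩ := this.exists
  exact ⟨w, h2, fun v hv => by rw [h1 v hv, hξ]⟩

theorem dir_of_mem_limitSetOf {A : Set (F N)} {ξ : Boundary N} (hξ : ξ ∈ limitSetOf A) (v : F N) :
    ∃ h ∈ A, toward v h = dir v ξ := by
  obtain ⟨h, hA, h1⟩ := mem_limitSetOf_iff.1 hξ {v}
  exact ⟨h, hA, h1 v (Finset.mem_singleton_self v)⟩

theorem limitSetOf_singleton (g : F N) : limitSetOf {g} = ∅ := by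
  ext ξ
  simp only [Set.mem_empty_iff_false, iff_false]
  intro h
  obtain ⟨w, rfl, h1⟩ := dir_of_mem_limitSetOf h g
  rw [toward_self] at h1
  exact (dir_adj w ξ).ne h1

theorem endpoint_mem_limitSetOf (r : Ray N) (n : ℕ) :
    r.endpoint ∈ limitSetOf (Set.range fun k => r.1 (n + k)) := by
  rw [mem_limitSetOf_iff]
  intro V
  obtain ⟨m, hm⟩ := Filter.eventually_atTop.1
    ((Filter.eventually_all_finset V).2 fun v _ => (eventually_dir_eq r v).mono fun n h => h.1)
  exact ⟨_, ⟨m, rfl⟩, hm (n + m) (Nat.le_add_left m n)⟩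

/-- Limit points of the hull of a closed set `S` are in `S`. -/
theorem limitSetOf_Conv_subset {S : Set (Boundary N)} (hS : IsClosed S) :
    limitSetOf (Conv S) ⊆ S := by
  intro ξ hξ
  by_contra hc
  obtain ⟨n, hn⟩ := exists_Cyl_subset hS.isOpen_compl (rayTo 1 ξ) (by simpa using hc)
  set r := rayTo 1 ξ with hr
  obtain ⟨w, hw, h1⟩ := dir_of_mem_limitSetOf hξ (r.1 n)
  rw [hr, ← rayTo_succ, ← hr] at h1
  have hne : r.1 n ≠ w := by
    rintro rfl
    rw [toward_self] at h1
    exact (r.adj n).ne h1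
  obtain ⟨η, hη, h2⟩ := exists_dir_eq_toward hw hne
  exact hn n le_rfl (mem_Cyl_iff.2 (h2.trans h1)) hη

/-! ### Limit sets of subgroups -/

theorem isClosed_limitSet (H : Subgroup (F N)) : IsClosed (limitSet H) := by
  rw [limitSet_eq]; exact isClosed_limitSetOf _

theorem limitSet_mono {H K : Subgroup (F N)} (h : H ≤ K) : limitSet H ⊆ limitSet K := by
  rw [limitSet_eq, limitSet_eq]; exact limitSetOf_mono h

theorem limitSet_bot : limitSet (⊥ : Subgroup (F N)) = ∅ := by
  rw [limitSet_eq, Subgroup.coe_bot]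
  exact limitSetOf_singleton 1

theorem mem_conjSubgroup {g x : F N} {H : Subgroup (F N)} :
    x ∈ conjSubgroup g H ↔ g⁻¹ * x * g ∈ H := by
  constructor
  · rintro ⟨h, hh, rfl⟩
    simpa [mul_assoc] using hh
  · intro h
    exact ⟨_, h, by simp [mul_assoc]⟩

theorem coe_conjSubgroup (g : F N) (H : Subgroup (F N)) :
    (conjSubgroup g H : Set (F N)) = (fun x => x * g⁻¹) '' ((fun x => g * x) '' (H : Set (F N))) := by
  ext x
  simp only [SetLike.mem_coe, mem_conjSubgroup, Set.mem_image, exists_exists_and_eq_and]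
  constructor
  · intro h
    exact ⟨_, h, by group⟩
  · rintro ⟨h, hh, rfl⟩
    simpa [mul_assoc] using hh

theorem conjSubgroup_mul (g h : F N) (H : Subgroup (F N)) :
    conjSubgroup (g * h) H = conjSubgroup g (conjSubgroup h H) := by
  ext x; simp [mem_conjSubgroup, mul_assoc]

theorem conjSubgroup_of_mem {g : F N} {H : Subgroup (F N)} (hg : g ∈ H) : conjSubgroup g H = H := by
  ext x
  rw [mem_conjSubgroup, H.mul_mem_cancel_right hg, H.mul_mem_cancel_left (H.inv_mem hg)]

theorem conjSubgroup_ne_bot {g : F N} {H : Subgroup (F N)} (h : H ≠ ⊥) : conjSubgroup g H ≠ ⊥ := by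
  rw [Subgroup.ne_bot_iff_exists_ne_one] at h ⊢
  obtain ⟨⟨x, hx⟩, h1⟩ := h
  refine ⟨⟨g * x * g⁻¹, mem_conjSubgroup.2 (by simpa [mul_assoc] using hx)⟩, fun h2 => h1 ?_⟩
  have h2 : g * x * g⁻¹ = 1 := congrArg Subtype.val h2
  exact Subtype.ext (conj_eq_one_iff.1 h2)

theorem limitSet_conjSubgroup (g : F N) (H : Subgroup (F N)) :
    limitSet (conjSubgroup g H) = (fun ξ => g • ξ) '' limitSet H := by
  rw [limitSet_eq, limitSet_eq, coe_conjSubgroup, limitSetOf_mul_right, image_smul_limitSetOf]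

theorem image_smul_limitSet_of_mem {g : F N} {H : Subgroup (F N)} (hg : g ∈ H) :
    (fun ξ => g • ξ) '' limitSet H = limitSet H := by
  rw [← limitSet_conjSubgroup, conjSubgroup_of_mem hg]

theorem toWord_pow_of_isCyclicallyReduced {c : F N}
    (hc : FreeGroup.IsCyclicallyReduced c.toWord) (n : ℕ) :
    (c ^ n).toWord = (List.replicate n c.toWord).flatten := by
  rw [FreeGroup.toWord_pow]
  exact (hc.flatten_replicate n).isReduced.reduce_eq

theorem infinite_range_pow {c : F N} (hc : c ≠ 1) : (Set.range fun n : ℕ => c ^ (n + 1)).Infinite :=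
  Set.infinite_range_of_injective fun m n h => by
    have := injective_pow_iff_not_isOfFinOrder.2 (not_isOfFinOrder_of_isMulTorsionFree hc) h
    omega

/-- Positive powers begin with the first letter of c, negative powers with the inverse of its last
letter. These differ since c is cyclically reduced, so the two kinds of limit points leave 1 in
different directions. -/
theorem limitSet_zpowers_nontrivial_of_isCyclicallyReduced {c : F N} (h1 : c ≠ 1)
    (hc : FreeGroup.IsCyclicallyReduced c.toWord) :
    (limitSet (Subgroup.zpowers c)).Nontrivial := by
  obtain ⟨ξ, hξ⟩ := limitSetOf_nonempty (infinite_range_pow h1)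
  obtain ⟨η, hη⟩ := limitSetOf_nonempty (infinite_range_pow (inv_ne_one.2 h1))
  have hne : c.toWord ≠ [] := fun h => h1 (FreeGroup.toWord_eq_nil_iff.1 h)
  obtain ⟨x, t, hx⟩ := List.exists_cons_of_ne_nil hne
  obtain ⟨s, z, hz⟩ : ∃ s z, c.toWord = s ++ [z] := ⟨_, _, (List.dropLast_append_getLast hne).symm⟩
  have hξ1 : dir 1 ξ = FreeGroup.mk [x] := by
    obtain ⟨_, ⟨n, rfl⟩, h⟩ := dir_of_mem_limitSetOf hξ 1
    rw [← h]
    simp only [toward, inv_one, one_mul, toWord_pow_of_isCyclicallyReduced hc,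
      List.replicate_succ, List.flatten_cons]
    rw [hx]
    simp
  have hη1 : dir 1 η = FreeGroup.mk [(z.1, !z.2)] := by
    obtain ⟨_, ⟨n, rfl⟩, h⟩ := dir_of_mem_limitSetOf hη 1
    rw [← h]
    simp only [toward, inv_one, one_mul, inv_pow, FreeGroup.toWord_inv,
      toWord_pow_of_isCyclicallyReduced hc, List.replicate_succ', List.flatten_append,
      List.flatten_cons, List.flatten_nil, List.append_nil]
    rw [hz]
    simp [FreeGroup.invRev]
  refine ⟨ξ, ?_, η, ?_, fun h => ?_⟩
  · rw [limitSet_eq]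
    refine limitSetOf_mono ?_ hξ
    rintro _ ⟨n, rfl⟩
    exact Subgroup.npow_mem_zpowers c _
  · rw [limitSet_eq]
    refine limitSetOf_mono ?_ hη
    rintro _ ⟨n, rfl⟩
    exact (Subgroup.zpowers c).pow_mem ((Subgroup.zpowers c).inv_mem (Subgroup.mem_zpowers c)) _
  · rw [h, hη1] at hξ1
    have h2 := congrArg FreeGroup.toWord hξ1
    simp only [FreeGroup.toWord_mk, FreeGroup.reduce_singleton, List.cons.injEq, and_true] at h2
    have h3 := hc.2 z (by rw [hz]; simp) x (by rw [hx]; simp) (by rw [← h2])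
    rw [← h2] at h3
    simp at h3

theorem limitSet_nontrivial {H : Subgroup (F N)} (hH : H ≠ ⊥) : (limitSet H).Nontrivial := by
  obtain ⟨⟨g, hg⟩, h1⟩ := Subgroup.ne_bot_iff_exists_ne_one.1 hH
  have h1 : g ≠ 1 := fun h => h1 (Subtype.ext h)
  set p : F N := FreeGroup.mk (FreeGroup.reduceCyclically.conjugator g.toWord) with hp
  set c : F N := FreeGroup.mk (FreeGroup.reduceCyclically g.toWord) with hc
  have hcr := FreeGroup.reduceCyclically.isCyclicallyReduced (FreeGroup.isReduced_toWord (x := g))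
  have hcw : c.toWord = FreeGroup.reduceCyclically g.toWord := by
    rw [hc, FreeGroup.toWord_mk, hcr.isReduced.reduce_eq]
  have hg' : g = p * c * p⁻¹ := by
    rw [hp, hc, FreeGroup.inv_mk, FreeGroup.mul_mk, FreeGroup.mul_mk,
      FreeGroup.reduceCyclically.conj_conjugator_reduceCyclically, FreeGroup.mk_toWord]
  have hc1 : c ≠ 1 := by
    rintro h
    rw [h] at hg'
    simp at hg'
    exact h1 hg'
  have h2 := limitSet_zpowers_nontrivial_of_isCyclicallyReduced hc1 (hcw ▸ hcr)
  have h3 : conjSubgroup p (Subgroup.zpowers c) ≤ H := by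
    intro x hx
    rw [mem_conjSubgroup] at hx
    obtain ⟨n, hn⟩ := hx
    have : x = g ^ n := by
      rw [hg', conj_zpow]
      simp only at hn
      rw [hn]
      group
    rw [this]
    exact H.zpow_mem hg n
  have h4 : (limitSet (conjSubgroup p (Subgroup.zpowers c))).Nontrivial := by
    rw [limitSet_conjSubgroup]
    exact h2.image (MulAction.injective p)
  exact h4.mono (limitSet_mono h3)

/-! ### Quasiconvex subgroups -/

/-- `H` acts with finitely many orbits on the convex hull of its limit set. -/
def IsQuasiconvex (H : Subgroup (F N)) : Prop :=
  ∃ B : Finset (F N), ∀ v ∈ Conv (limitSet H), ∃ h ∈ H, ∃ b ∈ B, v = h * b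

/-- If v lies on no translate of the paths spelled by the generators, then from v the whole subgroup
is seen in a single direction. Its limit points are then in that direction too, so v is not in the
hull. -/
theorem exists_eq_mul_of_mem_Conv_limitSet {S P : Set (F N)}
    (hP : ∀ s ∈ S, ∀ i, FreeGroup.mk (s.toWord.take i) ∈ P) {v : F N}
    (hv : v ∈ Conv (limitSet (Subgroup.closure S))) :
    ∃ h ∈ Subgroup.closure S, ∃ p ∈ P, v = h * p := by
  by_contra! hc
  -- The arbitrary left factor k is what lets the induction pass through products and inverses.
  have h1 : ∀ h ∈ Subgroup.closure S, ∀ k ∈ Subgroup.closure S, toward v (k * h) = toward v k := by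
    intro h hh
    induction hh using Subgroup.closure_induction with
    | mem s hs =>
      intro k hk
      have := toward_mul_mk s.toWord (v := v) (h := k) fun i => hc k hk _ (hP s hs i)
      rwa [FreeGroup.mk_toWord] at this
    | one => simp
    | mul x y hx hy h1 h2 =>
      intro k hk
      rw [← mul_assoc, h2 _ (mul_mem hk hx), h1 k hk]
    | inv x hx h1 =>
      intro k hk
      rw [← h1 _ (mul_mem hk (inv_mem hx)), inv_mul_cancel_right]
  obtain ⟨ξ, hξ, η, hη, hne⟩ := mem_Conv_iff.1 hv
  rw [limitSet_eq] at hξ hη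
  obtain ⟨x, hx, hx'⟩ := dir_of_mem_limitSetOf hξ v
  obtain ⟨y, hy, hy'⟩ := dir_of_mem_limitSetOf hη v
  apply hne
  rw [← hx', ← hy', ← one_mul x, ← one_mul y, h1 x hx 1 (one_mem _), h1 y hy 1 (one_mem _)]

theorem isQuasiconvex_of_fg {H : Subgroup (F N)} (hH : H.FG) : IsQuasiconvex H := by
  classical
  obtain ⟨S, rfl⟩ := hH
  refine ⟨S.biUnion fun s => (Finset.range (s.toWord.length + 1)).image
    fun i => FreeGroup.mk (s.toWord.take i), fun v hv => ?_⟩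
  refine exists_eq_mul_of_mem_Conv_limitSet (P := ↑(S.biUnion fun s =>
    (Finset.range (s.toWord.length + 1)).image fun i => FreeGroup.mk (s.toWord.take i))) ?_ hv
  intro s hs i
  wlog hi : i ≤ s.toWord.length generalizing i
  · have := this s.toWord.length le_rfl
    rwa [List.take_length, ← List.take_of_length_le (le_of_not_ge hi)] at this
  exact Finset.mem_biUnion.2 ⟨s, hs, Finset.mem_image.2
    ⟨i, Finset.mem_range.2 (Nat.lt_succ_of_le hi), rfl⟩⟩

theorem IsQuasiconvex.conj {H : Subgroup (F N)} (hH : IsQuasiconvex H) (g : F N) :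
    IsQuasiconvex (conjSubgroup g H) := by
  classical
  obtain ⟨B, hB⟩ := hH
  refine ⟨B.image fun b => g * b, fun v hv => ?_⟩
  rw [limitSet_conjSubgroup, Conv_image_smul] at hv
  obtain ⟨h, hh, b, hb, e⟩ := hB _ hv
  refine ⟨g * h * g⁻¹, mem_conjSubgroup.2 (by simpa [mul_assoc] using hh), g * b,
    Finset.mem_image_of_mem _ hb, ?_⟩
  rw [inv_mul_eq_iff_eq_mul] at e
  rw [e]; group

/-- Whenever Hb and Kc intersect, their intersection is (H ∩ K)x for any x in it; one such x is
chosen for each of the finitely many pairs (b, c). -/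
theorem exists_finset_inf_mul (H K : Subgroup (F N)) (B C : Finset (F N)) :
    ∃ D : Finset (F N), ∀ v, (∃ h ∈ H, ∃ b ∈ B, v = h * b) → (∃ k ∈ K, ∃ c ∈ C, v = k * c) →
      ∃ h ∈ H ⊓ K, ∃ d ∈ D, v = h * d := by
  classical
  have : ∀ p : F N × F N, ∃ x : F N, (∃ h ∈ H, ∃ k ∈ K, h * p.1 = k * p.2) →
      ∃ h ∈ H, ∃ k ∈ K, x = h * p.1 ∧ x = k * p.2 := by
    intro p
    by_cases h : ∃ h ∈ H, ∃ k ∈ K, h * p.1 = k * p.2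
    · obtain ⟨h, hh, k, hk, e⟩ := h
      exact ⟨h * p.1, fun _ => ⟨h, hh, k, hk, rfl, e⟩⟩
    · exact ⟨1, fun h' => absurd h' h⟩
  choose x hx using this
  refine ⟨(B ×ˢ C).image x, ?_⟩
  rintro v ⟨h, hh, b, hb, rfl⟩ ⟨k, hk, c, hc, e⟩
  obtain ⟨h', hh', k', hk', e1, e2⟩ := hx (b, c) ⟨h, hh, k, hk, e⟩
  refine ⟨h * h'⁻¹, ⟨H.mul_mem hh (H.inv_mem hh'), ?_⟩, x (b, c),
    Finset.mem_image_of_mem _ (Finset.mk_mem_product hb hc), ?_⟩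
  · have : h * h'⁻¹ = k * k'⁻¹ := by
      have e3 : h' * b = k' * c := e1.symm.trans e2
      have h4 : h * h'⁻¹ = (h * b) * (h' * b)⁻¹ := by group
      rw [h4, e, e3]; group
    rw [this]
    exact K.mul_mem hk (K.inv_mem hk')
  · rw [e1]; group

theorem IsQuasiconvex.inf {H K : Subgroup (F N)} (hH : IsQuasiconvex H) (hK : IsQuasiconvex K) :
    IsQuasiconvex (H ⊓ K) := by
  obtain ⟨B, hB⟩ := hH
  obtain ⟨C, hC⟩ := hK
  obtain ⟨D, hD⟩ := exists_finset_inf_mul H K B C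
  exact ⟨D, fun v hv => hD v (hB v (Conv_mono (limitSet_mono inf_le_left) hv))
    (hC v (Conv_mono (limitSet_mono inf_le_right) hv))⟩

theorem limitSetOf_subset_of_forall_exists {A : Set (F N)} {H : Subgroup (F N)} (D : Finset (F N))
    (h : ∀ v ∈ A, ∃ h ∈ H, ∃ d ∈ D, v = h * d) : limitSetOf A ⊆ limitSet H := by
  have h1 : A ⊆ ⋃ d ∈ (D : Set (F N)), (fun h => h * d) '' (H : Set (F N)) := by
    intro v hv
    obtain ⟨h, hh, d, hd, rfl⟩ := h v hv
    exact Set.mem_biUnion hd ⟨h, hh, rfl⟩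
  refine (limitSetOf_mono h1).trans ?_
  rw [limitSetOf_biUnion D.finite_toSet]
  refine Set.iUnion₂_subset fun d _ => ?_
  rw [limitSetOf_mul_right, limitSet_eq]

/-- Rays to a common limit point, starting in the two hulls, stay in them and eventually coincide.
Their common tail thus lies in finitely many right cosets of H ∩ K, whose limit sets are all Λ(H ∩
K). -/
theorem limitSet_inf {H K : Subgroup (F N)} (hH : IsQuasiconvex H) (hK : IsQuasiconvex K) :
    limitSet (H ⊓ K) = limitSet H ∩ limitSet K := by
  refine Set.Subset.antisymm (Set.subset_inter (limitSet_mono inf_le_left)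
    (limitSet_mono inf_le_right)) ?_
  rintro ξ ⟨h1, h2⟩
  have hne : ∀ {L : Subgroup (F N)}, ξ ∈ limitSet L → (Conv (limitSet L)).Nonempty := by
    intro L hL
    refine Conv_nonempty (limitSet_nontrivial ?_)
    rintro rfl
    rw [limitSet_bot] at hL
    exact hL
  obtain ⟨v, hv⟩ := hne h1
  obtain ⟨w, hw⟩ := hne h2
  obtain ⟨a, b, hab⟩ := Quotient.exact ((rayTo_endpoint v ξ).trans (rayTo_endpoint w ξ).symm)
  have hab : ∀ k, (rayTo v ξ).1 (a + k) = (rayTo w ξ).1 (b + k) := hab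
  obtain ⟨B, hB⟩ := hH
  obtain ⟨C, hC⟩ := hK
  obtain ⟨D, hD⟩ := exists_finset_inf_mul H K B C
  have h3 := endpoint_mem_limitSetOf (rayTo v ξ) a
  rw [rayTo_endpoint] at h3
  refine limitSetOf_subset_of_forall_exists D ?_ h3
  rintro _ ⟨k, rfl⟩
  refine hD _ (hB _ (rayTo_mem_Conv hv h1 _)) (hC _ ?_)
  change (rayTo v ξ).1 (a + k) ∈ _
  rw [hab]
  exact rayTo_mem_Conv hw h2 _

/-- Only finitely many translates `g Λ(H)`, `g ∈ F/H`, have a given vertex in their hull. -/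
theorem IsQuasiconvex.finite_image_mk {H : Subgroup (F N)} (hH : IsQuasiconvex H) (v : F N) :
    ((QuotientGroup.mk : F N → F N ⧸ H) '' {g | g⁻¹ * v ∈ Conv (limitSet H)}).Finite := by
  obtain ⟨B, hB⟩ := hH
  refine (B.finite_toSet.image fun b => (QuotientGroup.mk (v * b⁻¹) : F N ⧸ H)).subset ?_
  rintro _ ⟨g, hg, rfl⟩
  obtain ⟨h, hh, b, hb, e⟩ := hB _ hg
  refine ⟨b, hb, ?_⟩
  rw [inv_mul_eq_iff_eq_mul] at e
  rw [QuotientGroup.eq, e]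
  have : (g * (h * b) * b⁻¹)⁻¹ * g = h⁻¹ := by group
  rw [this]
  exact H.inv_mem hh

/-! ### Stabilizers of limit sets and commensurators -/

/-- The stabilizer of the limit set of `H`. -/
def limitStabilizer (H : Subgroup (F N)) : Subgroup (F N) where
  carrier := {g | (fun ξ => g • ξ) '' limitSet H = limitSet H}
  one_mem' := by simp
  mul_mem' := by
    intro g h hg hh
    have : (fun ξ : Boundary N => (g * h) • ξ) = (fun ξ => g • ξ) ∘ fun ξ => h • ξ :=
      funext fun ξ => mul_smul g h ξ
    change (fun ξ => (g * h) • ξ) '' limitSet H = limitSet H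
    rw [this, Set.image_comp, show (fun ξ => h • ξ) '' limitSet H = limitSet H from hh]
    exact hg
  inv_mem' := by
    intro g hg
    have hg : (fun ξ => g • ξ) '' limitSet H = limitSet H := hg
    change (fun ξ => g⁻¹ • ξ) '' limitSet H = limitSet H
    conv_lhs => rw [← hg]
    simp [Set.image_image]

theorem mem_limitStabilizer {H : Subgroup (F N)} {g : F N} :
    g ∈ limitStabilizer H ↔ (fun ξ => g • ξ) '' limitSet H = limitSet H := Iff.rfl

theorem le_limitStabilizer (H : Subgroup (F N)) : H ≤ limitStabilizer H :=
  fun _ hg => image_smul_limitSet_of_mem hg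

/-- Fix a hull vertex v. Every g in the stabilizer keeps v in the hull of gΛ(H), and by
`IsQuasiconvex.finite_image_mk` only finitely many cosets gH do so. -/
theorem IsQuasiconvex.relIndex_limitStabilizer_ne_zero {H : Subgroup (F N)}
    (hH : IsQuasiconvex H) (h1 : H ≠ ⊥) : H.relIndex (limitStabilizer H) ≠ 0 := by
  obtain ⟨v, hv⟩ := Conv_nonempty (limitSet_nontrivial h1)
  have hfin := hH.finite_image_mk v
  let f : limitStabilizer H ⧸ H.subgroupOf (limitStabilizer H) → F N ⧸ H :=
    fun q => QuotientGroup.mk (q.out : F N)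
  have hf : Function.Injective f := by
    intro q r h
    have h := QuotientGroup.eq.1 h
    rw [← QuotientGroup.out_eq' q, ← QuotientGroup.out_eq' r, QuotientGroup.eq]
    exact h
  have hr : Set.range f ⊆ (QuotientGroup.mk : F N → F N ⧸ H) '' {g | g⁻¹ * v ∈ Conv (limitSet H)} := by
    rintro _ ⟨q, rfl⟩
    refine ⟨q.out, ?_, rfl⟩
    have := mem_limitStabilizer.1 q.out.2
    change _ ∈ Conv (limitSet H)
    rw [← Conv_image_smul, this]
    exact hv
  have : Finite (limitStabilizer H ⧸ H.subgroupOf (limitStabilizer H)) :=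
    Set.finite_range_iff hf |>.1 (hfin.subset hr)
  exact Subgroup.index_ne_zero_of_finite

theorem limitSet_subset_of_relIndex_ne_zero {H K : Subgroup (F N)} (h : H.relIndex K ≠ 0) :
    limitSet K ⊆ limitSet H := by
  classical
  have : Finite (K ⧸ H.subgroupOf K) := by
    have : (H.subgroupOf K).FiniteIndex := ⟨h⟩
    infer_instance
  have := Fintype.ofFinite (K ⧸ H.subgroupOf K)
  rw [limitSet_eq K]
  refine limitSetOf_subset_of_forall_exists
    (Finset.univ.image fun q : K ⧸ H.subgroupOf K => (q.out : F N)⁻¹) fun v hv => ?_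
  -- Quotients consist of left cosets, while a decomposition into right cosets of H is needed; hence
  -- the inverses.
  let q : K ⧸ H.subgroupOf K := ((⟨v, hv⟩ : K)⁻¹ : K)
  have h1 : ((q.out : K) : K ⧸ H.subgroupOf K) = ((⟨v, hv⟩ : K)⁻¹ : K) := QuotientGroup.out_eq' q
  rw [QuotientGroup.eq, Subgroup.mem_subgroupOf] at h1
  refine ⟨v * q.out, ?_, _, Finset.mem_image_of_mem _ (Finset.mem_univ q), by simp⟩
  have h2 := inv_mem h1
  simpa using h2

open scoped Pointwise in
-- Commensurable subgroups have the same limit set. Conversely, if gΛ(H) = Λ(H), then H and gHg⁻¹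
-- both have finite index in the common stabilizer, hence are commensurable.
theorem IsQuasiconvex.commensurator_eq {H : Subgroup (F N)} (hH : IsQuasiconvex H) (h1 : H ≠ ⊥) :
    Subgroup.Commensurable.commensurator H = limitStabilizer H := by
  have hsmul : ∀ (g : F N) (H : Subgroup (F N)), ConjAct.toConjAct g • H = conjSubgroup g H :=
    fun _ _ => rfl
  ext g
  rw [Subgroup.Commensurable.commensurator_mem_iff, hsmul, mem_limitStabilizer,
    ← limitSet_conjSubgroup]
  constructor
  · rintro ⟨h2, h3⟩
    exact (limitSet_subset_of_relIndex_ne_zero h3).antisymm (limitSet_subset_of_relIndex_ne_zero h2)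
  · intro h
    have e : limitStabilizer (conjSubgroup g H) = limitStabilizer H := by
      ext x
      rw [mem_limitStabilizer, mem_limitStabilizer, h]
    have h2 := hH.relIndex_limitStabilizer_ne_zero h1
    have h3 := (hH.conj g).relIndex_limitStabilizer_ne_zero (conjSubgroup_ne_bot h1)
    have hle := le_limitStabilizer (conjSubgroup g H)
    rw [e] at h3 hle
    exact ⟨fun h0 => h3 (Subgroup.relIndex_eq_zero_of_le_right (le_limitStabilizer H) h0),
      fun h0 => h2 (Subgroup.relIndex_eq_zero_of_le_right hle h0)⟩

/-! ### The topology of `C_N` -/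

open TopologicalSpace (Compacts)

/-- A closed set with at least two points, as a compact set. -/
def ClosedSets.toCompacts (S : ClosedSets N) : Compacts (Boundary N) := ⟨S.1, S.2.1.isCompact⟩

theorem isEmbedding_toCompacts : IsEmbedding (ClosedSets.toCompacts (N := N)) := by
  refine ⟨?_, fun S T h => Subtype.ext (congrArg (fun K : Compacts (Boundary N) => K.1) h)⟩
  let : TopologicalSpace (Set (Boundary N)) := .vietoris _
  refine (IsInducing.of_comp_iff (Compacts.isEmbedding_coe (α := Boundary N)).isInducing).1 ?_
  exact ⟨rfl⟩

instance : SecondCountableTopology (ClosedSets N) :=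
  isEmbedding_toCompacts.isInducing.secondCountableTopology

instance : T2Space (ClosedSets N) := isEmbedding_toCompacts.t2Space

theorem isOpen_setOf_subset {U : Set (Boundary N)} (hU : IsOpen U) :
    IsOpen {S : ClosedSets N | S.1 ⊆ U} :=
  (Compacts.isOpen_subsets_of_isOpen hU).preimage isEmbedding_toCompacts.continuous

theorem isOpen_setOf_meets {U : Set (Boundary N)} (hU : IsOpen U) :
    IsOpen {S : ClosedSets N | (S.1 ∩ U).Nonempty} :=
  (Compacts.isOpen_inter_nonempty_of_isOpen hU).preimage isEmbedding_toCompacts.continuous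

theorem isClosed_setOf_meets {C : Set (Boundary N)} (hC : IsClosed C) :
    IsClosed {S : ClosedSets N | (S.1 ∩ C).Nonempty} :=
  (Compacts.isClosed_inter_nonempty_of_isClosed hC).preimage isEmbedding_toCompacts.continuous

theorem isClopen_setOf_meets_Cyl (u v : F N) :
    IsClopen {S : ClosedSets N | (S.1 ∩ Cyl u v).Nonempty} :=
  ⟨isClosed_setOf_meets (isClopen_Cyl u v).1, isOpen_setOf_meets (isClopen_Cyl u v).2⟩

theorem mem_Conv_iff_meets {S : Set (Boundary N)} {v : F N} :
    v ∈ Conv S ↔ ∃ u w, u ≠ w ∧ (S ∩ Cyl v u).Nonempty ∧ (S ∩ Cyl v w).Nonempty := by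
  rw [mem_Conv_iff]
  constructor
  · rintro ⟨ξ, hξ, η, hη, h⟩
    exact ⟨_, _, h, ⟨ξ, hξ, mem_Cyl_iff.2 rfl⟩, ⟨η, hη, mem_Cyl_iff.2 rfl⟩⟩
  · rintro ⟨u, w, h, ⟨ξ, hξ, h1⟩, ⟨η, hη, h2⟩⟩
    refine ⟨ξ, hξ, η, hη, ?_⟩
    rwa [mem_Cyl_iff.1 h1, mem_Cyl_iff.1 h2]

/-- The set of `S ∈ C_N` whose convex hull contains `v`. -/
def hullSet (v : F N) : Set (ClosedSets N) := {S | v ∈ Conv S.1}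

theorem isOpen_hullSet (v : F N) : IsOpen (hullSet v) := by
  have : hullSet v = ⋃ u, ⋃ w, ⋃ (_ : u ≠ w), {S : ClosedSets N | (S.1 ∩ Cyl v u).Nonempty} ∩
      {S | (S.1 ∩ Cyl v w).Nonempty} := by
    ext S
    simp only [hullSet, Set.mem_ofPred_eq, mem_Conv_iff_meets, Set.mem_iUnion, Set.mem_inter_iff,
      exists_prop]
  rw [this]
  exact isOpen_iUnion fun u => isOpen_iUnion fun w => isOpen_iUnion fun _ =>
    (isClopen_setOf_meets_Cyl v u).2.inter (isClopen_setOf_meets_Cyl v w).2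

/-- In the compact space of all closed subsets of ∂X, those whose hull misses v are the empty set
and the sets inside a single cylinder at v. This is an open condition, and the complement consists
of sets with at least two points. -/
theorem isCompact_hullSet (v : F N) : IsCompact (hullSet v) := by
  rw [isEmbedding_toCompacts.isInducing.isCompact_iff]
  have h : ClosedSets.toCompacts '' hullSet v = {K : Compacts (Boundary N) | v ∈ Conv (K : Set _)} := by
    ext K
    constructor
    · rintro ⟨S, hS, rfl⟩
      exact hS
    · intro hK
      exact ⟨⟨K, K.2.isClosed, nontrivial_of_mem_Conv hK⟩, hK, rfl⟩
  rw [h]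
  refine IsClosed.isCompact ?_
  have h2 : {K : Compacts (Boundary N) | v ∈ Conv (K : Set _)} =
      ({K : Compacts (Boundary N) | (K : Set (Boundary N)) ⊆ ∅} ∪
        ⋃ u, {K : Compacts (Boundary N) | (K : Set (Boundary N)) ⊆ Cyl v u})ᶜ := by
    ext K
    simp only [Set.mem_ofPred_eq, Set.mem_compl_iff, Set.mem_union, Set.mem_iUnion, not_or, not_exists]
    constructor
    · intro hK
      obtain ⟨ξ, hξ, η, hη, hne⟩ := mem_Conv_iff.1 hK
      refine ⟨fun h => h hξ, fun u h => hne ?_⟩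
      rw [mem_Cyl_iff.1 (h hξ), mem_Cyl_iff.1 (h hη)]
    · rintro ⟨h1, h2⟩
      obtain ⟨ξ, hξ⟩ := Set.nonempty_iff_ne_empty.2 fun h => h1 (Set.subset_empty_iff.2 h)
      obtain ⟨η, hη, hne⟩ := Set.not_subset.1 (h2 (dir v ξ))
      exact mem_Conv_iff.2 ⟨ξ, hξ, η, hη, fun h => hne (mem_Cyl_iff.2 h.symm)⟩
  rw [h2, isClosed_compl_iff]
  exact (Compacts.isOpen_subsets_of_isOpen isOpen_empty).union
    (isOpen_iUnion fun u => Compacts.isOpen_subsets_of_isOpen (isClopen_Cyl v u).2)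

theorem isClopen_hullSet (v : F N) : IsClopen (hullSet v) :=
  ⟨(isCompact_hullSet v).isClosed, isOpen_hullSet v⟩

theorem iUnion_hullSet : ⋃ v : F N, hullSet v = Set.univ := by
  exact Set.eq_univ_of_forall fun S => Set.mem_iUnion.2 (Conv_nonempty S.2.2)

theorem exists_finset_hullSet {K : Set (ClosedSets N)} (hK : IsCompact K) :
    ∃ B : Finset (F N), K ⊆ ⋃ v ∈ B, hullSet v :=
  hK.elim_finite_subcover hullSet isOpen_hullSet (by rw [iUnion_hullSet]; exact Set.subset_univ K)

theorem continuous_translate (g : F N) : Continuous (ClosedSets.translate g) := by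
  let : TopologicalSpace (Set (Boundary N)) := .vietoris _
  refine continuous_induced_rng.2 ?_
  exact (Continuous.image_vietoris (continuous_const_smul g)).comp continuous_induced_dom

theorem measurable_translate (g : F N) : Measurable (ClosedSets.translate g) :=
  (continuous_translate g).measurable

theorem translate_mul (g h : F N) (S : ClosedSets N) :
    ClosedSets.translate (g * h) S = ClosedSets.translate g (ClosedSets.translate h S) := by
  apply Subtype.ext
  simp [ClosedSets.translate, Set.image_image, mul_smul]

theorem translate_one (S : ClosedSets N) : ClosedSets.translate 1 S = S := by
  apply Subtype.ext
  simp [ClosedSets.translate]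

theorem translate_preimage_hullSet (g v : F N) :
    ClosedSets.translate g ⁻¹' hullSet v = hullSet (g⁻¹ * v) := by
  ext S
  exact Conv_image_smul g S.1 v

/-! ### Subset currents -/

theorem measure_hullSet_lt_top (μ : SCurr N) (v : F N) :
    (μ : Measure (ClosedSets N)) (hullSet v) < ∞ := μ.2.1 _ (isCompact_hullSet v)

theorem measure_translate_preimage (μ : SCurr N) (g : F N) {U : Set (ClosedSets N)}
    (hU : MeasurableSet U) : (μ : Measure (ClosedSets N)) (ClosedSets.translate g ⁻¹' U) =
      (μ : Measure (ClosedSets N)) U := μ.2.2 g U hU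

instance (μ : SCurr N) : IsFiniteMeasureOnCompacts (μ : Measure (ClosedSets N)) := ⟨μ.2.1⟩

instance (μ : SCurr N) : SigmaFinite (μ : Measure (ClosedSets N)) := by
  refine Measure.sigmaFinite_of_countable (S := Set.range hullSet) (Set.countable_range _) ?_ ?_
  · rintro _ ⟨v, rfl⟩
    exact measure_hullSet_lt_top μ v
  · rw [Set.sUnion_range, iUnion_hullSet]

/-- Every compact set is covered by finitely many of the open sets `hullSet v`. -/
theorem mem_SCurr {μ : Measure (ClosedSets N)} (h1 : ∀ v, μ (hullSet v) < ∞)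
    (h2 : ∀ (g : F N) (U : Set (ClosedSets N)), MeasurableSet U →
      μ (ClosedSets.translate g ⁻¹' U) = μ U) : μ ∈ SCurr N := by
  refine ⟨fun K hK => ?_, h2⟩
  obtain ⟨B, hB⟩ := exists_finset_hullSet hK
  refine (measure_mono hB).trans_lt ((measure_biUnion_finset_le B _).trans_lt ?_)
  exact ENNReal.sum_lt_top.2 fun v _ => h1 v

/-! ### Measurability of the intersection map -/

/-- The pairs `(S₁, S₂)` such that `S₁ ∩ S₂` meets `C`. -/
def meetSet (C : Set (Boundary N)) : Set (ClosedSets N × ClosedSets N) :=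
  {p | (p.1.1 ∩ p.2.1 ∩ C).Nonempty}

/-- If S ∩ T misses C, then S ∩ C and T ∩ C have disjoint open neighbourhoods U and V. The Vietoris
conditions of lying in U ∪ Cᶜ and in V ∪ Cᶜ keep nearby intersections away from C. -/
theorem isClosed_meetSet {C : Set (Boundary N)} (hC : IsClosed C) : IsClosed (meetSet C) := by
  rw [← isOpen_compl_iff, isOpen_iff_forall_mem_open]
  rintro ⟨S, T⟩ h
  have hd : Disjoint (S.1 ∩ C) (T.1 ∩ C) := by
    rw [Set.disjoint_iff]
    rintro ξ ⟨h1, h2⟩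
    exact h ⟨ξ, ⟨h1.1, h2.1⟩, h1.2⟩
  obtain ⟨U, V, hU, hV, hSU, hTV, hUV⟩ := normal_separation (S.2.1.inter hC) (T.2.1.inter hC) hd
  refine ⟨{S' : ClosedSets N | S'.1 ⊆ U ∪ Cᶜ} ×ˢ {T' : ClosedSets N | T'.1 ⊆ V ∪ Cᶜ}, ?_,
    (isOpen_setOf_subset (hU.union hC.isOpen_compl)).prod
      (isOpen_setOf_subset (hV.union hC.isOpen_compl)), ?_, ?_⟩
  · rintro ⟨S', T'⟩ ⟨h1, h2⟩ ⟨ξ, ⟨h3, h4⟩, h5⟩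
    exact Set.disjoint_iff.1 hUV ⟨(h1 h3).resolve_right fun h => h h5,
      (h2 h4).resolve_right fun h => h h5⟩
  · intro ξ hξ
    by_cases hc : ξ ∈ C
    · exact Or.inl (hSU ⟨hξ, hc⟩)
    · exact Or.inr hc
  · intro ξ hξ
    by_cases hc : ξ ∈ C
    · exact Or.inl (hTV ⟨hξ, hc⟩)
    · exact Or.inr hc

theorem measurableSet_meetSet {C : Set (Boundary N)} (hC : IsClosed C) :
    MeasurableSet (meetSet C) := (isClosed_meetSet hC).measurableSet

theorem measurableSet_meetSet_Cyl (u v : F N) : MeasurableSet (meetSet (Cyl u v)) :=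
  measurableSet_meetSet (isClopen_Cyl u v).1

theorem measurableSet_meetSet_of_isOpen {U : Set (Boundary N)} (hU : IsOpen U) :
    MeasurableSet (meetSet U) := by
  let := TopologicalSpace.metrizableSpaceMetric (Boundary N)
  obtain ⟨C, hC, -, rfl, -⟩ := hU.exists_iUnion_isClosed
  have : meetSet (⋃ n, C n) = ⋃ n, meetSet (C n) := by
    ext p
    simp [meetSet, Set.inter_iUnion]
  rw [this]
  exact MeasurableSet.iUnion fun n => measurableSet_meetSet (hC n)

/-- The pairs `(S₁, S₂)` such that `v` is in the hull of `S₁ ∩ S₂`. -/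
def interHullSet (v : F N) : Set (ClosedSets N × ClosedSets N) :=
  {p | v ∈ Conv (p.1.1 ∩ p.2.1)}

theorem measurableSet_interHullSet (v : F N) : MeasurableSet (interHullSet v) := by
  have : interHullSet v = ⋃ u, ⋃ w, ⋃ (_ : u ≠ w), meetSet (Cyl v u) ∩ meetSet (Cyl v w) := by
    ext p
    simp only [interHullSet, meetSet, Set.mem_ofPred_eq, mem_Conv_iff_meets, Set.mem_iUnion,
      Set.mem_inter_iff, exists_prop]
  rw [this]
  exact MeasurableSet.iUnion fun u => MeasurableSet.iUnion fun w => MeasurableSet.iUnion fun _ =>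
    (measurableSet_meetSet_Cyl v u).inter (measurableSet_meetSet_Cyl v w)

/-- The pairs `(S₁, S₂)` such that `S₁ ∩ S₂` has at least two points. -/
def interDomain (N : ℕ) : Set (ClosedSets N × ClosedSets N) := {p | (p.1.1 ∩ p.2.1).Nontrivial}

theorem measurableSet_interDomain : MeasurableSet (interDomain N) := by
  have : interDomain N = ⋃ v, interHullSet v := by
    ext p
    simp only [interDomain, interHullSet, Set.mem_ofPred_eq, Set.mem_iUnion]
    exact ⟨Conv_nonempty, fun ⟨v, hv⟩ => nontrivial_of_mem_Conv hv⟩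
  rw [this]
  exact MeasurableSet.iUnion measurableSet_interHullSet

/-- The intersection map. -/
def interMap (p : interDomain N) : ClosedSets N :=
  ⟨p.1.1.1 ∩ p.1.2.1, p.1.1.2.1.inter p.1.2.2.1, p.2⟩

/-- By second countability the Vietoris subbasis generates the Borel sets, and both kinds of
subbasic sets pull back to conditions on `meetSet`. The map itself need not be continuous. -/
theorem measurable_interMap : Measurable (interMap (N := N)) := by
  let : TopologicalSpace (Set (Boundary N)) := .vietoris _
  have h : borel (ClosedSets N) =
      MeasurableSpace.generateFrom (Set.preimage Subtype.val ''
        (Set.powerset '' {U | IsOpen U} ∪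
          (fun V => {s | (s ∩ V).Nonempty}) '' {V : Set (Boundary N) | IsOpen V})) :=
    borel_eq_generateFrom_of_subbasis (induced_generateFrom_eq)
  suffices H : @Measurable _ _ _ (borel (ClosedSets N)) (interMap (N := N)) from H
  rw [h]
  refine measurable_generateFrom ?_
  rintro _ ⟨_, ⟨U, hU, rfl⟩ | ⟨U, hU, rfl⟩, rfl⟩
  · have hU : IsOpen U := hU
    have h1 := measurable_subtype_coe (p := (· ∈ interDomain N))
      (measurableSet_meetSet hU.isClosed_compl).compl
    refine (congrArg MeasurableSet (Set.ext fun p => ?_)).mpr h1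
    change p.1.1.1 ∩ p.1.2.1 ⊆ U ↔ ¬ (p.1.1.1 ∩ p.1.2.1 ∩ Uᶜ).Nonempty
    rw [Set.inter_compl_nonempty_iff, not_not]
  · exact measurable_subtype_coe (measurableSet_meetSet_of_isOpen hU)

theorem interPreimage_eq (U : Set (ClosedSets N)) :
    interPreimage U = Subtype.val '' (interMap ⁻¹' U) := by
  ext p
  constructor
  · rintro ⟨S, hS, h⟩
    have hp : p ∈ interDomain N := by
      change (p.1.1 ∩ p.2.1).Nontrivial
      rw [← h]
      exact S.2.2
    have h1 : interMap ⟨p, hp⟩ = S := Subtype.ext h.symm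
    exact ⟨⟨p, hp⟩, by rwa [Set.mem_preimage, h1], rfl⟩
  · rintro ⟨q, hq, rfl⟩
    exact ⟨interMap q, hq, rfl⟩

theorem measurableSet_interPreimage {U : Set (ClosedSets N)} (hU : MeasurableSet U) :
    MeasurableSet (interPreimage U) := by
  rw [interPreimage_eq]
  exact measurableSet_interDomain.subtype_image (measurable_interMap hU)

/-! ### Counting currents -/

/-- The sum of the Dirac measures at the translates `g S`, over the cosets `g ∈ F/H`. -/
def cosetCounting (H : Subgroup (F N)) (S : ClosedSets N) : Measure (ClosedSets N) :=
  Measure.sum fun q : F N ⧸ H => Measure.dirac (ClosedSets.translate q.out S)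

theorem cosetCounting_apply (H : Subgroup (F N)) (S : ClosedSets N) {U : Set (ClosedSets N)}
    (hU : MeasurableSet U) : cosetCounting H S U =
      ∑' q : F N ⧸ H, U.indicator 1 (ClosedSets.translate q.out S) := by
  rw [cosetCounting, Measure.sum_apply _ hU]
  exact tsum_congr fun q => Measure.dirac_apply' _ hU

theorem translate_mk_out {H : Subgroup (F N)} {S : ClosedSets N}
    (hS : ∀ h ∈ H, ClosedSets.translate h S = S) (g : F N) :
    ClosedSets.translate (Quotient.out (g : F N ⧸ H)) S = ClosedSets.translate g S := by
  obtain ⟨h, hh⟩ := QuotientGroup.mk_out_eq_mul H g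
  rw [hh, translate_mul, hS h h.2]

theorem cosetCounting_translate {H : Subgroup (F N)} {S : ClosedSets N}
    (hS : ∀ h ∈ H, ClosedSets.translate h S = S) (g : F N) {U : Set (ClosedSets N)}
    (hU : MeasurableSet U) :
    cosetCounting H S (ClosedSets.translate g ⁻¹' U) = cosetCounting H S U := by
  rw [cosetCounting_apply H S (measurable_translate g hU), cosetCounting_apply H S hU]
  conv_rhs => rw [← (MulAction.toPerm g : Equiv.Perm (F N ⧸ H)).tsum_eq]
  refine tsum_congr fun q => ?_
  have h1 : MulAction.toPerm g q = ((g * q.out : F N) : F N ⧸ H) := by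
    conv_lhs => rw [← QuotientGroup.out_eq' q]
    rfl
  rw [h1, translate_mk_out hS, translate_mul]
  rfl

/-- Each coset of K splits into [K : H] cosets of H, all giving the same translate of S. This is the
source of the index in η_H. -/
theorem cosetCounting_of_le {H K : Subgroup (F N)} (hHK : H ≤ K) (hr : H.relIndex K ≠ 0)
    {S : ClosedSets N} (hS : ∀ h ∈ K, ClosedSets.translate h S = S) :
    cosetCounting H S = H.relIndex K • cosetCounting K S := by
  ext U hU
  rw [Measure.smul_apply, cosetCounting_apply H S hU, cosetCounting_apply K S hU, nsmul_eq_mul]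
  let e := Subgroup.quotientEquivProdOfLE hHK
  have h1 : ∀ q : F N ⧸ H, ClosedSets.translate q.out S =
      ClosedSets.translate (e q).1.out S := by
    intro q
    have : (e q).1 = ((q.out : F N) : F N ⧸ K) := by
      conv_lhs => rw [← QuotientGroup.out_eq' q]
      rfl
    rw [this, translate_mk_out hS]
  have h2 : ∑' q : F N ⧸ H, U.indicator (1 : ClosedSets N → ℝ≥0∞) (ClosedSets.translate q.out S) =
      ∑' p : (F N ⧸ K) × K ⧸ H.subgroupOf K,
        U.indicator (1 : ClosedSets N → ℝ≥0∞) (ClosedSets.translate p.1.out S) := by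
    rw [← e.tsum_eq]
    exact tsum_congr fun q => by rw [h1]
  have : Finite (K ⧸ H.subgroupOf K) := by
    have : (H.subgroupOf K).FiniteIndex := ⟨hr⟩
    infer_instance
  rw [h2, ENNReal.tsum_prod', ← ENNReal.tsum_mul_left]
  refine tsum_congr fun q => ?_
  change ∑' _ : K ⧸ H.subgroupOf K,
    U.indicator (1 : ClosedSets N → ℝ≥0∞) (ClosedSets.translate q.out S) = _
  rw [ENNReal.tsum_const, ENat.card_eq_coe_natCard]
  rfl

/-- The limit set of a non-trivial subgroup, as an element of `C_N`. -/
def limitPoint (H : Subgroup (F N)) (h : H ≠ ⊥) : ClosedSets N :=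
  ⟨limitSet H, isClosed_limitSet H, limitSet_nontrivial h⟩

theorem translate_limitPoint {H : Subgroup (F N)} (h : H ≠ ⊥) {g : F N}
    (hg : g ∈ limitStabilizer H) :
    ClosedSets.translate g (limitPoint H h) = limitPoint H h :=
  Subtype.ext hg

theorem translate_limitPoint_of_mem {H : Subgroup (F N)} (h : H ≠ ⊥) {g : F N} (hg : g ∈ H) :
    ClosedSets.translate g (limitPoint H h) = limitPoint H h :=
  translate_limitPoint h (le_limitStabilizer H hg)

/-- Writing K for the stabilizer, gK ↦ (gKg⁻¹, gΛ(H)) is well defined, and it is injective because K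
is the full stabilizer of Λ(H). -/
theorem conjCounting_limitStabilizer {H : Subgroup (F N)} (h : H ≠ ⊥)
    (hl : limitSet (limitStabilizer H) = limitSet H) :
    conjCounting (limitStabilizer H) = cosetCounting (limitStabilizer H) (limitPoint H h) := by
  set K := limitStabilizer H with hK
  let f : F N ⧸ K → {p : Subgroup (F N) × ClosedSets N //
      (∃ g : F N, p.1 = conjSubgroup g K) ∧ p.2.1 = limitSet p.1} := fun q =>
    ⟨(conjSubgroup q.out K, ClosedSets.translate q.out (limitPoint H h)), ⟨_, rfl⟩, by
      rw [limitSet_conjSubgroup, hl]; rfl⟩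
  have hf : Function.Bijective f := by
    constructor
    · intro q r hqr
      have h1 : ClosedSets.translate q.out (limitPoint H h) =
          ClosedSets.translate r.out (limitPoint H h) := congrArg (fun p => p.1.2) hqr
      have h2 : q.out⁻¹ * r.out ∈ K := by
        refine mem_limitStabilizer.2 ?_
        have h3 : ClosedSets.translate (q.out⁻¹ * r.out) (limitPoint H h) = limitPoint H h := by
          rw [translate_mul, ← h1, ← translate_mul, inv_mul_cancel, translate_one]
        exact congrArg Subtype.val h3
      rw [← QuotientGroup.out_eq' q, ← QuotientGroup.out_eq' r, QuotientGroup.eq]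
      exact h2
    · rintro ⟨⟨H', S⟩, ⟨g, hg⟩, hS⟩
      simp only at hg hS
      subst hg
      obtain ⟨k, hk⟩ := QuotientGroup.mk_out_eq_mul K g
      have h1 : conjSubgroup (Quotient.out (g : F N ⧸ K)) K = conjSubgroup g K := by
        rw [hk, conjSubgroup_mul, conjSubgroup_of_mem k.2]
      refine ⟨(g : F N ⧸ K), Subtype.ext (Prod.ext h1 ?_)⟩
      change ClosedSets.translate _ _ = S
      rw [translate_mk_out fun k hk => translate_limitPoint h hk]
      apply Subtype.ext
      rw [hS, limitSet_conjSubgroup, hl]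
      rfl
  ext U hU
  rw [conjCounting, cosetCounting, Measure.sum_apply _ hU, Measure.sum_apply _ hU,
    ← (Equiv.ofBijective f hf).tsum_eq]
  rfl

theorem IsQuasiconvex.limitSet_limitStabilizer {H : Subgroup (F N)} (hH : IsQuasiconvex H)
    (h : H ≠ ⊥) : limitSet (limitStabilizer H) = limitSet H :=
  (limitSet_subset_of_relIndex_ne_zero (hH.relIndex_limitStabilizer_ne_zero h)).antisymm
    (limitSet_mono (le_limitStabilizer H))

theorem counting_bot : counting (⊥ : Subgroup (F N)) = 0 := if_pos rfl

/-- `η_H` is the sum of the Dirac measures at `g Λ(H)` over the cosets `g ∈ F/H`. -/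
theorem IsQuasiconvex.counting_eq {H : Subgroup (F N)} (hH : IsQuasiconvex H) (h : H ≠ ⊥) :
    counting H = cosetCounting H (limitPoint H h) := by
  rw [counting, if_neg h, hH.commensurator_eq h,
    conjCounting_limitStabilizer h (hH.limitSet_limitStabilizer h)]
  exact (cosetCounting_of_le (le_limitStabilizer H) (hH.relIndex_limitStabilizer_ne_zero h)
    fun k hk => translate_limitPoint h hk).symm

theorem IsQuasiconvex.counting_mem_SCurr {H : Subgroup (F N)} (hH : IsQuasiconvex H) :
    counting H ∈ SCurr N := by
  by_cases h : H = ⊥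
  · subst h
    rw [counting_bot]
    exact zero_mem _
  rw [hH.counting_eq h]
  refine mem_SCurr (fun v => ?_) fun g U hU =>
    cosetCounting_translate (fun k hk => translate_limitPoint_of_mem h hk) g hU
  rw [cosetCounting_apply _ _ (isOpen_hullSet v).measurableSet]
  rw [tsum_eq_sum (s := (hH.finite_image_mk v).toFinset)]
  · refine ENNReal.sum_lt_top.2 fun q _ => ?_
    exact (Set.indicator_le_self' (fun _ _ => zero_le) _).trans_lt ENNReal.one_lt_top
  · intro q hq
    refine Set.indicator_of_notMem (fun hv => hq ?_) _
    rw [Set.Finite.mem_toFinset]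
    refine ⟨q.out, ?_, QuotientGroup.out_eq' q⟩
    exact (Conv_image_smul q.out (limitSet H) v).1 hv

theorem counting_mem_SCurr {H : Subgroup (F N)} (hH : H.FG) : counting H ∈ SCurr N :=
  (isQuasiconvex_of_fg hH).counting_mem_SCurr

/-! ### The intersection product -/

/-- The push-forward of `μ × ν` under the intersection map. -/
def interMeasure (μ ν : Measure (ClosedSets N)) : Measure (ClosedSets N) :=
  ((μ.prod ν).comap (Subtype.val : interDomain N → _)).map interMap

theorem interMeasure_apply (μ ν : Measure (ClosedSets N)) {U : Set (ClosedSets N)}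
    (hU : MeasurableSet U) : interMeasure μ ν U = (μ.prod ν) (interPreimage U) := by
  rw [interMeasure, Measure.map_apply measurable_interMap hU,
    Measure.comap_apply _ Subtype.val_injective
      (fun s hs => measurableSet_interDomain.subtype_image hs) _ (measurable_interMap hU),
    interPreimage_eq]

theorem map_translate (μ : SCurr N) (g : F N) :
    (μ : Measure (ClosedSets N)).map (ClosedSets.translate g) = μ := by
  ext U hU
  rw [Measure.map_apply (measurable_translate g) hU, measure_translate_preimage μ g hU]

/-- The diagonal action of `F_N` on pairs. -/
def translatePair (g : F N) : ClosedSets N × ClosedSets N → ClosedSets N × ClosedSets N :=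
  Prod.map (ClosedSets.translate g) (ClosedSets.translate g)

theorem measurable_translatePair (g : F N) : Measurable (translatePair g) :=
  (measurable_translate g).prodMap (measurable_translate g)

theorem prod_translatePair_preimage (μ ν : SCurr N) (g : F N)
    {A : Set (ClosedSets N × ClosedSets N)} (hA : MeasurableSet A) :
    ((μ : Measure (ClosedSets N)).prod (ν : Measure (ClosedSets N))) (translatePair g ⁻¹' A) =
      ((μ : Measure (ClosedSets N)).prod (ν : Measure (ClosedSets N))) A := by
  rw [← Measure.map_apply (measurable_translatePair g) hA, translatePair,
    ← Measure.map_prod_map _ _ (measurable_translate g) (measurable_translate g),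
    map_translate, map_translate]

theorem translate_inter (g : F N) (S T : ClosedSets N) :
    (ClosedSets.translate g S).1 ∩ (ClosedSets.translate g T).1 =
      (fun ξ => g • ξ) '' (S.1 ∩ T.1) :=
  (Set.image_inter (MulAction.injective g)).symm

theorem translatePair_mem_interPreimage (g : F N) (p : ClosedSets N × ClosedSets N)
    (U : Set (ClosedSets N)) :
    translatePair g p ∈ interPreimage U ↔ p ∈ interPreimage (ClosedSets.translate g ⁻¹' U) := by
  constructor
  · rintro ⟨S, hS, h⟩
    refine ⟨ClosedSets.translate g⁻¹ S, ?_, ?_⟩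
    · rw [Set.mem_preimage, ← translate_mul, mul_inv_cancel, translate_one]
      exact hS
    · change (fun ξ => g⁻¹ • ξ) '' S.1 = _
      rw [h, translatePair, Prod.map_fst, Prod.map_snd, translate_inter, Set.image_image]
      simp
  · rintro ⟨S, hS, h⟩
    refine ⟨ClosedSets.translate g S, hS, ?_⟩
    rw [translatePair, Prod.map_fst, Prod.map_snd, translate_inter, ← h]
    rfl

theorem interPreimage_hullSet (v : F N) : interPreimage (hullSet v) = interHullSet v := by
  ext p
  constructor
  · rintro ⟨S, hS, h⟩
    change v ∈ Conv (p.1.1 ∩ p.2.1)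
    rw [← h]
    exact hS
  · intro h
    exact ⟨⟨p.1.1 ∩ p.2.1, p.1.2.1.inter p.2.2.1, nontrivial_of_mem_Conv h⟩, h, rfl⟩

theorem interHullSet_subset (v : F N) : interHullSet v ⊆ hullSet v ×ˢ hullSet v :=
  fun _ hp => ⟨Conv_mono Set.inter_subset_left hp, Conv_mono Set.inter_subset_right hp⟩

theorem prod_hullSet_lt_top (μ ν : SCurr N) (v : F N) :
    ((μ : Measure (ClosedSets N)).prod (ν : Measure (ClosedSets N))) (hullSet v ×ˢ hullSet v)
      < ∞ := by
  rw [Measure.prod_prod]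
  exact ENNReal.mul_lt_top (measure_hullSet_lt_top μ v) (measure_hullSet_lt_top ν v)

theorem interMeasure_mem_SCurr (μ ν : SCurr N) :
    interMeasure (μ : Measure (ClosedSets N)) (ν : Measure (ClosedSets N)) ∈ SCurr N := by
  refine mem_SCurr (fun v => ?_) fun g U hU => ?_
  · rw [interMeasure_apply _ _ (isOpen_hullSet v).measurableSet, interPreimage_hullSet]
    exact (measure_mono (interHullSet_subset v)).trans_lt (prod_hullSet_lt_top μ ν v)
  · rw [interMeasure_apply _ _ hU, interMeasure_apply _ _ (measurable_translate g hU),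
      ← prod_translatePair_preimage μ ν g (measurableSet_interPreimage hU)]
    congr 1
    ext p
    exact (translatePair_mem_interPreimage g p U).symm

/-- The intersection product of two subset currents. -/
def interCurrent (μ ν : SCurr N) : SCurr N := ⟨_, interMeasure_mem_SCurr μ ν⟩

theorem interCurrent_apply (μ ν : SCurr N) {U : Set (ClosedSets N)} (hU : MeasurableSet U) :
    (interCurrent μ ν : Measure (ClosedSets N)) U =
      ((μ : Measure (ClosedSets N)).prod (ν : Measure (ClosedSets N))) (interPreimage U) :=
  interMeasure_apply _ _ hU

/-- The intersection product as a bilinear map. -/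
def interBilin (N : ℕ) : SCurr N →ₗ[ℝ≥0] SCurr N →ₗ[ℝ≥0] SCurr N :=
  LinearMap.mk₂ ℝ≥0 interCurrent
    (fun μ μ' ν => Subtype.ext <| Measure.ext fun U hU => by
      rw [interCurrent_apply _ _ hU, Submodule.coe_add, Submodule.coe_add, Measure.add_apply,
        interCurrent_apply _ _ hU, interCurrent_apply _ _ hU, Measure.add_prod, Measure.add_apply])
    (fun c μ ν => Subtype.ext <| Measure.ext fun U hU => by
      rw [interCurrent_apply _ _ hU, Submodule.coe_smul, Submodule.coe_smul, Measure.smul_apply,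
        interCurrent_apply _ _ hU, Measure.prod_smul_left, Measure.smul_apply])
    (fun μ ν ν' => Subtype.ext <| Measure.ext fun U hU => by
      rw [interCurrent_apply _ _ hU, Submodule.coe_add, Submodule.coe_add, Measure.add_apply,
        interCurrent_apply _ _ hU, interCurrent_apply _ _ hU, Measure.prod_add, Measure.add_apply])
    (fun c μ ν => Subtype.ext <| Measure.ext fun U hU => by
      have hm := measurableSet_interPreimage hU
      conv_rhs => rw [Submodule.coe_smul, Measure.smul_apply, interCurrent_apply _ _ hU]
      rw [interCurrent_apply _ _ hU, Measure.prod_apply hm, Measure.prod_apply hm, ENNReal.smul_def,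
        smul_eq_mul, ← lintegral_const_mul _ (measurable_measure_prodMk_left hm)]
      refine lintegral_congr fun S => ?_
      rw [Submodule.coe_smul, Measure.smul_apply, ENNReal.smul_def, smul_eq_mul])

/-! ### Intersections of counting currents -/

/-- `F`-orbits of pairs of cosets correspond to double cosets. -/
theorem bijective_coset_pairs (H K : Subgroup (F N)) :
    Function.Bijective fun p : (d : DoubleCoset.Quotient (H : Set (F N)) (K : Set (F N))) ×
        F N ⧸ (H ⊓ conjSubgroup (Quotient.out d) K) =>
      (((p.2.out : F N) : F N ⧸ H), ((p.2.out * Quotient.out p.1 : F N) : F N ⧸ K)) := by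
  constructor
  · rintro ⟨d, x⟩ ⟨d', x'⟩ h
    simp only [Prod.mk.injEq, QuotientGroup.eq] at h
    obtain ⟨h1, h2⟩ := h
    have hd : d = d' := by
      rw [← DoubleCoset.out_eq' H K d, ← DoubleCoset.out_eq' H K d', DoubleCoset.eq]
      refine ⟨_, H.inv_mem h1, _, h2, ?_⟩
      group
    subst hd
    congr 1
    rw [← QuotientGroup.out_eq' x, ← QuotientGroup.out_eq' x', QuotientGroup.eq]
    refine ⟨h1, mem_conjSubgroup.2 ?_⟩
    convert h2 using 1
    group
  · rintro ⟨q, r⟩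
    obtain ⟨g, rfl⟩ := QuotientGroup.mk_surjective q
    obtain ⟨k, rfl⟩ := QuotientGroup.mk_surjective r
    obtain ⟨a, b, ha, hb, hab⟩ := DoubleCoset.mk_out_eq_mul H K (g⁻¹ * k)
    set d := DoubleCoset.mk H K (g⁻¹ * k) with hd
    obtain ⟨⟨l, hl1, hl2⟩, hl⟩ :=
      -- The representative of the double coset is a g⁻¹ k b, so g a⁻¹ carries it to k b, while it
      -- also represents gH.
      QuotientGroup.mk_out_eq_mul (H ⊓ conjSubgroup (Quotient.out d) K) (g * a⁻¹)
    refine ⟨⟨d, ((g * a⁻¹ : F N) : F N ⧸ (H ⊓ conjSubgroup (Quotient.out d) K))⟩, ?_⟩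
    simp only [Prod.mk.injEq]
    rw [hl]
    constructor
    · rw [QuotientGroup.eq]
      have : (g * a⁻¹ * l)⁻¹ * g = l⁻¹ * a := by group
      rw [this]
      exact H.mul_mem (H.inv_mem hl1) ha
    · rw [QuotientGroup.eq]
      have hl2 := mem_conjSubgroup.1 hl2
      have h3 : (g * a⁻¹ * l * Quotient.out d)⁻¹ * k =
          ((Quotient.out d)⁻¹ * l * Quotient.out d)⁻¹ * ((Quotient.out d)⁻¹ * (a * g⁻¹ * k)) := by
        group
      rw [h3]
      refine K.mul_mem (K.inv_mem hl2) ?_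
      rw [hab]
      have : (a * (g⁻¹ * k) * b)⁻¹ * (a * g⁻¹ * k) = b⁻¹ := by group
      rw [this]
      exact K.inv_mem hb

theorem prod_cosetCounting_apply (H K : Subgroup (F N)) (S T : ClosedSets N)
    {A : Set (ClosedSets N × ClosedSets N)} (hA : MeasurableSet A) :
    ((cosetCounting H S).prod (cosetCounting K T)) A =
      ∑' p : (F N ⧸ H) × (F N ⧸ K),
        A.indicator 1 (ClosedSets.translate p.1.out S, ClosedSets.translate p.2.out T) := by
  have : Countable (F N ⧸ K) := QuotientGroup.mk_surjective.countable
  rw [cosetCounting, cosetCounting, Measure.prod_sum, Measure.sum_apply _ hA]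
  refine tsum_congr fun p => ?_
  rw [Measure.dirac_prod_dirac, Measure.dirac_apply' _ hA]

/-- The pair (xΛ(H), xdΛ(K)) intersects in xΛ(H ∩ dKd⁻¹). If the subgroup is trivial this is empty,
and both sides vanish. -/
theorem counting_inf_conjSubgroup_apply {H K : Subgroup (F N)} (hH : IsQuasiconvex H)
    (hK : IsQuasiconvex K) (h : H ≠ ⊥) (k : K ≠ ⊥) (d : F N) {U : Set (ClosedSets N)}
    (hU : MeasurableSet U) :
    counting (H ⊓ conjSubgroup d K) U = ∑' x : F N ⧸ (H ⊓ conjSubgroup d K),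
      (interPreimage U).indicator 1 (ClosedSets.translate x.out (limitPoint H h),
        ClosedSets.translate (x.out * d) (limitPoint K k)) := by
  have hL : limitSet (H ⊓ conjSubgroup d K) =
      (limitPoint H h).1 ∩ (ClosedSets.translate d (limitPoint K k)).1 := by
    rw [limitSet_inf hH (hK.conj d), limitSet_conjSubgroup]
    rfl
  have key : ∀ g : F N, (ClosedSets.translate g (limitPoint H h)).1 ∩
      (ClosedSets.translate (g * d) (limitPoint K k)).1 =
        (fun ξ => g • ξ) '' limitSet (H ⊓ conjSubgroup d K) := by
    intro g
    rw [translate_mul, translate_inter, hL]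
  by_cases hbot : H ⊓ conjSubgroup d K = ⊥
  · rw [hbot, counting_bot]
    refine (ENNReal.tsum_eq_zero.2 fun x => Set.indicator_of_notMem ?_ _).symm
    rintro ⟨S, -, hS⟩
    have h2 := key x.out
    rw [hbot, limitSet_bot, Set.image_empty] at h2
    have := S.2.2.nonempty
    rw [hS, h2] at this
    exact Set.not_nonempty_empty this
  · rw [(hH.inf (hK.conj d)).counting_eq hbot, cosetCounting_apply _ _ hU]
    refine tsum_congr fun x => ?_
    have : ClosedSets.translate x.out (limitPoint _ hbot) ∈ U ↔
        (ClosedSets.translate x.out (limitPoint H h),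
          ClosedSets.translate (x.out * d) (limitPoint K k)) ∈ interPreimage U := by
      constructor
      · exact fun h => ⟨_, h, (key _).symm⟩
      · rintro ⟨S, hS, h⟩
        have : ClosedSets.translate x.out (limitPoint _ hbot) = S :=
          Subtype.ext ((h.trans (key _)).symm)
        rwa [this]
    by_cases hx : ClosedSets.translate x.out (limitPoint _ hbot) ∈ U
    · rw [Set.indicator_of_mem hx, Set.indicator_of_mem (this.1 hx)]
      rfl
    · rw [Set.indicator_of_notMem hx, Set.indicator_of_notMem fun h => hx (this.2 h)]

theorem interMeasure_counting {H K : Subgroup (F N)} (hH : IsQuasiconvex H)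
    (hK : IsQuasiconvex K) (h : H ≠ ⊥) (k : K ≠ ⊥) :
    interMeasure (counting H) (counting K) = doubleCosetSum H K := by
  ext U hU
  rw [interMeasure_apply _ _ hU, hH.counting_eq h, hK.counting_eq k,
    prod_cosetCounting_apply _ _ _ _ (measurableSet_interPreimage hU), doubleCosetSum,
    Measure.sum_apply _ hU, ← (Equiv.ofBijective _ (bijective_coset_pairs H K)).tsum_eq,
    ENNReal.tsum_sigma']
  refine tsum_congr fun d => ?_
  rw [counting_inf_conjSubgroup_apply hH hK h k _ hU]
  refine tsum_congr fun x => ?_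
  simp only [Equiv.ofBijective_apply]
  rw [translate_mk_out fun g hg => translate_limitPoint_of_mem h hg,
    translate_mk_out fun g hg => translate_limitPoint_of_mem k hg]

theorem conjSubgroup_bot (g : F N) : conjSubgroup g ⊥ = ⊥ := by
  simp [conjSubgroup]

theorem extendsProduct_interBilin : ExtendsProduct (interBilin N) := by
  intro H K hH hK μ ν hμ hν
  change interMeasure _ _ = _
  rw [hμ, hν]
  by_cases h : H = ⊥
  · subst h
    have h1 : doubleCosetSum ⊥ K = 0 := by
      simp only [doubleCosetSum, bot_inf_eq, counting_bot]
      exact Measure.sum_zero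
    rw [counting_bot, h1]
    ext U hU
    rw [interMeasure_apply _ _ hU, Measure.zero_prod]
    rfl
  by_cases k : K = ⊥
  · subst k
    have h1 : doubleCosetSum H ⊥ = 0 := by
      simp only [doubleCosetSum, conjSubgroup_bot, inf_bot_eq, counting_bot]
      exact Measure.sum_zero
    rw [counting_bot, h1]
    ext U hU
    rw [interMeasure_apply _ _ hU, Measure.prod_zero]
    rfl
  exact interMeasure_counting (isQuasiconvex_of_fg hH) (isQuasiconvex_of_fg hK) h k

/-! ### Subset cylinders of edges and of round graphs of grade one -/

/-- The `S ∈ C_N` whose convex hull contains the edge with endpoints `u` and `v`. -/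
def edgeSet (u v : F N) : Set (ClosedSets N) :=
  {S | (S.1 ∩ Cyl u v).Nonempty ∧ (S.1 ∩ Cyl v u).Nonempty}

theorem isClopen_edgeSet (u v : F N) : IsClopen (edgeSet u v) :=
  (isClopen_setOf_meets_Cyl u v).inter (isClopen_setOf_meets_Cyl v u)

theorem mem_edgeSet_iff {u v : F N} (h : (cayley N).Adj u v) {S : ClosedSets N} :
    S ∈ edgeSet u v ↔ u ∈ Conv S.1 ∧ v ∈ Conv S.1 := by
  constructor
  · rintro ⟨⟨ξ, hξ, h1⟩, ⟨η, hη, h2⟩⟩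
    rw [mem_Cyl_iff] at h1 h2
    refine ⟨mem_Conv_iff.2 ⟨ξ, hξ, η, hη, fun e => ?_⟩, mem_Conv_iff.2 ⟨ξ, hξ, η, hη, fun e => ?_⟩⟩
    · exact (dir_eq_iff_ne h η).1 (e ▸ h1) h2
    · exact (dir_eq_iff_ne h ξ).1 h1 (e.trans h2)
  · rintro ⟨hu, hv⟩
    obtain ⟨ξ, hξ, h1⟩ := exists_dir_eq_toward hv h.ne
    obtain ⟨η, hη, h2⟩ := exists_dir_eq_toward hu h.ne'
    rw [toward_of_adj h] at h1
    rw [toward_of_adj h.symm] at h2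
    exact ⟨⟨ξ, hξ, mem_Cyl_iff.2 h1⟩, ⟨η, hη, mem_Cyl_iff.2 h2⟩⟩

theorem adj_one_of (a : Fin N) : (cayley N).Adj 1 (FreeGroup.of a) :=
  adj_iff_exists_letter.2 ⟨(a, true), by rw [one_mul]; rfl⟩

theorem isTerminalEdge_edge {a : Fin N} {u v : F N} : IsTerminalEdge (edge a) u v ↔
    (u = 1 ∧ v = FreeGroup.of a) ∨ (u = FreeGroup.of a ∧ v = 1) := by
  have ha := adj_one_of a
  have hmem : ∀ w, w ∈ edge a ↔ w = 1 ∨ w = FreeGroup.of a := fun w => by simp [edge]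
  have h1 : degIn (edge a) 1 = 1 := by
    rw [degIn, Set.ncard_eq_one]
    refine ⟨FreeGroup.of a, Set.ext fun w => ?_⟩
    simp only [Set.mem_ofPred_eq, hmem, Set.mem_singleton_iff]
    constructor
    · rintro ⟨rfl | rfl, h⟩
      · exact absurd rfl h.ne
      · rfl
    · rintro rfl
      exact ⟨Or.inr rfl, ha⟩
  have h2 : degIn (edge a) (FreeGroup.of a) = 1 := by
    rw [degIn, Set.ncard_eq_one]
    refine ⟨1, Set.ext fun w => ?_⟩
    simp only [Set.mem_ofPred_eq, hmem, Set.mem_singleton_iff]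
    constructor
    · rintro ⟨rfl | rfl, h⟩
      · rfl
      · exact absurd rfl h.ne
    · rintro rfl
      exact ⟨Or.inl rfl, ha.symm⟩
  constructor
  · rintro ⟨hu, hv, hadj, -⟩
    rw [hmem] at hu hv
    rcases hu with rfl | rfl <;> rcases hv with rfl | rfl
    · exact absurd rfl hadj.ne
    · exact Or.inl ⟨rfl, rfl⟩
    · exact Or.inr ⟨rfl, rfl⟩
    · exact absurd rfl hadj.ne
  · rintro (⟨rfl, rfl⟩ | ⟨rfl, rfl⟩)
    · exact ⟨(hmem _).2 (Or.inl rfl), (hmem _).2 (Or.inr rfl), ha, h2⟩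
    · exact ⟨(hmem _).2 (Or.inr rfl), (hmem _).2 (Or.inl rfl), ha.symm, h1⟩

theorem SCyl_edge (a : Fin N) : SCyl (edge a) = edgeSet 1 (FreeGroup.of a) := by
  ext S
  simp only [SCyl, isTerminalEdge_edge, Set.mem_ofPred_eq, edgeSet]
  constructor
  · rintro ⟨-, h⟩
    exact ⟨h _ _ (Or.inl ⟨rfl, rfl⟩), h _ _ (Or.inr ⟨rfl, rfl⟩)⟩
  · rintro ⟨h1, h2⟩
    refine ⟨fun ξ _ => ?_, ?_⟩
    · rcases dir_or (adj_one_of a) ξ with h | h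
      · exact ⟨_, _, Or.inl ⟨rfl, rfl⟩, mem_Cyl_iff.2 h⟩
      · exact ⟨_, _, Or.inr ⟨rfl, rfl⟩, mem_Cyl_iff.2 h⟩
    · rintro u v (⟨rfl, rfl⟩ | ⟨rfl, rfl⟩)
      · exact h1
      · exact h2

/-- A vertex of T farthest from 1, if it is not 1, has degree one, hence is at distance one. -/
theorem eq_or_adj_of_mem_roundGraphs {T : Finset (F N)} (hT : T ∈ roundGraphs N 1) {u : F N}
    (hu : u ∈ T) : u = 1 ∨ (cayley N).Adj 1 u := by
  obtain ⟨hTree, -, h1T, -, hleaf⟩ := hT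
  obtain ⟨v, hv, hmax⟩ := T.exists_max_image (fun w => (cayley N).dist 1 w) ⟨1, h1T⟩
  suffices h : (cayley N).dist 1 v ≤ 1 by
    have h2 := (hmax u hu).trans h
    rcases Nat.le_one_iff_eq_zero_or_eq_one.1 h2 with h3 | h3
    · exact Or.inl (dist_eq_zero.1 h3).symm
    · exact Or.inr (SimpleGraph.dist_eq_one_iff_adj.1 h3)
  by_cases hv1 : v = 1
  · rw [hv1, dist_eq_zero.2 rfl]; exact zero_le_one
  refine (hleaf v hv ?_).le
  have hunique : ∀ w ∈ T, (cayley N).Adj v w → w = toward v 1 := by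
    intro w hw hvw
    rcases toward_or hvw 1 with h | h
    · exact h.symm
    · have h2 := (dist_lt_iff_toward hvw.symm 1).2 h
      have h3 := hmax w hw
      rw [SimpleGraph.dist_comm, SimpleGraph.dist_comm (u := 1) (v := v)] at h3
      omega
  obtain ⟨p⟩ := hTree.1.preconnected ⟨v, hv⟩ ⟨1, h1T⟩
  obtain ⟨w, hw, hvw⟩ : ∃ w ∈ T, (cayley N).Adj v w := by
    cases p with
    | nil => exact absurd rfl hv1
    | cons h p => exact ⟨_, Subtype.coe_prop _, h⟩
  rw [degIn, Set.ncard_eq_one]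
  refine ⟨w, Set.ext fun x => ?_⟩
  simp only [Set.mem_ofPred_eq, Set.mem_singleton_iff]
  constructor
  · rintro ⟨hx, hvx⟩
    rw [hunique x hx hvx, hunique w hw hvw]
  · rintro rfl
    exact ⟨hw, hvw⟩

theorem isTerminalEdge_of_mem_roundGraphs {T : Finset (F N)} (hT : T ∈ roundGraphs N 1)
    {u v : F N} : IsTerminalEdge T u v ↔ u = 1 ∧ v ∈ T ∧ v ≠ 1 := by
  have key : ∀ v ∈ T, v ≠ 1 → ∀ u ∈ T, (cayley N).Adj v u → u = 1 := by
    intro v hv hv1 u hu hvu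
    by_contra hu1
    have h1 := (eq_or_adj_of_mem_roundGraphs hT hv).resolve_left hv1
    have h2 := (eq_or_adj_of_mem_roundGraphs hT hu).resolve_left hu1
    rcases toward_or hvu 1 with h | h
    · rw [toward_of_adj h1.symm] at h; exact hu1 h.symm
    · rw [toward_of_adj h2.symm] at h; exact hv1 h.symm
  constructor
  · rintro ⟨hu, hv, hadj, hdeg⟩
    have hv1 : v ≠ 1 := by
      rintro rfl
      have := hT.2.2.2.1
      omega
    exact ⟨key v hv hv1 u hu hadj.symm, hv, hv1⟩
  · rintro ⟨rfl, hv, hv1⟩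
    have h1 := (eq_or_adj_of_mem_roundGraphs hT hv).resolve_left hv1
    refine ⟨hT.2.2.1, hv, h1, ?_⟩
    rw [degIn, Set.ncard_eq_one]
    refine ⟨1, Set.ext fun x => ?_⟩
    simp only [Set.mem_ofPred_eq, Set.mem_singleton_iff]
    constructor
    · rintro ⟨hx, hvx⟩
      exact key v hv hv1 x hx hvx
    · rintro rfl
      exact ⟨hT.2.2.1, h1.symm⟩

/-- So S determines T, and the subset cylinders of these graphs are disjoint; they partition
`hullSet 1`, which turns V(μ) into its measure. -/
theorem mem_SCyl_iff_of_mem_roundGraphs {T : Finset (F N)} (hT : T ∈ roundGraphs N 1)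
    {S : ClosedSets N} : S ∈ SCyl T ↔ (T : Set (F N)) = insert 1 (dir 1 '' S.1) := by
  simp only [SCyl, isTerminalEdge_of_mem_roundGraphs hT, Set.mem_ofPred_eq]
  constructor
  · rintro ⟨h1, h2⟩
    ext v
    rw [Set.mem_insert_iff]
    constructor
    · intro hv
      by_cases hv1 : v = 1
      · exact Or.inl hv1
      · obtain ⟨ξ, hξ, hξ'⟩ := h2 1 v ⟨rfl, hv, hv1⟩
        exact Or.inr ⟨ξ, hξ, mem_Cyl_iff.1 hξ'⟩
    · rintro (rfl | ⟨ξ, hξ, rfl⟩)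
      · exact hT.2.2.1
      · obtain ⟨_, v, ⟨rfl, hv, -⟩, h3⟩ := h1 ξ hξ
        rw [mem_Cyl_iff.1 h3]
        exact hv
  · intro h
    refine ⟨fun ξ hξ => ⟨1, dir 1 ξ, ⟨rfl, ?_, (dir_adj 1 ξ).ne'⟩, mem_Cyl_iff.2 rfl⟩, ?_⟩
    · rw [← Finset.mem_coe, h]
      exact Or.inr ⟨ξ, hξ, rfl⟩
    · rintro _ v ⟨rfl, hv, hv1⟩
      rw [← Finset.mem_coe, h] at hv
      obtain ⟨ξ, hξ, h2⟩ := hv.resolve_left hv1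
      exact ⟨ξ, hξ, mem_Cyl_iff.2 h2⟩

theorem insert_mem_roundGraphs {D : Finset (F N)} (hD : ∀ u ∈ D, (cayley N).Adj 1 u)
    (h2 : 1 < D.card) [DecidableEq (F N)] : insert 1 D ∈ roundGraphs N 1 := by
  have h1D : (1 : F N) ∉ D := fun h => (hD 1 h).ne rfl
  have hdeg : degIn (insert 1 D) 1 = D.card := by
    rw [degIn, ← Set.ncard_coe_finset]
    congr 1
    ext w
    simp only [Set.mem_ofPred_eq, Finset.mem_insert, Finset.mem_coe]
    constructor
    · rintro ⟨rfl | hw, h⟩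
      · exact absurd rfl h.ne
      · exact hw
    · exact fun hw => ⟨Or.inr hw, hD w hw⟩
  refine ⟨?_, ?_, Finset.mem_insert_self _ _, by rw [hdeg]; exact h2, ?_⟩
  · refine IsGeodesicallyConvex.isTree (fun u hu v hv huv => ?_) ⟨1, Finset.mem_insert_self _ _⟩
    rw [Finset.mem_coe, Finset.mem_insert] at hu hv ⊢
    rcases hu with rfl | hu
    · have hv := hv.resolve_left huv.symm
      rw [toward_of_adj (hD v hv)]
      exact Or.inr hv
    · left
      refine (toward_or (hD u hu) v).resolve_left fun h => ?_
      rcases hv with rfl | hv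
      · rw [toward_self] at h
        exact huv h.symm
      · rw [toward_of_adj (hD v hv)] at h
        exact huv h.symm
  · rw [Finset.card_insert_of_notMem h1D]
    omega
  · intro u hu hu1
    rw [Finset.mem_insert] at hu
    rcases hu with rfl | hu
    · omega
    · exact dist_adj (hD u hu)

theorem finite_roundGraphs : (roundGraphs N 1).Finite := by
  refine ((finite_ball (N := N) 1 1).toFinset.powerset.finite_toSet).subset fun T hT => ?_
  rw [Finset.mem_coe, Finset.mem_powerset]
  intro u hu
  rw [Set.Finite.mem_toFinset]
  rcases eq_or_adj_of_mem_roundGraphs hT hu with rfl | h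
  · simp
  · exact (dist_adj h).le

theorem iUnion_SCyl_roundGraphs : ⋃ T ∈ roundGraphs N 1, SCyl T = hullSet (1 : F N) := by
  classical
  ext S
  simp only [Set.mem_iUnion, exists_prop]
  constructor
  · rintro ⟨T, hT, hS⟩
    rw [mem_SCyl_iff_of_mem_roundGraphs hT] at hS
    have hdeg := hT.2.2.2.1
    rw [degIn, Set.one_lt_ncard_iff (T.finite_toSet.subset fun u hu => hu.1)] at hdeg
    obtain ⟨u, v, ⟨hu, hu1⟩, ⟨hv, hv1⟩, huv⟩ := hdeg
    rw [← Finset.mem_coe, hS] at hu hv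
    obtain ⟨ξ, hξ, rfl⟩ := hu.resolve_left hu1.ne'
    obtain ⟨η, hη, rfl⟩ := hv.resolve_left hv1.ne'
    exact mem_Conv_iff.2 ⟨ξ, hξ, η, hη, huv⟩
  · intro hS
    have hfin : (dir 1 '' S.1).Finite := by
      refine (finite_neighbors (1 : F N)).subset ?_
      rintro _ ⟨ξ, -, rfl⟩
      exact dir_adj 1 ξ
    obtain ⟨ξ, hξ, η, hη, hne⟩ := mem_Conv_iff.1 hS
    have hT : insert 1 hfin.toFinset ∈ roundGraphs N 1 := by
      refine insert_mem_roundGraphs (fun u hu => ?_) (Finset.one_lt_card.2 ?_)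
      · rw [Set.Finite.mem_toFinset] at hu
        obtain ⟨ξ, -, rfl⟩ := hu
        exact dir_adj 1 ξ
      · exact ⟨dir 1 ξ, by simpa using ⟨ξ, hξ, rfl⟩, dir 1 η, by simpa using ⟨η, hη, rfl⟩, hne⟩
    refine ⟨_, hT, ?_⟩
    rw [mem_SCyl_iff_of_mem_roundGraphs hT]
    simp

theorem measurableSet_SCyl_of_mem_roundGraphs {T : Finset (F N)} (hT : T ∈ roundGraphs N 1) :
    MeasurableSet (SCyl T) := by
  have : SCyl T = {S : ClosedSets N | S.1 ⊆ ⋃ v ∈ (T : Set (F N)), ⋃ (_ : v ≠ 1), Cyl 1 v} ∩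
      ⋂ v ∈ (T : Set (F N)), ⋂ (_ : v ≠ 1), {S | (S.1 ∩ Cyl 1 v).Nonempty} := by
    ext S
    simp only [SCyl, isTerminalEdge_of_mem_roundGraphs hT, Set.mem_ofPred_eq, Set.mem_inter_iff,
      Set.subset_def, Set.mem_iUnion, Set.mem_iInter, Finset.mem_coe, exists_prop]
    refine and_congr (forall₂_congr fun ξ _ => ?_) ?_
    · constructor
      · rintro ⟨_, v, ⟨rfl, h1, h2⟩, h3⟩
        exact ⟨v, h1, h2, h3⟩
      · rintro ⟨v, h1, h2, h3⟩
        exact ⟨1, v, ⟨rfl, h1, h2⟩, h3⟩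
    · constructor
      · exact fun h v h1 h2 => h 1 v ⟨rfl, h1, h2⟩
      · rintro h _ v ⟨rfl, h1, h2⟩
        exact h v h1 h2
  rw [this]
  refine (isOpen_setOf_subset ?_).measurableSet.inter ?_
  · exact isOpen_biUnion fun v _ => isOpen_iUnion fun _ => (isClopen_Cyl 1 v).2
  · exact MeasurableSet.biInter (Set.to_countable _) fun v _ => MeasurableSet.iInter fun _ =>
      (isClopen_setOf_meets_Cyl 1 v).2.measurableSet

theorem edgeFunctional_eq (μ : SCurr N) : edgeFunctional μ =
    ∑ a : Fin N, (μ : Measure (ClosedSets N)).real (edgeSet 1 (FreeGroup.of a)) := by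
  simp only [edgeFunctional, SCyl_edge]

theorem vertexFunctional_eq (μ : SCurr N) :
    vertexFunctional μ = (μ : Measure (ClosedSets N)).real (hullSet 1) := by
  have hfin := finite_roundGraphs (N := N)
  rw [vertexFunctional, finsum_mem_eq_finite_toFinset_sum _ hfin, ← iUnion_SCyl_roundGraphs]
  have h1 : ⋃ T ∈ roundGraphs N 1, SCyl T = ⋃ T ∈ hfin.toFinset, SCyl T := by simp
  have hsub : ∀ T ∈ hfin.toFinset, SCyl T ⊆ hullSet 1 := fun T hT => by
    rw [← iUnion_SCyl_roundGraphs]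
    exact Set.subset_biUnion_of_mem (u := SCyl) (hfin.mem_toFinset.1 hT)
  have hfm : ∀ T ∈ hfin.toFinset, (μ : Measure (ClosedSets N)) (SCyl T) ≠ ∞ := fun T hT =>
    ((measure_mono (hsub T hT)).trans_lt (measure_hullSet_lt_top μ 1)).ne
  rw [h1, measureReal_biUnion_finset (h := hfm)]
  · intro T hT T' hT' hne
    refine Set.disjoint_left.2 fun S hS hS' => hne ?_
    rw [mem_SCyl_iff_of_mem_roundGraphs (by simpa using hT)] at hS
    rw [mem_SCyl_iff_of_mem_roundGraphs (by simpa using hT')] at hS'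
    exact Finset.coe_injective (hS.trans hS'.symm)
  · exact fun T hT => measurableSet_SCyl_of_mem_roundGraphs (by simpa using hT)

/-! ### Roots of finite subtrees -/

/-- `r` is the root of `Y` if `Y` is the `r`-translate of the representative of its class. -/
def IsRoot (Y : Set (F N)) (r : F N) : Prop :=
  ∃ c : Quotient (basedSetoid N), Y = (fun x => r * x) '' (c.out.1 : Set (F N))

theorem IsRoot.mem {Y : Set (F N)} {r : F N} (h : IsRoot Y r) : r ∈ Y := by
  obtain ⟨c, rfl⟩ := h
  exact ⟨1, c.out.2.2, mul_one r⟩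

theorem IsRoot.finite {Y : Set (F N)} {r : F N} (h : IsRoot Y r) : Y.Finite := by
  obtain ⟨c, rfl⟩ := h
  exact (c.out.1.finite_toSet).image _

theorem IsRoot.translate {Y : Set (F N)} {r : F N} (h : IsRoot Y r) (g : F N) :
    IsRoot ((fun x => g * x) '' Y) (g * r) := by
  obtain ⟨c, rfl⟩ := h
  exact ⟨c, by simp only [Set.image_image, mul_assoc]⟩

theorem isRoot_translate_iff {Y : Set (F N)} {r : F N} (g : F N) :
    IsRoot ((fun x => g * x) '' Y) (g * r) ↔ IsRoot Y r := by
  refine ⟨fun h => ?_, fun h => h.translate g⟩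
  have := h.translate g⁻¹
  simpa only [Set.image_image, inv_mul_cancel_left, Set.image_id'] using this

theorem eq_one_of_image_mul_eq {T : Set (F N)} (hT : T.Finite) (hne : T.Nonempty) {g : F N}
    (h : (fun x => g * x) '' T = T) : g = 1 := by
  by_contra hg
  obtain ⟨y, hy⟩ := hne
  have h1 : ∀ n : ℕ, g ^ n * y ∈ T := by
    intro n
    induction n with
    | zero => simpa
    | succ n ih =>
      rw [pow_succ', mul_assoc, ← h]
      exact ⟨_, ih, rfl⟩
  refine Set.infinite_of_injective_forall_mem (fun m n hmn => ?_) h1 hT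
  exact injective_pow_iff_not_isOfFinOrder.2 (not_isOfFinOrder_of_isMulTorsionFree hg)
    (mul_right_cancel hmn)

/-- Both roots come from the same class, and no nontrivial translation preserves a finite nonempty
set because the group is torsion-free. -/
theorem IsRoot.unique {Y : Set (F N)} {r r' : F N} (h : IsRoot Y r) (h' : IsRoot Y r') :
    r = r' := by
  have hfin := h.finite
  have hne : Y.Nonempty := ⟨r, h.mem⟩
  obtain ⟨c, hc⟩ := h
  obtain ⟨c', hc'⟩ := h'
  have h1 : c = c' := by
    rw [← Quotient.out_eq c, ← Quotient.out_eq c']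
    refine Quotient.sound ⟨r'⁻¹ * r, ?_⟩
    have : (fun x => r'⁻¹ * x) '' Y = c'.out.1 := by
      rw [hc', Set.image_image]; simp
    rw [← this, hc, Set.image_image]
    simp only [mul_assoc]
  subst h1
  have h2 : (fun x => (r' * r⁻¹) * x) '' Y = Y := by
    conv_lhs => rw [hc]
    rw [hc', Set.image_image]
    simp
  have := eq_one_of_image_mul_eq hfin hne h2
  exact (mul_inv_eq_one.1 this).symm

theorem exists_isRoot {Y : Set (F N)} (hfin : Y.Finite) (hne : Y.Nonempty)
    (hconv : IsGeodesicallyConvex Y) : ∃ r, IsRoot Y r := by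
  classical
  obtain ⟨y, hy⟩ := hne
  have hc : IsGeodesicallyConvex ((fun x => y⁻¹ * x) '' Y) := by
    rintro _ ⟨u, hu, rfl⟩ _ ⟨v, hv, rfl⟩ huv
    exact ⟨_, hconv u hu v hv (fun e => huv (by rw [e])), (mul_toward _ _ _).symm⟩
  have hone : (1 : F N) ∈ (fun x => y⁻¹ * x) '' Y := ⟨y, hy, inv_mul_cancel y⟩
  let B : BasedSubtree N := ⟨(hfin.image fun x => y⁻¹ * x).toFinset, by
    rw [IsFinSubtree, Set.Finite.coe_toFinset]
    exact hc.isTree ⟨1, hone⟩, by rwa [Set.Finite.mem_toFinset]⟩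
  obtain ⟨g, hg⟩ : (Quotient.mk (basedSetoid N) B).out ≈ B := Quotient.mk_out B
  refine ⟨y * g, Quotient.mk (basedSetoid N) B, ?_⟩
  have h1 : (B.1 : Set (F N)) = (fun x => y⁻¹ * x) '' Y := Set.Finite.coe_toFinset _
  rw [h1] at hg
  have h2 : (fun x => y * x) '' ((fun x => g * x) '' ((Quotient.mk (basedSetoid N) B).out.1 : Set (F N))) = Y := by
    rw [hg, Set.image_image]; simp
  rw [← h2, Set.image_image]
  simp only [mul_assoc]

theorem isRoot_one_iff {Y : Set (F N)} :
    IsRoot Y 1 ↔ ∃ c : Quotient (basedSetoid N), Y = (c.out.1 : Set (F N)) := by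
  simp [IsRoot]

/-! ### The intersection of two hulls -/

/-- The intersection of the convex hulls of a pair of sets. -/
def hullInter (p : ClosedSets N × ClosedSets N) : Set (F N) := Conv p.1.1 ∩ Conv p.2.1

theorem isGeodesicallyConvex_hullInter (p : ClosedSets N × ClosedSets N) :
    IsGeodesicallyConvex (hullInter p) :=
  (isGeodesicallyConvex_Conv _).inter (isGeodesicallyConvex_Conv _)

/-- A common boundary point gives a ray inside both hulls. Conversely an infinite intersection of
hulls has a limit point, which lies in both closed sets. -/
theorem finite_hullInter_iff {p : ClosedSets N × ClosedSets N} (hne : (hullInter p).Nonempty) :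
    (hullInter p).Finite ↔ p.1.1 ∩ p.2.1 = ∅ := by
  constructor
  · intro hfin
    by_contra h
    obtain ⟨ξ, h1, h2⟩ := Set.nonempty_iff_ne_empty.2 h
    obtain ⟨v, hv1, hv2⟩ := hne
    exact Set.infinite_of_injective_forall_mem (s := hullInter p) (rayTo v ξ).injective
      (fun n => ⟨rayTo_mem_Conv hv1 h1 n, rayTo_mem_Conv hv2 h2 n⟩) hfin
  · intro h
    by_contra hinf
    obtain ⟨ξ, hξ⟩ := limitSetOf_nonempty (A := hullInter p) hinf
    have : ξ ∈ p.1.1 ∩ p.2.1 :=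
      ⟨limitSetOf_Conv_subset p.1.2.1 (limitSetOf_mono Set.inter_subset_left hξ),
        limitSetOf_Conv_subset p.2.2.1 (limitSetOf_mono Set.inter_subset_right hξ)⟩
    rw [h] at this
    exact this

theorem IsRoot.inter_eq_empty {p : ClosedSets N × ClosedSets N} {r : F N}
    (h : IsRoot (hullInter p) r) : p.1.1 ∩ p.2.1 = ∅ :=
  (finite_hullInter_iff ⟨r, h.mem⟩).1 h.finite

theorem hullInter_translatePair (g : F N) (p : ClosedSets N × ClosedSets N) :
    hullInter (translatePair g p) = (fun x => g * x) '' hullInter p := by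
  ext v
  have h1 : v ∈ hullInter (translatePair g p) ↔ g⁻¹ * v ∈ hullInter p :=
    and_congr (Conv_image_smul g p.1.1 v) (Conv_image_smul g p.2.1 v)
  rw [h1]
  constructor
  · exact fun h => ⟨_, h, mul_inv_cancel_left g v⟩
  · rintro ⟨w, hw, rfl⟩
    simpa using hw

theorem measurableSet_hullInter_eq (T : Set (F N)) :
    MeasurableSet {p : ClosedSets N × ClosedSets N | hullInter p = T} := by
  have h : ∀ v : F N, MeasurableSet {p : ClosedSets N × ClosedSets N | v ∈ hullInter p} := fun v =>
    (isOpen_hullSet v).measurableSet.prod (isOpen_hullSet v).measurableSet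
  have : {p : ClosedSets N × ClosedSets N | hullInter p = T} =
      ⋂ v : F N, {p | v ∈ hullInter p ↔ v ∈ T} := by
    ext p
    simp [Set.ext_iff]
  rw [this]
  refine MeasurableSet.iInter fun v => ?_
  by_cases hv : v ∈ T
  · have : {p : ClosedSets N × ClosedSets N | v ∈ hullInter p ↔ v ∈ T} =
        {p | v ∈ hullInter p} := by ext; simp [hv]
    rw [this]
    exact h v
  · have : {p : ClosedSets N × ClosedSets N | v ∈ hullInter p ↔ v ∈ T} =
        {p | v ∈ hullInter p}ᶜ := by ext; simp [hv]
    rw [this]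
    exact (h v).compl

instance : Countable (Quotient (basedSetoid N)) := by
  have : Countable (BasedSubtree N) := Subtype.countable
  exact Quotient.countable

theorem measurableSet_isRoot (r : F N) :
    MeasurableSet {p : ClosedSets N × ClosedSets N | IsRoot (hullInter p) r} := by
  have : {p : ClosedSets N × ClosedSets N | IsRoot (hullInter p) r} =
      ⋃ c : Quotient (basedSetoid N), {p | hullInter p = (fun x => r * x) '' (c.out.1 : Set (F N))} := by
    ext p
    simp [IsRoot]
  rw [this]
  exact MeasurableSet.iUnion fun c => measurableSet_hullInter_eq _

/-! ### The flow on the intersection of two hulls -/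

/-- The pairs for which the edge from `u` to `v` of the intersection of the hulls points towards
the hull of the intersection (or its only point, or the root if the intersection is empty). -/
def flowSet (u v : F N) : Set (ClosedSets N × ClosedSets N) :=
  (edgeSet u v ×ˢ edgeSet u v) ∩
    ((meetSet (Cyl u v) \ meetSet (Cyl v u)) ∪
      {p | ∃ r, IsRoot (hullInter p) r ∧ toward u r = v})

theorem measurableSet_flowSet (u v : F N) : MeasurableSet (flowSet u v) := by
  have h1 := (isClopen_edgeSet u v).2.measurableSet
  refine (h1.prod h1).inter (((measurableSet_meetSet_Cyl u v).diff
    (measurableSet_meetSet_Cyl v u)).union ?_)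
  have : {p : ClosedSets N × ClosedSets N | ∃ r, IsRoot (hullInter p) r ∧ toward u r = v} =
      ⋃ r : F N, ⋃ (_ : toward u r = v), {p | IsRoot (hullInter p) r} := by
    ext p
    simp only [Set.mem_ofPred_eq, Set.mem_iUnion, exists_prop, and_comm]
  rw [this]
  exact MeasurableSet.iUnion fun r => MeasurableSet.iUnion fun _ => measurableSet_isRoot r

theorem translate_mem_edgeSet_iff (g u v : F N) (S : ClosedSets N) :
    ClosedSets.translate g S ∈ edgeSet (g * u) (g * v) ↔ S ∈ edgeSet u v := by
  have h : ∀ u v : F N, ((ClosedSets.translate g S).1 ∩ Cyl (g * u) (g * v)).Nonempty ↔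
      (S.1 ∩ Cyl u v).Nonempty := by
    intro u v
    constructor
    · rintro ⟨_, ⟨ξ, hξ, rfl⟩, h⟩
      refine ⟨ξ, hξ, ?_⟩
      simpa [smul_mem_Cyl] using h
    · rintro ⟨ξ, hξ, h⟩
      refine ⟨g • ξ, ⟨ξ, hξ, rfl⟩, ?_⟩
      simpa [smul_mem_Cyl] using h
  exact and_congr (h u v) (h v u)

theorem translatePair_mem_meetSet_iff (g u v : F N) (p : ClosedSets N × ClosedSets N) :
    translatePair g p ∈ meetSet (Cyl (g * u) (g * v)) ↔ p ∈ meetSet (Cyl u v) := by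
  change ((ClosedSets.translate g p.1).1 ∩ (ClosedSets.translate g p.2).1 ∩ _).Nonempty ↔
    (p.1.1 ∩ p.2.1 ∩ _).Nonempty
  rw [translate_inter]
  constructor
  · rintro ⟨_, ⟨ξ, hξ, rfl⟩, h⟩
    refine ⟨ξ, hξ, ?_⟩
    simpa [smul_mem_Cyl] using h
  · rintro ⟨ξ, hξ, h⟩
    refine ⟨g • ξ, ⟨ξ, hξ, rfl⟩, ?_⟩
    simpa [smul_mem_Cyl] using h

/-- The flow is equivariant because roots are: they are defined through representatives of
translation classes, with no choice made for individual trees. -/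
theorem translatePair_preimage_flowSet (g u v : F N) :
    translatePair g ⁻¹' flowSet (g * u) (g * v) = flowSet u v := by
  ext p
  refine and_congr (and_congr (translate_mem_edgeSet_iff g u v p.1)
    (translate_mem_edgeSet_iff g u v p.2)) (or_congr (and_congr
      (translatePair_mem_meetSet_iff g u v p) (not_congr (translatePair_mem_meetSet_iff g v u p))) ?_)
  change (∃ r, IsRoot (hullInter (translatePair g p)) r ∧ _) ↔ ∃ r, _
  rw [hullInter_translatePair]
  constructor
  · rintro ⟨r, h1, h2⟩
    refine ⟨g⁻¹ * r, (isRoot_translate_iff g).1 (by rwa [mul_inv_cancel_left]), ?_⟩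
    refine mul_left_cancel (a := g) ?_
    rw [← mul_toward, mul_inv_cancel_left, h2]
  · rintro ⟨r, h1, h2⟩
    exact ⟨g * r, h1.translate g, by rw [mul_toward, h2]⟩

theorem measure_flowSet_translate (μ ν : SCurr N) (g u v : F N) :
    ((μ : Measure (ClosedSets N)).prod (ν : Measure (ClosedSets N))) (flowSet (g * u) (g * v)) =
      ((μ : Measure (ClosedSets N)).prod (ν : Measure (ClosedSets N))) (flowSet u v) := by
  rw [← prod_translatePair_preimage μ ν g (measurableSet_flowSet _ _),
    translatePair_preimage_flowSet]

theorem edgeSet_comm (u v : F N) : edgeSet u v = edgeSet v u := by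
  ext S; exact and_comm

theorem interPreimage_edgeSet {u v : F N} (h : (cayley N).Adj u v) :
    interPreimage (edgeSet u v) = meetSet (Cyl u v) ∩ meetSet (Cyl v u) := by
  ext p
  constructor
  · rintro ⟨S, ⟨h1, h2⟩, hS⟩
    rw [hS] at h1 h2
    exact ⟨h1, h2⟩
  · rintro ⟨h1, h2⟩
    have hne : (p.1.1 ∩ p.2.1).Nontrivial := by
      obtain ⟨ξ, hξ, h3⟩ := h1
      obtain ⟨η, hη, h4⟩ := h2
      refine ⟨ξ, hξ, η, hη, ?_⟩
      rintro rfl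
      rw [mem_Cyl_iff] at h3 h4
      exact (dir_eq_iff_ne h ξ).1 h3 h4
    exact ⟨⟨p.1.1 ∩ p.2.1, p.1.2.1.inter p.2.2.1, hne⟩, ⟨h1, h2⟩, rfl⟩

theorem mem_edgeSet_prod_iff {u v : F N} (h : (cayley N).Adj u v)
    {p : ClosedSets N × ClosedSets N} :
    p ∈ edgeSet u v ×ˢ edgeSet u v ↔ u ∈ hullInter p ∧ v ∈ hullInter p := by
  rw [Set.mem_prod, mem_edgeSet_iff h, mem_edgeSet_iff h]
  exact and_and_and_comm

theorem meetSet_or {u v : F N} (h : (cayley N).Adj u v) {p : ClosedSets N × ClosedSets N}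
    (hp : (p.1.1 ∩ p.2.1).Nonempty) : p ∈ meetSet (Cyl u v) ∨ p ∈ meetSet (Cyl v u) := by
  obtain ⟨ξ, hξ⟩ := hp
  rcases dir_or h ξ with h1 | h1
  · exact Or.inl ⟨ξ, hξ, mem_Cyl_iff.2 h1⟩
  · exact Or.inr ⟨ξ, hξ, mem_Cyl_iff.2 h1⟩

theorem not_isRoot_of_mem_meetSet {C : Set (Boundary N)} {p : ClosedSets N × ClosedSets N}
    (hp : p ∈ meetSet C) {r : F N} (hr : IsRoot (hullInter p) r) : False := by
  obtain ⟨ξ, hξ, -⟩ := hp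
  rw [hr.inter_eq_empty] at hξ
  exact hξ

/-- Edges of the intersection of the hulls which are not in the hull of the intersection are
oriented by the flow in exactly one way. -/
theorem edgeSet_prod_eq {u v : F N} (h : (cayley N).Adj u v) :
    edgeSet u v ×ˢ edgeSet u v =
      interPreimage (edgeSet u v) ∪ (flowSet u v ∪ flowSet v u) := by
  rw [interPreimage_edgeSet h]
  ext p
  constructor
  · intro hp
    have hp' : p ∈ edgeSet v u ×ˢ edgeSet v u := by rwa [edgeSet_comm v u]
    by_cases h1 : p ∈ meetSet (Cyl u v) <;> by_cases h2 : p ∈ meetSet (Cyl v u)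
    · exact Or.inl ⟨h1, h2⟩
    · exact Or.inr (Or.inl ⟨hp, Or.inl ⟨h1, h2⟩⟩)
    · exact Or.inr (Or.inr ⟨hp', Or.inl ⟨h2, h1⟩⟩)
    -- A common point would lie on one side of the edge, so here the intersection of the hulls is
    -- finite and the root decides the orientation.
    · have hemp : p.1.1 ∩ p.2.1 = ∅ := by
        by_contra hc
        exact (meetSet_or h (Set.nonempty_iff_ne_empty.2 hc)).elim h1 h2
      have hu := ((mem_edgeSet_prod_iff h).1 hp).1
      obtain ⟨r, hr⟩ := exists_isRoot ((finite_hullInter_iff ⟨u, hu⟩).2 hemp) ⟨u, hu⟩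
        (isGeodesicallyConvex_hullInter p)
      rcases toward_or h r with h3 | h3
      · exact Or.inr (Or.inl ⟨hp, Or.inr ⟨r, hr, h3⟩⟩)
      · exact Or.inr (Or.inr ⟨hp', Or.inr ⟨r, hr, h3⟩⟩)
  · rintro (⟨⟨ξ, hξ, h1⟩, ⟨η, hη, h2⟩⟩ | hp | hp)
    · exact ⟨⟨⟨ξ, hξ.1, h1⟩, ⟨η, hη.1, h2⟩⟩, ⟨⟨ξ, hξ.2, h1⟩, ⟨η, hη.2, h2⟩⟩⟩
    · exact hp.1
    · rw [edgeSet_comm u v]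
      exact hp.1

theorem disjoint_interPreimage_flowSet {u v : F N} (h : (cayley N).Adj u v) :
    Disjoint (interPreimage (edgeSet u v)) (flowSet u v ∪ flowSet v u) := by
  rw [interPreimage_edgeSet h, Set.disjoint_left]
  rintro p ⟨h1, h2⟩ (⟨-, h3 | ⟨r, hr, -⟩⟩ | ⟨-, h3 | ⟨r, hr, -⟩⟩)
  · exact h3.2 h2
  · exact not_isRoot_of_mem_meetSet h1 hr
  · exact h3.2 h1
  · exact not_isRoot_of_mem_meetSet h1 hr

theorem disjoint_flowSet_swap {u v : F N} (h : (cayley N).Adj u v) :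
    Disjoint (flowSet u v) (flowSet v u) := by
  rw [Set.disjoint_left]
  rintro p ⟨-, h1 | ⟨r, hr, h1⟩⟩ ⟨-, h2 | ⟨s, hs, h2⟩⟩
  · exact h1.2 h2.1
  · exact not_isRoot_of_mem_meetSet h1.1 hs
  · exact not_isRoot_of_mem_meetSet h2.1 hr
  · rw [hs.unique hr] at h2
    have h3 := (dist_lt_iff_toward h r).2 h1
    have h4 := (dist_lt_iff_toward h.symm r).2 h2
    omega

/-- The pairs whose hulls intersect in a finite subtree with root `1`. -/
def rootSet (N : ℕ) : Set (ClosedSets N × ClosedSets N) := {p | IsRoot (hullInter p) 1}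

/-- At a vertex of the intersection of the hulls which is neither in the hull of the intersection
nor the root, there is exactly one outgoing edge of the flow. -/
theorem hullSet_prod_eq : hullSet (1 : F N) ×ˢ hullSet 1 =
    interHullSet 1 ∪ (rootSet N ∪ ⋃ x : Fin N × Bool, flowSet 1 (FreeGroup.mk [x])) := by
  have hletter : ∀ {u : F N}, (cayley N).Adj 1 u → ∃ x, u = FreeGroup.mk [x] := fun h => by
    simpa using adj_iff_exists_letter.1 h
  have hflow : ∀ {u : F N} {p : ClosedSets N × ClosedSets N}, (cayley N).Adj 1 u →
      p ∈ flowSet 1 u → p ∈ ⋃ x : Fin N × Bool, flowSet 1 (FreeGroup.mk [x]) := fun h hp => by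
    obtain ⟨x, rfl⟩ := hletter h
    exact Set.mem_iUnion.2 ⟨x, hp⟩
  ext p
  constructor
  · intro hp
    have h1 : (1 : F N) ∈ hullInter p := hp
    by_cases hemp : p.1.1 ∩ p.2.1 = ∅
    · obtain ⟨r, hr⟩ := exists_isRoot ((finite_hullInter_iff ⟨1, h1⟩).2 hemp) ⟨1, h1⟩
        (isGeodesicallyConvex_hullInter p)
      by_cases hr1 : 1 = r
      · subst hr1
        exact Or.inr (Or.inl hr)
      · have hadj := toward_adj hr1
        refine Or.inr (Or.inr (hflow hadj ⟨?_, Or.inr ⟨r, hr, rfl⟩⟩))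
        rw [mem_edgeSet_prod_iff hadj]
        exact ⟨h1, isGeodesicallyConvex_hullInter p 1 h1 r hr.mem hr1⟩
    · obtain ⟨ξ, hξ⟩ := Set.nonempty_iff_ne_empty.2 hemp
      -- Outside the hull, all points of S₁ ∩ S₂ leave 1 in one direction, which is the outgoing
      -- edge.
      by_cases hc : p ∈ interHullSet 1
      · exact Or.inl hc
      have hadj := dir_adj 1 ξ
      refine Or.inr (Or.inr (hflow hadj ⟨?_, Or.inl ⟨⟨ξ, hξ, mem_Cyl_iff.2 rfl⟩, ?_⟩⟩))
      · rw [mem_edgeSet_prod_iff hadj]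
        exact ⟨h1, dir_mem_Conv h1.1 hξ.1, dir_mem_Conv h1.2 hξ.2⟩
      · rintro ⟨η, hη, h2⟩
        refine hc (mem_Conv_iff.2 ⟨ξ, hξ, η, hη, fun e => ?_⟩)
        exact (dir_eq_iff_ne hadj η).1 e.symm (mem_Cyl_iff.1 h2)
  · rintro (hp | hp | hp)
    · exact interHullSet_subset 1 hp
    · exact hp.mem
    · obtain ⟨x, hx⟩ := Set.mem_iUnion.1 hp
      exact ((mem_edgeSet_prod_iff
        (adj_iff_exists_letter.2 ⟨x, (one_mul _).symm⟩)).1 hx.1).1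

theorem disjoint_interHullSet : Disjoint (interHullSet (1 : F N))
    (rootSet N ∪ ⋃ x : Fin N × Bool, flowSet 1 (FreeGroup.mk [x])) := by
  rw [Set.disjoint_left]
  intro p hp h
  obtain ⟨ξ, hξ, η, hη, hne⟩ := mem_Conv_iff.1 hp
  have hroot : ∀ r, ¬ IsRoot (hullInter p) r := fun r hr => by
    rw [hr.inter_eq_empty] at hξ
    exact hξ
  rcases h with h | h
  · exact hroot 1 h
  · obtain ⟨x, -, h1 | ⟨r, hr, -⟩⟩ := Set.mem_iUnion.1 h
    · have hadj : (cayley N).Adj 1 (FreeGroup.mk [x]) :=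
        adj_iff_exists_letter.2 ⟨x, (one_mul _).symm⟩
      have key : ∀ ζ ∈ p.1.1 ∩ p.2.1, dir 1 ζ = FreeGroup.mk [x] := fun ζ hζ =>
        (dir_eq_iff_ne hadj ζ).2 fun e => h1.2 ⟨ζ, hζ, mem_Cyl_iff.2 e⟩
      exact hne ((key ξ hξ).trans (key η hη).symm)
    · exact hroot r hr

theorem disjoint_rootSet :
    Disjoint (rootSet N) (⋃ x : Fin N × Bool, flowSet 1 (FreeGroup.mk [x])) := by
  rw [Set.disjoint_left]
  intro p hp h
  obtain ⟨x, -, h1 | ⟨r, hr, h2⟩⟩ := Set.mem_iUnion.1 h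
  · exact not_isRoot_of_mem_meetSet h1.1 hp
  · rw [hr.unique hp, toward_self] at h2
    exact (adj_iff_exists_letter.2 ⟨x, (one_mul _).symm⟩ : (cayley N).Adj 1 _).ne h2

theorem pairwise_disjoint_flowSet : Pairwise
    (Function.onFun Disjoint fun x : Fin N × Bool => flowSet 1 (FreeGroup.mk [x])) := by
  intro x y hxy
  have hne : (FreeGroup.mk [x] : F N) ≠ FreeGroup.mk [y] := fun e => hxy (by
    have := congrArg FreeGroup.toWord e
    simpa only [FreeGroup.toWord_mk, FreeGroup.reduce_singleton, List.cons.injEq, and_true]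
      using this)
  rw [Function.onFun, Set.disjoint_left]
  rintro p ⟨-, h1 | ⟨r, hr, h1⟩⟩ ⟨-, h2 | ⟨s, hs, h2⟩⟩
  · obtain ⟨ξ, hξ, h3⟩ := h1.1
    refine h2.2 ⟨ξ, hξ, mem_Cyl_iff.2 ?_⟩
    have hadj : (cayley N).Adj 1 (FreeGroup.mk [y]) :=
      adj_iff_exists_letter.2 ⟨y, (one_mul _).symm⟩
    refine (dir_or hadj ξ).resolve_left ?_
    rw [mem_Cyl_iff.1 h3]
    exact hne
  · exact not_isRoot_of_mem_meetSet h1.1 hs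
  · exact not_isRoot_of_mem_meetSet h2.1 hr
  · rw [hs.unique hr, h1] at h2
    exact hne h2

/-! ### The edge and vertex identities -/

theorem measurableSet_meetIn (T : Finset (F N)) : MeasurableSet (meetIn T) :=
  measurableSet_hullInter_eq (T : Set (F N))

theorem contractibleFunctional_eq (μ ν : SCurr N) : contractibleFunctional μ ν =
    ((μ : Measure (ClosedSets N)).prod (ν : Measure (ClosedSets N))) (rootSet N) := by
  have h : rootSet N = ⋃ c : Quotient (basedSetoid N), meetIn c.out.1 := by
    ext p
    simp only [rootSet, Set.mem_ofPred_eq, isRoot_one_iff, Set.mem_iUnion]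
    rfl
  rw [h, measure_iUnion _ fun c => measurableSet_meetIn _]
  · rfl
  · intro c c' hne
    rw [Function.onFun, Set.disjoint_left]
    intro p hp hp'
    refine hne ?_
    have e : (c.out.1 : Set (F N)) = c'.out.1 := Eq.trans (Eq.symm hp) hp'
    rw [← Quotient.out_eq c, ← Quotient.out_eq c']
    exact Quotient.sound ⟨1, by simpa using e⟩

theorem rootSet_subset : rootSet N ⊆ hullSet (1 : F N) ×ˢ hullSet 1 := by
  rw [hullSet_prod_eq]
  exact Set.subset_union_of_subset_right Set.subset_union_left _

theorem contractibleFunctional_lt_top (μ ν : SCurr N) : contractibleFunctional μ ν < ∞ := by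
  rw [contractibleFunctional_eq]
  exact (measure_mono rootSet_subset).trans_lt (prod_hullSet_lt_top μ ν 1)

theorem edgeSet_prod_lt_top (μ ν : SCurr N) {u v : F N} (h : (cayley N).Adj u v) :
    ((μ : Measure (ClosedSets N)).prod (ν : Measure (ClosedSets N)))
      (edgeSet u v ×ˢ edgeSet u v) < ∞ :=
  (measure_mono (Set.prod_mono (fun _ hS => ((mem_edgeSet_iff h).1 hS).1)
    (fun _ hS => ((mem_edgeSet_iff h).1 hS).1))).trans_lt (prod_hullSet_lt_top μ ν u)

theorem edge_identity (μ ν : SCurr N) (a : Fin N) :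
    (μ : Measure (ClosedSets N)).real (edgeSet 1 (FreeGroup.of a)) *
        (ν : Measure (ClosedSets N)).real (edgeSet 1 (FreeGroup.of a)) =
      (interCurrent μ ν : Measure (ClosedSets N)).real (edgeSet 1 (FreeGroup.of a)) +
        ∑ b : Bool, ((μ : Measure (ClosedSets N)).prod (ν : Measure (ClosedSets N))).real
          (flowSet 1 (FreeGroup.mk [(a, b)])) := by
  have hadj := adj_one_of a
  have hfin := edgeSet_prod_lt_top μ ν hadj
  rw [← measureReal_prod_prod]
  have hI : (interCurrent μ ν : Measure (ClosedSets N)).real (edgeSet 1 (FreeGroup.of a)) =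
      ((μ : Measure (ClosedSets N)).prod (ν : Measure (ClosedSets N))).real
        (interPreimage (edgeSet 1 (FreeGroup.of a))) := by
    rw [measureReal_def, measureReal_def, interCurrent_apply _ _ (isClopen_edgeSet _ _).2.measurableSet]
  -- The flow from a to 1 is translated by a⁻¹ into flow leaving the vertex 1; summed over a, the
  -- edges then account for all edges going out of 1.
  have hflow : ((μ : Measure (ClosedSets N)).prod (ν : Measure (ClosedSets N))).real
      (flowSet 1 (FreeGroup.mk [(a, false)])) =
        ((μ : Measure (ClosedSets N)).prod (ν : Measure (ClosedSets N))).real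
          (flowSet (FreeGroup.of a) 1) := by
    have h1 : (FreeGroup.mk [(a, false)] : F N) = (FreeGroup.of a)⁻¹ * 1 := by
      rw [mul_one]; rfl
    rw [measureReal_def, measureReal_def,
      ← measure_flowSet_translate μ ν (FreeGroup.of a)⁻¹ (FreeGroup.of a) 1, inv_mul_cancel, ← h1]
  rw [edgeSet_prod_eq hadj] at hfin ⊢
  have hfin2 := (measure_mono (Set.subset_union_right)).trans_lt hfin
  rw [measureReal_union (disjoint_interPreimage_flowSet hadj)
    ((measurableSet_flowSet _ _).union (measurableSet_flowSet _ _))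
    ((measure_mono Set.subset_union_left).trans_lt hfin).ne hfin2.ne,
    measureReal_union (disjoint_flowSet_swap hadj) (measurableSet_flowSet _ _)
    ((measure_mono Set.subset_union_left).trans_lt hfin2).ne
    ((measure_mono Set.subset_union_right).trans_lt hfin2).ne, hI, Fintype.sum_bool, hflow]
  rfl

theorem vertex_identity (μ ν : SCurr N) :
    (μ : Measure (ClosedSets N)).real (hullSet 1) * (ν : Measure (ClosedSets N)).real (hullSet 1) =
      (interCurrent μ ν : Measure (ClosedSets N)).real (hullSet 1) +
        ((contractibleFunctional μ ν).toReal +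
          ∑ a : Fin N, ∑ b : Bool, ((μ : Measure (ClosedSets N)).prod
            (ν : Measure (ClosedSets N))).real (flowSet 1 (FreeGroup.mk [(a, b)]))) := by
  have hfin := prod_hullSet_lt_top μ ν 1
  rw [← measureReal_prod_prod]
  have hI : (interCurrent μ ν : Measure (ClosedSets N)).real (hullSet 1) =
      ((μ : Measure (ClosedSets N)).prod (ν : Measure (ClosedSets N))).real (interHullSet 1) := by
    rw [measureReal_def, measureReal_def, interCurrent_apply _ _ (isOpen_hullSet _).measurableSet,
      interPreimage_hullSet]
  rw [hullSet_prod_eq] at hfin ⊢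
  have hm : MeasurableSet (⋃ x : Fin N × Bool, flowSet (1 : F N) (FreeGroup.mk [x])) :=
    MeasurableSet.iUnion fun x => measurableSet_flowSet _ _
  have hfin2 := (measure_mono (Set.subset_union_right)).trans_lt hfin
  have hfin3 := (measure_mono (Set.subset_union_right)).trans_lt hfin2
  have hfin4 : ∀ x : Fin N × Bool, ((μ : Measure (ClosedSets N)).prod
      (ν : Measure (ClosedSets N))) (flowSet 1 (FreeGroup.mk [x])) ≠ ∞ := fun x =>
    ((measure_mono (Set.subset_iUnion _ x)).trans_lt hfin3).ne
  rw [measureReal_union disjoint_interHullSet ((measurableSet_isRoot 1).union hm)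
    ((measure_mono Set.subset_union_left).trans_lt hfin).ne hfin2.ne,
    measureReal_union disjoint_rootSet hm
    ((measure_mono Set.subset_union_left).trans_lt hfin2).ne hfin3.ne, hI,
    contractibleFunctional_eq, ← Fintype.sum_prod_type']
  congr 2
  rw [measureReal_def, measure_iUnion pairwise_disjoint_flowSet fun x => measurableSet_flowSet _ _,
    tsum_fintype, ENNReal.toReal_sum fun x _ => hfin4 x]
  rfl

/-- The flow terms of `edge_identity` and `vertex_identity` agree and cancel; what remains is ĉ. -/
theorem reducedRank_interCurrent (μ ν : SCurr N) :
    reducedRank (interCurrent μ ν) = intersectionFunctional μ ν := by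
  rw [reducedRank, intersectionFunctional, edgeFunctional_eq, vertexFunctional_eq,
    vertexFunctional_eq, vertexFunctional_eq, vertex_identity]
  simp only [SCyl_edge, edge_identity, Finset.sum_add_distrib]
  ring

/-! ### Positive words -/

/-- The elements of the free group which are products of basis elements. -/
def IsPositive (g : F N) : Prop := ∀ x ∈ g.toWord, x.2 = true

theorem isPositive_one : IsPositive (1 : F N) := by simp [IsPositive]

theorem isPositive_of (a : Fin N) : IsPositive (FreeGroup.of a : F N) := by simp [IsPositive]

theorem IsPositive.toWord_mul {g h : F N} (hg : IsPositive g) (hh : IsPositive h) :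
    (g * h).toWord = g.toWord ++ h.toWord := by
  rw [FreeGroup.toWord_mul]
  refine FreeGroup.IsReduced.reduce_eq ?_
  have : ∀ x ∈ g.toWord ++ h.toWord, x.2 = true := fun x hx =>
    (List.mem_append.1 hx).elim (hg x) (hh x)
  refine List.Pairwise.isChain (List.pairwise_of_forall_mem_list fun x hx y hy _ => ?_)
  rw [this x hx, this y hy]

theorem IsPositive.mul {g h : F N} (hg : IsPositive g) (hh : IsPositive h) :
    IsPositive (g * h) := fun x hx => by
  rw [hg.toWord_mul hh] at hx
  exact (List.mem_append.1 hx).elim (hg x) (hh x)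

theorem IsPositive.pow {g : F N} (hg : IsPositive g) (n : ℕ) : IsPositive (g ^ n) := by
  induction n with
  | zero => exact isPositive_one
  | succ n ih => rw [pow_succ]; exact ih.mul hg

theorem IsPositive.toward_one {g : F N} (hg : IsPositive g) (a : Fin N) :
    toward 1 (FreeGroup.of a * g) = FreeGroup.of a := by
  simp only [toward, inv_one, one_mul, (isPositive_of a).toWord_mul hg, FreeGroup.toWord_of]
  rfl

theorem IsPositive.toward_one_inv {g : F N} (hg : IsPositive g) (a : Fin N) :
    toward 1 (g * FreeGroup.of a)⁻¹ = (FreeGroup.of a)⁻¹ := by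
  simp only [toward, inv_one, one_mul, FreeGroup.toWord_inv, hg.toWord_mul (isPositive_of a),
    FreeGroup.toWord_of]
  simp [FreeGroup.invRev]
  rfl

/-! ### Limit sets of cyclic subgroups -/

theorem limitSetOf_union (A B : Set (F N)) :
    limitSetOf (A ∪ B) = limitSetOf A ∪ limitSetOf B := by
  simp only [limitSetOf, Set.image_union, closure_union]
  rfl

theorem limitSet_zpowers (c : F N) : limitSet (Subgroup.zpowers c) =
    limitSetOf (Set.range fun k : ℕ => c ^ (k + 1)) ∪
      limitSetOf (Set.range fun k : ℕ => (c ^ k)⁻¹) := by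
  rw [limitSet_eq, ← limitSetOf_union]
  congr 1
  ext x
  simp only [SetLike.mem_coe, Subgroup.mem_zpowers_iff, Set.mem_union, Set.mem_range]
  constructor
  · rintro ⟨k, rfl⟩
    rcases lt_or_ge 0 k with hk | hk
    · refine Or.inl ⟨(k - 1).toNat, ?_⟩
      rw [← zpow_natCast]
      congr 1
      omega
    · refine Or.inr ⟨(-k).toNat, ?_⟩
      rw [← zpow_natCast, ← zpow_neg]
      congr 1
      omega
  · rintro (⟨k, rfl⟩ | ⟨k, rfl⟩)
    · exact ⟨k + 1, by rw [← zpow_natCast]; rfl⟩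
    · exact ⟨-k, by rw [zpow_neg, zpow_natCast]⟩

theorem limitSetOf_range_pow_nonempty {c : F N} (hc : c ≠ 1) :
    (limitSetOf (Set.range fun k : ℕ => c ^ (k + 1))).Nonempty :=
  limitSetOf_nonempty (infinite_range_pow hc)

theorem limitSetOf_range_pow_inv_nonempty {c : F N} (hc : c ≠ 1) :
    (limitSetOf (Set.range fun k : ℕ => (c ^ k)⁻¹)).Nonempty := by
  refine (limitSetOf_nonempty (infinite_range_pow (inv_ne_one.2 hc))).mono (limitSetOf_mono ?_)
  rintro _ ⟨k, rfl⟩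
  exact ⟨k + 1, (inv_pow c (k + 1)).symm⟩

theorem dir_of_mem_limitSetOf_pow {a : Fin N} {c p : F N} (hc : IsPositive c) (hp : IsPositive p)
    {m : ℕ} (h : c = FreeGroup.of a ^ (m + 1) * p) {ξ : Boundary N}
    (hξ : ξ ∈ limitSetOf (Set.range fun k : ℕ => c ^ (k + 1))) :
    dir (FreeGroup.of a ^ m) ξ = FreeGroup.of a ^ (m + 1) := by
  obtain ⟨_, ⟨k, rfl⟩, hk⟩ := dir_of_mem_limitSetOf hξ (FreeGroup.of a ^ m)
  have h1 : c ^ (k + 1) = FreeGroup.of a ^ m * (FreeGroup.of a * (p * c ^ k)) := by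
    rw [pow_succ']
    nth_rewrite 1 [h]
    simp only [pow_succ, mul_assoc]
  have h2 := mul_toward (FreeGroup.of a ^ m) 1 (FreeGroup.of a * (p * c ^ k))
  rw [mul_one, (hp.mul (hc.pow k)).toward_one] at h2
  rw [← hk, pow_succ]
  simp only [h1, h2]

theorem dir_of_mem_limitSetOf_pow_inv {c : F N} (a : Fin N) (hc : IsPositive c) (m : ℕ)
    {ξ : Boundary N} (hξ : ξ ∈ limitSetOf (Set.range fun k : ℕ => (c ^ k)⁻¹)) :
    dir (FreeGroup.of a ^ (m + 1)) ξ = FreeGroup.of a ^ m := by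
  obtain ⟨_, ⟨k, rfl⟩, hk⟩ := dir_of_mem_limitSetOf hξ (FreeGroup.of a ^ (m + 1))
  have h1 : (c ^ k)⁻¹ =
      FreeGroup.of a ^ (m + 1) * (c ^ k * FreeGroup.of a ^ m * FreeGroup.of a)⁻¹ := by
    simp only [pow_succ]
    group
  have h2 := mul_toward (FreeGroup.of a ^ (m + 1)) 1 (c ^ k * FreeGroup.of a ^ m * FreeGroup.of a)⁻¹
  rw [mul_one, ((hc.pow k).mul ((isPositive_of a).pow m)).toward_one_inv] at h2
  rw [← hk]
  change toward _ (c ^ k)⁻¹ = _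
  rw [h1, h2, pow_succ, mul_inv_cancel_right]

theorem dir_inv_of_mem_limitSetOf_pow_inv (a : Fin N) (m : ℕ)
    {ξ : Boundary N} (hξ : ξ ∈ limitSetOf (Set.range fun k : ℕ => ((FreeGroup.of a : F N) ^ k)⁻¹)) :
    dir (FreeGroup.of a ^ m)⁻¹ ξ = (FreeGroup.of a ^ (m + 1))⁻¹ := by
  -- The set of powers is shifted without changing its limit set, so that every element lies beyond
  -- the vertex considered.
  rw [← limitSetOf_mul_right _ (FreeGroup.of a ^ (m + 1))⁻¹] at hξ
  obtain ⟨_, ⟨_, ⟨k, rfl⟩, rfl⟩, hk⟩ := dir_of_mem_limitSetOf hξ (FreeGroup.of a ^ m)⁻¹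
  have h1 : ((FreeGroup.of a : F N) ^ k)⁻¹ * (FreeGroup.of a ^ (m + 1))⁻¹ =
      (FreeGroup.of a ^ m)⁻¹ * (FreeGroup.of a ^ k * FreeGroup.of a)⁻¹ := by
    group
  have h2 := mul_toward (FreeGroup.of a ^ m)⁻¹ 1 (FreeGroup.of a ^ k * FreeGroup.of a)⁻¹
  rw [mul_one, ((isPositive_of a).pow k).toward_one_inv] at h2
  rw [← hk]
  change toward _ (_ * _) = _
  rw [h1, h2, pow_succ', mul_inv_rev]

theorem dir_of_mem_limitSetOf_of_pow (a : Fin N) (m : ℕ) {ξ : Boundary N}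
    (hξ : ξ ∈ limitSetOf (Set.range fun k : ℕ => (FreeGroup.of a : F N) ^ (k + 1))) :
    dir (FreeGroup.of a ^ m) ξ = FreeGroup.of a ^ (m + 1) := by
  rw [← limitSetOf_mul_right _ (FreeGroup.of a ^ m)] at hξ
  obtain ⟨_, ⟨_, ⟨k, rfl⟩, rfl⟩, hk⟩ := dir_of_mem_limitSetOf hξ (FreeGroup.of a ^ m)
  have h1 : (FreeGroup.of a : F N) ^ (k + 1) * FreeGroup.of a ^ m =
      FreeGroup.of a ^ m * (FreeGroup.of a * FreeGroup.of a ^ k) := by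
    rw [← pow_succ', ← pow_add, ← pow_add, add_comm]
  have h2 := mul_toward (FreeGroup.of a ^ m) 1 (FreeGroup.of a * FreeGroup.of a ^ k)
  rw [mul_one, ((isPositive_of a).pow k).toward_one] at h2
  rw [← hk]
  change toward _ (_ * _) = _
  rw [h1, h2, pow_succ]

/-! ### Neighbourhoods of the limit set of a basis element -/

/-- The sets which consist of a part near each of the two ends of the axis of `a`. -/
def twoEnded (a : Fin N) (m : ℕ) : Set (ClosedSets N) :=
  {S | S.1 ⊆ Cyl (FreeGroup.of a ^ m) (FreeGroup.of a ^ (m + 1)) ∪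
      Cyl (FreeGroup.of a ^ m)⁻¹ (FreeGroup.of a ^ (m + 1))⁻¹ ∧
    (S.1 ∩ Cyl (FreeGroup.of a ^ m) (FreeGroup.of a ^ (m + 1))).Nonempty ∧
    (S.1 ∩ Cyl (FreeGroup.of a ^ m)⁻¹ (FreeGroup.of a ^ (m + 1))⁻¹).Nonempty}

theorem rayTo_one_of_mem_limitSetOf_pow {a : Fin N} {ξ : Boundary N}
    (hξ : ξ ∈ limitSetOf (Set.range fun k : ℕ => (FreeGroup.of a : F N) ^ (k + 1))) (n : ℕ) :
    (rayTo 1 ξ).1 n = FreeGroup.of a ^ n := by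
  induction n with
  | zero => simp
  | succ n ih => rw [rayTo_succ, ih, dir_of_mem_limitSetOf_of_pow a n hξ]

theorem rayTo_one_of_mem_limitSetOf_pow_inv {a : Fin N} {ξ : Boundary N}
    (hξ : ξ ∈ limitSetOf (Set.range fun k : ℕ => ((FreeGroup.of a : F N) ^ k)⁻¹)) (n : ℕ) :
    (rayTo 1 ξ).1 n = (FreeGroup.of a ^ n)⁻¹ := by
  induction n with
  | zero => simp
  | succ n ih => rw [rayTo_succ, ih, dir_inv_of_mem_limitSetOf_pow_inv a n hξ]

theorem of_ne_one (a : Fin N) : (FreeGroup.of a : F N) ≠ 1 := FreeGroup.of_ne_one a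

/-- The cylinders at the two ends of the axis shrink to the ends. The statement passes through the
generation of the Vietoris topology from its subbasis, because only finite intersections combine
conditions on m. -/
theorem eventually_twoEnded_subset {a : Fin N} {S : ClosedSets N}
    (hS : S.1 = limitSet (Subgroup.zpowers (FreeGroup.of a))) {U : Set (ClosedSets N)}
    (hU : IsOpen U) (hSU : S ∈ U) : ∀ᶠ m in Filter.atTop, twoEnded a m ⊆ U := by
  let : TopologicalSpace (Set (Boundary N)) := .vietoris _
  obtain ⟨G, hG, rfl⟩ := isOpen_induced_iff.1 hU
  change S.1 ∈ G at hSU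
  rw [hS, limitSet_zpowers] at hSU
  have hpos : ∀ ξ ∈ limitSetOf (Set.range fun k : ℕ => (FreeGroup.of a : F N) ^ (k + 1)),
      ∀ V : Set (Boundary N), IsOpen V → ξ ∈ V → ∀ᶠ m in Filter.atTop,
        Cyl (FreeGroup.of a ^ m) (FreeGroup.of a ^ (m + 1)) ⊆ V := by
    intro ξ hξ V hV hξV
    obtain ⟨n, hn⟩ := exists_Cyl_subset hV (rayTo 1 ξ) (by simpa using hξV)
    simp only [rayTo_one_of_mem_limitSetOf_pow hξ] at hn
    exact Filter.eventually_atTop.2 ⟨n, hn⟩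
  have hneg : ∀ ξ ∈ limitSetOf (Set.range fun k : ℕ => ((FreeGroup.of a : F N) ^ k)⁻¹),
      ∀ V : Set (Boundary N), IsOpen V → ξ ∈ V → ∀ᶠ m in Filter.atTop,
        Cyl (FreeGroup.of a ^ m)⁻¹ (FreeGroup.of a ^ (m + 1))⁻¹ ⊆ V := by
    intro ξ hξ V hV hξV
    obtain ⟨n, hn⟩ := exists_Cyl_subset hV (rayTo 1 ξ) (by simpa using hξV)
    simp only [rayTo_one_of_mem_limitSetOf_pow_inv hξ] at hn
    exact Filter.eventually_atTop.2 ⟨n, hn⟩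
  suffices h : ∀ᶠ m in Filter.atTop, ∀ T ∈ twoEnded a m, T.1 ∈ G from h
  clear hU hS
  induction hG with
  | basic s hs =>
    rcases hs with ⟨V, hV, rfl⟩ | ⟨V, hV, rfl⟩
    · obtain ⟨ξ, hξ⟩ := limitSetOf_range_pow_nonempty (of_ne_one a)
      obtain ⟨η, hη⟩ := limitSetOf_range_pow_inv_nonempty (of_ne_one a)
      filter_upwards [hpos ξ hξ V hV (hSU (Or.inl hξ)), hneg η hη V hV (hSU (Or.inr hη))]
        with m h1 h2 T hT
      exact hT.1.trans (Set.union_subset h1 h2)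
    · obtain ⟨ξ, hξ | hξ, hξV⟩ := hSU
      · filter_upwards [hpos ξ hξ V hV hξV] with m h1 T hT
        exact hT.2.1.mono (Set.inter_subset_inter_right _ h1)
      · filter_upwards [hneg ξ hξ V hV hξV] with m h1 T hT
        exact hT.2.2.mono (Set.inter_subset_inter_right _ h1)
  | univ => exact Filter.Eventually.of_forall fun m T _ => Set.mem_univ _
  | inter s t _ _ hs ht =>
    filter_upwards [hs hSU.1, ht hSU.2] with m h1 h2 T hT
    exact ⟨h1 T hT, h2 T hT⟩
  | sUnion 𝒮 _ ih =>
    obtain ⟨s, hs, hSs⟩ := hSU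
    filter_upwards [ih s hs hSs] with m h1 T hT
    exact ⟨s, hs, h1 T hT⟩

/-! ### The counting currents of the subgroups generated by `a ^ n * b` -/

/-- The axis of aⁿb contains 1, a, …, aⁿ. When j is more than m away from 0 and from n, its
translate by a⁻ʲ follows the axis of a for m + 1 steps in both directions. -/
theorem translate_inv_limitPoint_mem_twoEnded {a b : Fin N} {n j m : ℕ}
    {H : Subgroup (F N)} (hH : H = Subgroup.zpowers (FreeGroup.of a ^ n * FreeGroup.of b))
    (h : H ≠ ⊥) (h1 : m < j) (h2 : j + m < n) :
    ClosedSets.translate (FreeGroup.of a ^ j)⁻¹ (limitPoint H h) ∈ twoEnded a m := by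
  subst hH
  set c : F N := FreeGroup.of a ^ n * FreeGroup.of b with hc
  have hcp : IsPositive c := ((isPositive_of a).pow n).mul (isPositive_of b)
  have hc1 : c ≠ 1 := fun h' => h (by rw [h', Subgroup.zpowers_one_eq_bot])
  have hpos : ∀ ξ ∈ limitSetOf (Set.range fun k : ℕ => c ^ (k + 1)),
      (FreeGroup.of a ^ j)⁻¹ • ξ ∈ Cyl (FreeGroup.of a ^ m) (FreeGroup.of a ^ (m + 1)) := by
    intro ξ hξ
    have h3 : c = FreeGroup.of a ^ (j + m + 1) *
        (FreeGroup.of a ^ (n - (j + m + 1)) * FreeGroup.of b) := by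
      rw [hc, ← mul_assoc, ← pow_add, Nat.add_sub_cancel' h2]
    rw [mem_Cyl_iff, dir_smul', inv_inv, ← pow_add, dir_of_mem_limitSetOf_pow hcp
      (((isPositive_of a).pow _).mul (isPositive_of b)) h3 hξ, add_assoc, pow_add,
      inv_mul_cancel_left]
  have hneg : ∀ ξ ∈ limitSetOf (Set.range fun k : ℕ => (c ^ k)⁻¹),
      (FreeGroup.of a ^ j)⁻¹ • ξ ∈ Cyl (FreeGroup.of a ^ m)⁻¹ (FreeGroup.of a ^ (m + 1))⁻¹ := by
    intro ξ hξ
    obtain ⟨i, rfl⟩ : ∃ i, j = i + 1 + m := ⟨j - m - 1, by omega⟩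
    rw [mem_Cyl_iff, dir_smul', inv_inv, pow_add (FreeGroup.of a) (i + 1) m, mul_inv_cancel_right,
      dir_of_mem_limitSetOf_pow_inv a hcp i hξ]
    group
  have hS : (ClosedSets.translate (FreeGroup.of a ^ j)⁻¹ (limitPoint _ h)).1 =
      (fun ξ => (FreeGroup.of a ^ j)⁻¹ • ξ) '' limitSet (Subgroup.zpowers c) := rfl
  rw [limitSet_zpowers, Set.image_union] at hS
  rw [twoEnded, Set.mem_ofPred_eq, hS]
  refine ⟨?_, ?_, ?_⟩
  · rintro _ (⟨ξ, hξ, rfl⟩ | ⟨ξ, hξ, rfl⟩)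
    · exact Or.inl (hpos ξ hξ)
    · exact Or.inr (hneg ξ hξ)
  · obtain ⟨ξ, hξ⟩ := limitSetOf_range_pow_nonempty hc1
    exact ⟨_, Or.inl ⟨ξ, hξ, rfl⟩, hpos ξ hξ⟩
  · obtain ⟨ξ, hξ⟩ := limitSetOf_range_pow_inv_nonempty hc1
    exact ⟨_, Or.inr ⟨ξ, hξ, rfl⟩, hneg ξ hξ⟩

/-- The exponent sum of a basis element. -/
def exponentSum (b : Fin N) : F N →* Multiplicative ℤ :=
  FreeGroup.lift fun i => if i = b then Multiplicative.ofAdd 1 else 1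

theorem exponentSum_of_self (b : Fin N) :
    exponentSum b (FreeGroup.of b) = Multiplicative.ofAdd 1 := by simp [exponentSum]

theorem exponentSum_of_ne {a b : Fin N} (h : a ≠ b) :
    exponentSum b (FreeGroup.of a) = 1 := by simp [exponentSum, h]

theorem zpow_eq_one_of_exponentSum_zpow_eq_one {a b : Fin N} (hab : a ≠ b) {n : ℕ} {k : ℤ}
    (h : exponentSum b ((FreeGroup.of a ^ n * FreeGroup.of b) ^ k) = 1) : k = 0 := by
  rw [map_zpow, map_mul, map_pow, exponentSum_of_self, exponentSum_of_ne hab, one_pow, one_mul,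
    ← ofAdd_zsmul] at h
  simpa using h

/-- The exponent sum of b is k on (aⁿb)ᵏ and zero on conjugates of powers of a. -/
theorem zpowers_inf_conjSubgroup_eq_bot {a b : Fin N} (hab : a ≠ b) (n : ℕ) (g : F N) :
    Subgroup.zpowers (FreeGroup.of a ^ n * FreeGroup.of b) ⊓
      conjSubgroup g (Subgroup.zpowers (FreeGroup.of a)) = ⊥ := by
  rw [eq_bot_iff]
  rintro x ⟨h1, h2⟩
  obtain ⟨k, rfl⟩ := Subgroup.mem_zpowers_iff.1 h1
  obtain ⟨l, hl⟩ := Subgroup.mem_zpowers_iff.1 (mem_conjSubgroup.1 h2)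
  have h3 := congrArg (exponentSum b) hl
  rw [map_mul, map_mul, map_inv, mul_right_comm, inv_mul_cancel, one_mul, map_zpow (exponentSum b)
    (FreeGroup.of a), exponentSum_of_ne hab, one_zpow] at h3
  rw [zpow_eq_one_of_exponentSum_zpow_eq_one hab h3.symm]
  simp

theorem doubleCosetSum_zpowers_eq_zero {a b : Fin N} (hab : a ≠ b) (n : ℕ) :
    doubleCosetSum (Subgroup.zpowers (FreeGroup.of a ^ n * FreeGroup.of b))
      (Subgroup.zpowers (FreeGroup.of a)) = 0 := by
  simp only [doubleCosetSum, zpowers_inf_conjSubgroup_eq_bot hab, counting_bot, Measure.sum_zero]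

theorem counting_le_doubleCosetSum (H : Subgroup (F N)) : counting H ≤ doubleCosetSum H H := by
  obtain ⟨h, k, hh, hk, heq⟩ := DoubleCoset.mk_out_eq_mul H H 1
  have h1 : H ⊓ conjSubgroup (Quotient.out (DoubleCoset.mk H H 1)) H = H := by
    rw [conjSubgroup_of_mem, inf_idem]
    rw [heq]
    exact H.mul_mem (H.mul_mem hh H.one_mem) hk
  have h2 := Measure.le_sum (fun d : DoubleCoset.Quotient (H : Set (F N)) (H : Set (F N)) =>
    counting (H ⊓ conjSubgroup (Quotient.out d) H)) (DoubleCoset.mk H H 1)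
  rwa [h1] at h2

/-! ### Integrals against counting currents -/

/-- A translate xS matters only if 1 is in its hull, that is, x⁻¹ is in the hull of S. So the
relevant cosets are indexed by the H-orbits on the hull, represented by the q i. -/
theorem integral_cosetCounting_eq_sum {H : Subgroup (F N)} {S : ClosedSets N}
    (hS : ∀ h ∈ H, ClosedSets.translate h S = S) {ι : Type*} (s : Finset ι) (q : ι → F N)
    (hq : Set.InjOn (fun i => (((q i)⁻¹ : F N) : F N ⧸ H)) s)
    (hc : ∀ v ∈ Conv S.1, ∃ h ∈ H, ∃ i ∈ s, v = h * q i) {f : ClosedSets N → ℝ}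
    (hf : Integrable f (cosetCounting H S)) (hsupp : Function.support f ⊆ hullSet 1) :
    ∫ T, f T ∂cosetCounting H S = ∑ i ∈ s, f (ClosedSets.translate (q i)⁻¹ S) := by
  classical
  rw [cosetCounting] at hf ⊢
  rw [integral_sum_measure hf]
  simp only [integral_dirac]
  rw [tsum_eq_sum (s := s.image fun i => (((q i)⁻¹ : F N) : F N ⧸ H)), Finset.sum_image hq]
  · exact Finset.sum_congr rfl fun i _ => by rw [translate_mk_out hS]
  · intro x hx
    by_contra h0
    have h1 : (1 : F N) ∈ Conv (ClosedSets.translate x.out S).1 := hsupp h0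
    rw [ClosedSets.translate, Conv_image_smul, mul_one] at h1
    obtain ⟨h, hh, i, hi, hv⟩ := hc _ h1
    refine hx (Finset.mem_image.2 ⟨i, hi, ?_⟩)
    rw [← QuotientGroup.out_eq' x, QuotientGroup.eq, inv_inv,
      show q i = h⁻¹ * x.out⁻¹ by rw [hv, inv_mul_cancel_left], inv_mul_cancel_right]
    exact H.inv_mem hh

theorem fg_zpowers (c : F N) : (Subgroup.zpowers c).FG :=
  ⟨{c}, by rw [Finset.coe_singleton, Subgroup.zpowers_eq_closure]⟩

/-- The counting current of a cyclic subgroup. -/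
def cyclicCurrent (c : F N) : SCurr N := ⟨_, counting_mem_SCurr (fg_zpowers c)⟩

theorem coe_cyclicCurrent {c : F N} (h : Subgroup.zpowers c ≠ ⊥) :
    (cyclicCurrent c : Measure (ClosedSets N)) =
      cosetCounting (Subgroup.zpowers c) (limitPoint (Subgroup.zpowers c) h) :=
  (isQuasiconvex_of_fg (fg_zpowers c)).counting_eq h

theorem exists_eq_mul_pow_of_mem_Conv (a b : Fin N) (n : ℕ) {v : F N}
    (hv : v ∈ Conv (limitSet (Subgroup.zpowers (FreeGroup.of a ^ n * FreeGroup.of b)))) :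
    ∃ h ∈ Subgroup.zpowers (FreeGroup.of a ^ n * FreeGroup.of b), ∃ i ∈ Finset.range (n + 1),
      v = h * FreeGroup.of a ^ i := by
  set c : F N := FreeGroup.of a ^ n * FreeGroup.of b with hc
  have hw : c.toWord = List.replicate n (a, true) ++ [(b, true)] := by
    rw [hc, ((isPositive_of a).pow n).toWord_mul (isPositive_of b), FreeGroup.toWord_of_pow,
      FreeGroup.toWord_of]
  rw [Subgroup.zpowers_eq_closure] at hv
  have h1 : ∀ s ∈ ({c} : Set (F N)), ∀ i, FreeGroup.mk (s.toWord.take i) ∈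
      {p : F N | ∃ h ∈ Subgroup.zpowers c, ∃ i ∈ Finset.range (n + 1),
        p = h * FreeGroup.of a ^ i} := by
    rintro _ rfl i
    rcases le_or_gt i n with hi | hi
    · refine ⟨1, Subgroup.one_mem _, i, Finset.mem_range.2 (by omega), ?_⟩
      rw [hw, List.take_append_of_le_length (by simpa using hi), List.take_replicate,
        min_eq_left hi, ← FreeGroup.toWord_of_pow, FreeGroup.mk_toWord, one_mul]
    -- The full word is c itself, which is in the orbit of 1.
    · refine ⟨c, Subgroup.mem_zpowers c, 0, by simp, ?_⟩
      rw [List.take_of_length_le (by rw [hw]; simpa using hi), FreeGroup.mk_toWord, pow_zero,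
        mul_one]
  obtain ⟨h, hh, _, ⟨h', hh', i, hi, rfl⟩, rfl⟩ := exists_eq_mul_of_mem_Conv_limitSet h1 hv
  rw [← Subgroup.zpowers_eq_closure] at hh
  exact ⟨h * h', Subgroup.mul_mem _ hh hh', i, hi, (mul_assoc _ _ _).symm⟩

theorem mem_zpowers_of_mem_Conv (a : Fin N) {v : F N}
    (hv : v ∈ Conv (limitSet (Subgroup.zpowers (FreeGroup.of a)))) :
    v ∈ Subgroup.zpowers (FreeGroup.of a : F N) := by
  rw [Subgroup.zpowers_eq_closure] at hv
  have h1 : ∀ s ∈ ({FreeGroup.of a} : Set (F N)), ∀ i, FreeGroup.mk (s.toWord.take i) ∈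
      (Subgroup.zpowers (FreeGroup.of a : F N) : Set (F N)) := by
    rintro _ rfl i
    rw [FreeGroup.toWord_of]
    rcases i with _ | i
    · exact Subgroup.one_mem _
    · rw [List.take_of_length_le (by simp)]
      exact Subgroup.mem_zpowers _
  obtain ⟨h, hh, p, hp, rfl⟩ := exists_eq_mul_of_mem_Conv_limitSet h1 hv
  rw [← Subgroup.zpowers_eq_closure] at hh
  exact Subgroup.mul_mem _ hh hp

theorem zpowers_of_ne_bot (a : Fin N) : Subgroup.zpowers (FreeGroup.of a : F N) ≠ ⊥ :=
  fun h => of_ne_one a (Subgroup.zpowers_eq_bot.1 h)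

theorem zpowers_pow_mul_ne_bot {a b : Fin N} (hab : a ≠ b) (n : ℕ) :
    Subgroup.zpowers (FreeGroup.of a ^ n * FreeGroup.of b : F N) ≠ ⊥ := fun h => by
  have h1 := Subgroup.zpowers_eq_bot.1 h
  exact one_ne_zero (zpow_eq_one_of_exponentSum_zpow_eq_one (n := n) (k := 1) hab
    (by rw [h1, one_zpow, map_one]))

theorem integral_cyclicCurrent_pow_mul {a b : Fin N} (hab : a ≠ b) (n : ℕ)
    {f : ClosedSets N → ℝ} (hf : Continuous f) (hc : HasCompactSupport f)
    (hsupp : Function.support f ⊆ hullSet 1) :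
    ∫ T, f T ∂(cyclicCurrent (FreeGroup.of a ^ n * FreeGroup.of b) : Measure (ClosedSets N)) =
      ∑ i ∈ Finset.range (n + 1), f (ClosedSets.translate (FreeGroup.of a ^ i)⁻¹
        (limitPoint _ (zpowers_pow_mul_ne_bot hab n))) := by
  have hint := hf.integrable_of_hasCompactSupport hc
    (μ := (cyclicCurrent (FreeGroup.of a ^ n * FreeGroup.of b) : Measure (ClosedSets N)))
  rw [coe_cyclicCurrent (zpowers_pow_mul_ne_bot hab n)] at hint ⊢
  refine integral_cosetCounting_eq_sum (fun h hh => translate_limitPoint_of_mem _ hh) _ _ ?_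
    (fun v hv => exists_eq_mul_pow_of_mem_Conv a b n hv) hint hsupp
  intro i _ j _ hij
  obtain ⟨k, hk⟩ := Subgroup.mem_zpowers_iff.1 (QuotientGroup.eq.1 hij)
  have h1 := congrArg (exponentSum b) hk
  rw [inv_inv, map_mul (exponentSum b) (FreeGroup.of a ^ i), map_inv, map_pow, map_pow,
    exponentSum_of_ne hab, one_pow, one_pow, inv_one, mul_one] at h1
  rw [zpow_eq_one_of_exponentSum_zpow_eq_one hab h1, zpow_zero, inv_inv] at hk
  exact injective_pow_iff_not_isOfFinOrder.2 (not_isOfFinOrder_of_isMulTorsionFree (of_ne_one a))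
    (mul_inv_eq_one.1 hk.symm)

theorem integral_cyclicCurrent_of (a : Fin N) {f : ClosedSets N → ℝ} (hf : Continuous f)
    (hc : HasCompactSupport f) (hsupp : Function.support f ⊆ hullSet 1) :
    ∫ T, f T ∂(cyclicCurrent (FreeGroup.of a) : Measure (ClosedSets N)) =
      f (limitPoint _ (zpowers_of_ne_bot a)) := by
  have hint := hf.integrable_of_hasCompactSupport hc
    (μ := (cyclicCurrent (FreeGroup.of a) : Measure (ClosedSets N)))
  rw [coe_cyclicCurrent (zpowers_of_ne_bot a)] at hint ⊢
  rw [integral_cosetCounting_eq_sum (fun h hh => translate_limitPoint_of_mem _ hh) {()}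
    (fun _ => 1) (by simp) (fun v hv => ⟨v, mem_zpowers_of_mem_Conv a hv, (), by simp, by simp⟩)
    hint hsupp, Finset.sum_singleton, inv_one, translate_one]

/-! ### Convergence of the rescaled counting currents -/

/-- At most 2M of the n + 1 terms are not close to L, and these are bounded. -/
theorem tendsto_average {x : ℕ → ℕ → ℝ} {L K : ℝ} (hK : ∀ n j, |x n j - L| ≤ K)
    (h : ∀ ε > 0, ∃ M, ∀ n j, M ≤ j → j + M ≤ n → |x n j - L| ≤ ε) :
    Filter.Tendsto (fun n : ℕ => ((n : ℝ) + 1)⁻¹ * ∑ j ∈ Finset.range (n + 1), x n j)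
      Filter.atTop (𝓝 L) := by
  have hK0 : 0 ≤ K := (abs_nonneg _).trans (hK 0 0)
  refine Metric.tendsto_atTop.2 fun ε hε => ?_
  obtain ⟨M, hM⟩ := h (ε / 2) (half_pos hε)
  -- Beyond this bound the exceptional terms contribute less than ε/2 to the average.
  obtain ⟨n₀, hn₀⟩ := exists_nat_gt (2 * M * K / (ε / 2))
  refine ⟨n₀, fun n hn => ?_⟩
  have hn1 : (0 : ℝ) < n + 1 := by positivity
  have h1 : ((n : ℝ) + 1)⁻¹ * ∑ j ∈ Finset.range (n + 1), x n j - L =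
      ((n : ℝ) + 1)⁻¹ * ∑ j ∈ Finset.range (n + 1), (x n j - L) := by
    rw [Finset.sum_sub_distrib, Finset.sum_const, Finset.card_range, nsmul_eq_mul]
    push_cast
    field_simp
  have h2 : ∑ j ∈ Finset.range (n + 1), |x n j - L| ≤ ∑ j ∈ Finset.range (n + 1),
      (ε / 2 + ((if j < M then K else 0) + if n < j + M then K else 0)) := by
    refine Finset.sum_le_sum fun j _ => ?_
    by_cases hj : j < M
    · rw [if_pos hj]
      have : (0 : ℝ) ≤ if n < j + M then K else 0 := by split_ifs <;> simp [hK0]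
      linarith [hK n j]
    · by_cases hj' : n < j + M
      · rw [if_neg hj, if_pos hj']
        linarith [hK n j]
      · rw [if_neg hj, if_neg hj']
        linarith [hM n j (not_lt.1 hj) (not_lt.1 hj')]
  have h3 : ((Finset.range (n + 1)).filter fun j => j < M).card ≤ M := by
    refine (Finset.card_le_card fun j hj => ?_).trans_eq (Finset.card_range M)
    exact Finset.mem_range.2 (Finset.mem_filter.1 hj).2
  have h4 : ((Finset.range (n + 1)).filter fun j => n < j + M).card ≤ M := by
    have : ((Finset.range (n + 1)).filter fun j => n < j + M) ⊆ Finset.Ico (n + 1 - M) (n + 1) := by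
      intro j hj
      simp only [Finset.mem_filter, Finset.mem_range, Finset.mem_Ico] at hj ⊢
      omega
    refine (Finset.card_le_card this).trans ?_
    rw [Nat.card_Ico]
    omega
  have h5 : ∑ j ∈ Finset.range (n + 1), |x n j - L| ≤ (n + 1) * (ε / 2) + 2 * M * K := by
    refine h2.trans ?_
    rw [Finset.sum_add_distrib, Finset.sum_add_distrib, Finset.sum_const, Finset.card_range,
      ← Finset.sum_filter, ← Finset.sum_filter, Finset.sum_const, Finset.sum_const]
    simp only [nsmul_eq_mul]
    have h3' := mul_le_mul_of_nonneg_right (Nat.cast_le (α := ℝ).2 h3) hK0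
    have h4' := mul_le_mul_of_nonneg_right (Nat.cast_le (α := ℝ).2 h4) hK0
    push_cast
    linarith
  have h6 : 2 * M * K < (n + 1) * (ε / 2) := by
    rw [div_lt_iff₀ (half_pos hε)] at hn₀
    have : (n₀ : ℝ) ≤ n := by exact_mod_cast hn
    nlinarith
  rw [Real.dist_eq, h1, abs_mul, abs_of_pos (inv_pos.2 hn1), inv_mul_lt_iff₀ hn1]
  exact (Finset.abs_sum_le_sum_abs _ _).trans_lt (by linarith)

theorem tendsto_integral_of_support_subset_hullSet_one {a b : Fin N} (hab : a ≠ b)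
    {f : ClosedSets N → ℝ} (hf : Continuous f) (hc : HasCompactSupport f)
    (hsupp : Function.support f ⊆ hullSet 1) :
    Filter.Tendsto (fun n : ℕ => ((n : ℝ) + 1)⁻¹ * ∫ T, f T
      ∂(cyclicCurrent (FreeGroup.of a ^ n * FreeGroup.of b) : Measure (ClosedSets N)))
      Filter.atTop
      (𝓝 (∫ T, f T ∂(cyclicCurrent (FreeGroup.of a) : Measure (ClosedSets N)))) := by
  simp only [integral_cyclicCurrent_pow_mul hab _ hf hc hsupp,
    integral_cyclicCurrent_of a hf hc hsupp]
  obtain ⟨K, hK⟩ := hc.exists_bound_of_continuous hf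
  refine tendsto_average (K := K + K) (fun n j => ?_) fun ε hε => ?_
  · refine (abs_sub _ _).trans (add_le_add (hK _) (hK _))
  · have hopen : IsOpen {T | |f T - f (limitPoint _ (zpowers_of_ne_bot a))| < ε} :=
      isOpen_lt (hf.sub continuous_const).abs continuous_const
    obtain ⟨m, hm⟩ := (eventually_twoEnded_subset (a := a)
      (S := limitPoint _ (zpowers_of_ne_bot a)) rfl hopen (by simpa using hε)).exists
    refine ⟨m + 1, fun n j h1 h2 => (hm (translate_inv_limitPoint_mem_twoEnded rfl
      (zpowers_pow_mul_ne_bot hab n) (by omega) (by omega))).le⟩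

theorem integral_comp_translate (μ : SCurr N) (g : F N) {f : ClosedSets N → ℝ}
    (hf : Continuous f) : ∫ T, f (ClosedSets.translate g T) ∂(μ : Measure (ClosedSets N)) =
      ∫ T, f T ∂(μ : Measure (ClosedSets N)) := by
  conv_rhs => rw [← map_translate μ g]
  exact (integral_map (measurable_translate g).aemeasurable
    hf.stronglyMeasurable.aestronglyMeasurable).symm

theorem tendsto_integral_of_support_subset_hullSet {a b : Fin N} (hab : a ≠ b) (v : F N)
    {f : ClosedSets N → ℝ} (hf : Continuous f) (hsupp : Function.support f ⊆ hullSet v) :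
    Filter.Tendsto (fun n : ℕ => ((n : ℝ) + 1)⁻¹ * ∫ T, f T
      ∂(cyclicCurrent (FreeGroup.of a ^ n * FreeGroup.of b) : Measure (ClosedSets N)))
      Filter.atTop
      (𝓝 (∫ T, f T ∂(cyclicCurrent (FreeGroup.of a) : Measure (ClosedSets N)))) := by
  have hs : Function.support (f ∘ ClosedSets.translate v) ⊆ hullSet 1 := by
    intro T hT
    have : T ∈ ClosedSets.translate v ⁻¹' hullSet v := hsupp hT
    rwa [translate_preimage_hullSet, inv_mul_cancel] at this
  have h := tendsto_integral_of_support_subset_hullSet_one hab (hf.comp (continuous_translate v))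
    (HasCompactSupport.of_support_subset_isCompact (isCompact_hullSet 1) hs) hs
  simpa only [Function.comp_def, integral_comp_translate _ v hf] using h

/-- The support is covered by finitely many `hullSet v`. As these are clopen, f can be cut into
continuous pieces, each supported in one of them and movable to `hullSet 1` by invariance. -/
theorem tendsto_integral_cyclicCurrent {a b : Fin N} (hab : a ≠ b)
    {f : ClosedSets N → ℝ} (hf : Continuous f) (hc : HasCompactSupport f) :
    Filter.Tendsto (fun n : ℕ => ((n : ℝ) + 1)⁻¹ * ∫ T, f T
      ∂(cyclicCurrent (FreeGroup.of a ^ n * FreeGroup.of b) : Measure (ClosedSets N)))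
      Filter.atTop
      (𝓝 (∫ T, f T ∂(cyclicCurrent (FreeGroup.of a) : Measure (ClosedSets N)))) := by
  obtain ⟨B, hB⟩ := exists_finset_hullSet hc
  replace hB := (subset_tsupport f).trans hB
  clear hc
  induction B using Finset.cons_induction generalizing f with
  | empty =>
    have : f = 0 := by
      rw [← Function.support_eq_empty_iff, Set.eq_empty_iff_forall_notMem]
      intro T hT
      simpa using hB hT
    simp [this]
  | cons v B _ ih =>
    have hcont : ∀ C : Set (ClosedSets N), IsClopen C → Continuous (C.indicator f) := fun C hC =>
      hf.indicator fun x hx => by simp [hC.frontier_eq] at hx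
    have h1 : Function.support ((hullSet v).indicator f) ⊆ hullSet v :=
      Set.support_indicator_subset
    have h2 : Function.support ((hullSet v)ᶜ.indicator f) ⊆ ⋃ w ∈ B, hullSet w := by
      rw [Set.support_indicator]
      rintro T ⟨hT, hfT⟩
      obtain ⟨w, hw, hTw⟩ := Set.mem_iUnion₂.1 (hB hfT)
      rcases Finset.mem_cons.1 hw with rfl | hw
      · exact absurd hTw hT
      · exact Set.mem_iUnion₂.2 ⟨w, hw, hTw⟩
    have hc1 : HasCompactSupport ((hullSet v).indicator f) :=
      HasCompactSupport.of_support_subset_isCompact (isCompact_hullSet v) h1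
    have hc2 : HasCompactSupport ((hullSet v)ᶜ.indicator f) :=
      HasCompactSupport.of_support_subset_isCompact
        (B.isCompact_biUnion fun w _ => isCompact_hullSet w) h2
    have hadd : ∀ μ : SCurr N, ∫ T, f T ∂(μ : Measure (ClosedSets N)) =
        ∫ T, (hullSet v).indicator f T ∂(μ : Measure (ClosedSets N)) +
          ∫ T, (hullSet v)ᶜ.indicator f T ∂(μ : Measure (ClosedSets N)) := fun μ => by
      rw [← integral_add ((hcont _ (isClopen_hullSet v)).integrable_of_hasCompactSupport hc1)
        ((hcont _ (isClopen_hullSet v).compl).integrable_of_hasCompactSupport hc2)]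
      exact integral_congr_ae (Filter.Eventually.of_forall fun T =>
        (congrFun (Set.indicator_self_add_compl (hullSet v) f) T).symm)
    simp only [hadd, mul_add]
    exact (tendsto_integral_of_support_subset_hullSet hab v (hcont _ (isClopen_hullSet v)) h1).add
      (ih (hcont _ (isClopen_hullSet v).compl) h2)

/-- The rescaled counting currents of `⟨a ^ n * b⟩`. -/
def averagedCurrent (a b : Fin N) (n : ℕ) : SCurr N :=
  ((n : ℝ≥0) + 1)⁻¹ • cyclicCurrent (FreeGroup.of a ^ n * FreeGroup.of b)

theorem tendsto_averagedCurrent {a b : Fin N} (hab : a ≠ b) :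
    Filter.Tendsto (averagedCurrent a b) Filter.atTop (𝓝 (cyclicCurrent (FreeGroup.of a))) := by
  rw [(Topology.IsInducing.mk rfl : Topology.IsInducing fun (μ : SCurr N)
    (f : C_c(ClosedSets N, ℝ)) => ∫ S, f S ∂(μ : Measure (ClosedSets N))).tendsto_nhds_iff,
    tendsto_pi_nhds]
  intro f
  refine (tendsto_integral_cyclicCurrent hab f.continuous f.hasCompactSupport).congr fun n => ?_
  simp only [Function.comp_apply, averagedCurrent, Submodule.coe_smul, integral_smul_nnreal_measure]
  rw [NNReal.smul_def, smul_eq_mul]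
  push_cast
  rfl

/-! ### Discontinuity -/

/-- The indicator function of a compact open set. -/
def indicatorOfClopen (U : Set (ClosedSets N)) (h1 : IsClopen U) (h2 : IsCompact U) :
    C_c(ClosedSets N, ℝ) where
  toFun := U.indicator 1
  continuous_toFun := continuous_one.indicator fun x hx => by simp [h1.frontier_eq] at hx
  hasCompactSupport' :=
    HasCompactSupport.of_support_subset_isCompact h2 Set.support_indicator_subset

theorem continuous_integral (f : C_c(ClosedSets N, ℝ)) :
    Continuous fun μ : SCurr N => ∫ S, f S ∂(μ : Measure (ClosedSets N)) :=
  (continuous_apply f).comp (continuous_induced_dom : Continuous fun (μ : SCurr N)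
    (f : C_c(ClosedSets N, ℝ)) => ∫ S, f S ∂(μ : Measure (ClosedSets N)))

/-- The indicator of a compact open set is an admissible test function. Evaluation on `hullSet 1` is
what detects the discontinuity. -/
theorem continuous_real_hullSet (v : F N) :
    Continuous fun μ : SCurr N => (μ : Measure (ClosedSets N)).real (hullSet v) := by
  have h := continuous_integral (indicatorOfClopen _ (isClopen_hullSet v) (isCompact_hullSet v))
  convert h using 2 with μ
  exact (integral_indicator_one (isOpen_hullSet v).measurableSet).symm

theorem limitPoint_zpowers_of_mem_hullSet (a : Fin N) :
    limitPoint _ (zpowers_of_ne_bot a) ∈ hullSet 1 := by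
  obtain ⟨ξ, hξ⟩ := limitSetOf_range_pow_nonempty (of_ne_one a)
  obtain ⟨η, hη⟩ := limitSetOf_range_pow_inv_nonempty (of_ne_one a)
  have h := limitSet_zpowers (FreeGroup.of a)
  refine mem_Conv_iff.2 ⟨ξ, h.symm.subset (Or.inl hξ), η, h.symm.subset (Or.inr hη), ?_⟩
  have h1 := dir_of_mem_limitSetOf_of_pow a 0 hξ
  have h2 := dir_inv_of_mem_limitSetOf_pow_inv a 0 hη
  simp only [pow_zero, zero_add, pow_one, inv_one] at h1 h2
  rw [h1, h2]
  intro h3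
  simpa [FreeGroup.invRev] using congrArg FreeGroup.toWord h3

theorem cyclicCurrent_of_hullSet_ne_zero (a : Fin N) :
    (cyclicCurrent (FreeGroup.of a) : Measure (ClosedSets N)) (hullSet 1) ≠ 0 := by
  rw [coe_cyclicCurrent (zpowers_of_ne_bot a),
    cosetCounting_apply _ _ (isOpen_hullSet 1).measurableSet]
  refine (ENNReal.le_tsum ((1 : F N) : F N ⧸ Subgroup.zpowers (FreeGroup.of a))).trans_lt' ?_ |>.ne'
  rw [translate_mk_out (fun h hh => translate_limitPoint_of_mem _ hh), translate_one,
    Set.indicator_of_mem (limitPoint_zpowers_of_mem_hullSet a)]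
  exact one_pos

theorem not_continuous_of_extendsProduct (hN : 2 ≤ N)
    {Φ : SCurr N →ₗ[ℝ≥0] SCurr N →ₗ[ℝ≥0] SCurr N} (hΦ : ExtendsProduct Φ) :
    ¬ Continuous fun p : SCurr N × SCurr N => Φ p.1 p.2 := by
  intro hcont
  set a : Fin N := ⟨0, by omega⟩
  set b : Fin N := ⟨1, by omega⟩
  have hab : a ≠ b := by simp [a, b]
  have h1 := (((continuous_real_hullSet 1).comp hcont).tendsto (cyclicCurrent (FreeGroup.of a),
    cyclicCurrent (FreeGroup.of a))).comp
      ((tendsto_averagedCurrent hab).prodMk_nhds tendsto_const_nhds)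
  have h2 : ∀ n, Φ (averagedCurrent a b n) (cyclicCurrent (FreeGroup.of a)) = 0 := fun n => by
    rw [averagedCurrent, map_smul, LinearMap.smul_apply]
    have : Φ (cyclicCurrent (FreeGroup.of a ^ n * FreeGroup.of b))
        (cyclicCurrent (FreeGroup.of a)) = 0 := Subtype.ext <|
      (hΦ _ _ (fg_zpowers _) (fg_zpowers _) _ _ rfl rfl).trans
        (doubleCosetSum_zpowers_eq_zero hab n)
    rw [this, smul_zero]
  -- Continuity would force the product at the limit to have mass zero on `hullSet 1`, contradicting
  -- the contribution of the trivial double coset.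
  have h3 := tendsto_nhds_unique h1 (tendsto_const_nhds.congr fun n => by
    simp only [Function.comp_apply, h2]
    rfl : Filter.Tendsto _ _ (𝓝 ((0 : Measure (ClosedSets N)).real (hullSet 1))))
  simp only [Function.comp_apply, measureReal_zero_apply] at h3
  rw [measureReal_def, ENNReal.toReal_eq_zero_iff] at h3
  have h4 := h3.resolve_right (measure_hullSet_lt_top _ _).ne
  rw [hΦ _ _ (fg_zpowers _) (fg_zpowers _) _ _ rfl rfl] at h4
  exact cyclicCurrent_of_hullSet_ne_zero a
    (le_antisymm ((counting_le_doubleCosetSum _ _).trans h4.le) bot_le)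

end

end SubsetCurrents

theorem theorem4p2 (N : ℕ) (hN : 2 ≤ N) :
    -- the counting measures of finitely generated subgroups are subset currents
    (∀ H : Subgroup (SubsetCurrents.F N), H.FG →
      SubsetCurrents.counting H ∈ SubsetCurrents.SCurr N) ∧
    -- preimages of Borel sets under the intersection map are measurable
    (∀ U : Set (SubsetCurrents.ClosedSets N), MeasurableSet U →
      MeasurableSet (SubsetCurrents.interPreimage U)) ∧
    -- the pushforward is a subset current and a bilinear, non-continuous function of `(μ, ν)`,
    -- with the stated values on counting currents, and `rk ∘ Î = 𝒩`
    (∃ I : SubsetCurrents.SCurr N →ₗ[ℝ≥0] SubsetCurrents.SCurr N →ₗ[ℝ≥0] SubsetCurrents.SCurr N,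
      (∀ (μ ν : SubsetCurrents.SCurr N) (U : Set (SubsetCurrents.ClosedSets N)), MeasurableSet U →
        (I μ ν : Measure (SubsetCurrents.ClosedSets N)) U =
          ((μ : Measure (SubsetCurrents.ClosedSets N)).prod
            (ν : Measure (SubsetCurrents.ClosedSets N))) (SubsetCurrents.interPreimage U)) ∧
      (∀ μ ν : SubsetCurrents.SCurr N,
        SubsetCurrents.contractibleFunctional μ ν < ∞ ∧
        SubsetCurrents.reducedRank (I μ ν) = SubsetCurrents.intersectionFunctional μ ν) ∧
      SubsetCurrents.ExtendsProduct I ∧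
      ¬ Continuous fun p : SubsetCurrents.SCurr N × SubsetCurrents.SCurr N => I p.1 p.2) ∧
    -- no bilinear map with these values on counting currents is continuous
    (∀ Φ : SubsetCurrents.SCurr N →ₗ[ℝ≥0] SubsetCurrents.SCurr N →ₗ[ℝ≥0] SubsetCurrents.SCurr N,
      SubsetCurrents.ExtendsProduct Φ →
      ¬ Continuous fun p : SubsetCurrents.SCurr N × SubsetCurrents.SCurr N => Φ p.1 p.2) := by
  refine ⟨fun H hH => SubsetCurrents.counting_mem_SCurr hH,
    fun U hU => SubsetCurrents.measurableSet_interPreimage hU,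
    ⟨SubsetCurrents.interBilin N, fun μ ν U hU => SubsetCurrents.interCurrent_apply μ ν hU,
      fun μ ν => ⟨SubsetCurrents.contractibleFunctional_lt_top μ ν,
        SubsetCurrents.reducedRank_interCurrent μ ν⟩,
      SubsetCurrents.extendsProduct_interBilin,
      SubsetCurrents.not_continuous_of_extendsProduct hN SubsetCurrents.extendsProduct_interBilin⟩,
    fun Φ hΦ => SubsetCurrents.not_continuous_of_extendsProduct hN hΦ⟩
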